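/- Let $n\ge 1$ and $0<a<1$. Write $x=(x',x_n)\in\mathbb R^{n-1}\times\mathbb R$, $\langle\eta\rangle=(1+|\eta|^2)^{1/2}$, $\mathbb R^n_+=\{x_n>0\}$, let $\overline{\mathbb R}^n_+=\{x_n\ge 0\}$, let $r^+$ be restriction to $\mathbb R^n_+$ and $e^+$ extension by zero to $\mathbb R^n$. For $s\in\mathbb R$ let $H^s(\mathbb R^n)=\{u\in\mathcal S'(\mathbb R^n):\langle\xi\rangle^s\hat u\in L_2\}$, $\overline H^s(\mathbb R^n_+)=r^+H^s(\mathbb R^n)$ (with the quotient norm), $\dot H^s(\overline{\mathbb R}^n_+)=\{u\in H^s(\mathbb R^n):\operatorname{supp}u\subset\overline{\mathbb R}^n_+\}$, and $\mathcal S(\overline{\mathbb R}^n_+)=r^+\mathcal S(\mathbb R^n)$. Let $\Xi_+^t$ be the Fourier multiplier with symbol $(\langle\xi'\rangle+i\xi_n)^t$, and for $t>a-\frac12$ put $$H^{a(t)}(\overline{\mathbb R}^n_+)=\Xi_+^{-a}e^+\overline H^{t-a}(\mathbb R^n_+),$$ normed so that $\Xi_+^{-a}e^+$ is isometric from $\overline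 H^{t-a}(\mathbb R^n_+)$. Let $K_0\psi=\mathcal F^{-1}_{\xi'\to x'}\bigl(1_{\{x_n>0\}}e^{-\langle\xi'\rangle x_n}\hat\psi(\xi')\bigr)$ be the Poisson operator for the Dirichlet problem of $1-\Delta$ on $\mathbb R^n_+$. Functions on $\mathbb R^n_+$ such as $x_n^aK_0\psi$ and $x_n^a\varphi$ are extended by zero to $\mathbb R^n$. $1^\circ$ Let $\frac12<a<1$. For every $\psi\in H^{a-\frac12}(\mathbb R^{n-1})$ the function $x_n^aK_0\psi$ is a tempered distribution, and a tempered distribution $u$ on $\mathbb R^n$ belongs to $H^{a(2a)}(\overline{\mathbb R}^n_+)$ if and only if $$u=v+x_n^aK_0\psi\quad\text{with } v\in\dot H^{2a}(\overline{\mathbb R}^n_+),\ \psi\in H^{a-\frac12}(\mathbb R^{n-1}).\tag{$*$}$$ $2^\circ$ Let $0<a<1$ and $t>a+\frac12$. Then $x_n^a\mathcal S(\overline{\mathbb R}^n_+)$ is a dense subspace of $H^{a(t)}(\overline{\mathbb R}^n_+)$, and the map $\gamma_0^a$ given there by $u=x_n^a\varphi\mapsto\gamma_0(u/x_n^a)=\varphi(\cdot,0)$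 extends in a unique way to a continuous linear map $$\gamma_0^a\colon H^{a(t)}(\overline{\mathbb R}^n_+)\to H^{t-a-\frac12}(\mathbb R^{n-1}).$$ If moreover $\frac12<a<1$ and $t=2a$, then $\psi=\gamma_0^au$ in every decomposition $(*)$ of $u\in H^{a(2a)}(\overline{\mathbb R}^n_+)$. -/

import Mathlib

open MeasureTheory TemperedDistribution Distribution FourierTransform
open scoped SchwartzMap ENNReal NNReal

noncomputable section

namespace HalfSpace

/-- `ℝ^k` with its Euclidean norm. The half-space lives in `Euc (d + 1)`, so `n = d + 1`. -/
abbrev Euc (k : ℕ) : Type := EuclideanSpace ℝ (Fin k)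

variable {d : ℕ}

/-- The last coordinate `x_n` of `x = (x', x_n)`. -/
def nrm (x : Euc (d + 1)) : ℝ := x (Fin.last d)

/-- The tangential part `x'` of `x = (x', x_n)`. -/
def tang (x : Euc (d + 1)) : Euc d := WithLp.toLp 2 fun i => x i.castSucc

/-- The boundary point `(x', 0)`. -/
def bdry (y : Euc d) : Euc (d + 1) := WithLp.toLp 2 (Fin.snoc (α := fun _ => ℝ) (fun i => y i) 0)

/-- The open half-space `ℝ^n_+ = {x_n > 0}`. -/
def openHalf (d : ℕ) : Set (Euc (d + 1)) := {x | 0 < nrm x}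

/-- The closed half-space `{x_n ≥ 0}`. -/
def closedHalf (d : ℕ) : Set (Euc (d + 1)) := {x | 0 ≤ nrm x}

/-- `⟨η⟩ = (1 + |η|²)^{1/2}`. -/
def bracket {k : ℕ} (η : Euc k) : ℝ := Real.sqrt (1 + ‖η‖ ^ 2)

/-- The tempered distribution `u` is the function `f`. -/
def IsRepBy {k : ℕ} (u : 𝓢'(Euc k, ℂ)) (f : Euc k → ℂ) : Prop :=
  ∀ φ : 𝓢(Euc k, ℂ), Integrable (fun x => φ x * f x) ∧ u φ = ∫ x, φ x * f x

/-- The Sobolev space `H^s(ℝ^k)` of tempered distributions `u` with `⟨ξ⟩^s û ∈ L²`. -/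
def sobolev (k : ℕ) (s : ℝ) : Submodule ℂ 𝓢'(Euc k, ℂ) where
  carrier := {u | MemSobolev s 2 u}
  add_mem' hu hv := hu.add hv
  zero_mem' := memSobolev_fun_zero _ _ s 2
  smul_mem' c _ hu := hu.smul c

/-- The norm of `H^s(ℝ^k)`, with value `∞` outside `H^s`: the `L²` norm of the function that
`besselPotential s u` is. (Mathlib normalizes the Fourier transform with `e^{-2πi x·ξ}`, hence this
is `‖(1 - (2π)⁻² Δ)^{s/2} u‖`, equivalent to `‖(1 - Δ)^{s/2} u‖`.) -/
def sobolevENorm {k : ℕ} (s : ℝ) (u : 𝓢'(Euc k, ℂ)) : ℝ≥0∞ :=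
  ⨅ (f : Lp ℂ 2 (volume : Measure (Euc k))) (_ : besselPotential (Euc k) ℂ s u = f), ‖f‖ₑ

theorem dsupport_add_subset {k : ℕ} {C : Set (Euc k)} {u v : 𝓢'(Euc k, ℂ)}
    (hu : dsupport u ⊆ C) (hv : dsupport v ⊆ C) : dsupport (u + v) ⊆ C := by
  intro x hx
  by_contra hxC
  obtain ⟨s, hs, hso, hxs⟩ := (notMem_dsupport_iff x).1 fun h => hxC (hu h)
  obtain ⟨r, hr, hro, hxr⟩ := (notMem_dsupport_iff x).1 fun h => hxC (hv h)
  refine (notMem_dsupport_iff x).2 ⟨s ∩ r, fun φ hφ => ?_, hso.inter hro, hxs, hxr⟩ hx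
  have h1 := hs φ (hφ.trans Set.inter_subset_left)
  have h2 := hr φ (hφ.trans Set.inter_subset_right)
  change u φ + v φ = 0
  rw [h1, h2, add_zero]

theorem dsupport_smul_subset' {k : ℕ} {C : Set (Euc k)} {u : 𝓢'(Euc k, ℂ)} (c : ℂ)
    (hu : dsupport u ⊆ C) : dsupport (c • u) ⊆ C := by
  intro x hx
  by_contra hxC
  obtain ⟨s, hs, hso, hxs⟩ := (notMem_dsupport_iff x).1 fun h => hxC (hu h)
  refine (notMem_dsupport_iff x).2 ⟨s, fun φ hφ => ?_, hso, hxs⟩ hx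
  change c • u φ = 0
  rw [hs φ hφ, smul_zero]

theorem dsupport_zero_subset {k : ℕ} {C : Set (Euc k)} :
    dsupport (0 : 𝓢'(Euc k, ℂ)) ⊆ C := fun x hx =>
  absurd hx ((notMem_dsupport_iff x).2 ⟨Set.univ, fun _ _ => rfl, isOpen_univ, trivial⟩)

/-- The space `Ḣ^s` of the `u ∈ H^s(ℝ^n)` with support in the closed half-space. -/
def supported (d : ℕ) (s : ℝ) : Submodule ℂ 𝓢'(Euc (d + 1), ℂ) where
  carrier := {u | u ∈ sobolev (d + 1) s ∧ dsupport u ⊆ closedHalf d}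
  add_mem' hu hv := ⟨add_mem hu.1 hv.1, dsupport_add_subset hu.2 hv.2⟩
  zero_mem' := ⟨zero_mem _, dsupport_zero_subset⟩
  smul_mem' c _ hu := ⟨Submodule.smul_mem _ c hu.1, dsupport_smul_subset' c hu.2⟩

/-- `g = e⁺ r⁺ F` for `F ∈ H^r(ℝ^n)`, `r > -1/2`: restriction of `F` to the open half-space followed
by extension by zero. For `r ≥ 0`, `g` is the `L²` function equal to `F` for `x_n > 0` and to `0` for
`x_n < 0`; for `-1/2 < r < 0` it is the unique element of `Ḣ^r` that restricts to `r⁺ F`. -/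
def IsCutoff (r : ℝ) (F g : 𝓢'(Euc (d + 1), ℂ)) : Prop :=
  g ∈ supported d (min r 0) ∧ IsVanishingOn (g - F) (openHalf d)

/-- The symbol `(⟨η'⟩ + i η_n)^t`, at `η = 2πξ` because of Mathlib's Fourier transform. -/
def xiSymbol (t : ℝ) (ξ : Euc (d + 1)) : ℂ :=
  ((bracket ((2 * Real.pi) • tang ξ) : ℂ) + Complex.I * (2 * Real.pi * nrm ξ : ℝ)) ^ (t : ℂ)

/-- The order-reducing operator `Ξ_+^t = Op((⟨ξ'⟩ + i ξ_n)^t)`. -/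
def Xi (t : ℝ) : 𝓢'(Euc (d + 1), ℂ) →L[ℂ] 𝓢'(Euc (d + 1), ℂ) :=
  fourierMultiplierCLM ℂ (xiSymbol t)

/-- The `a`-transmission space `H^{a(t)} = Ξ_+^{-a} e⁺ r⁺ H^{t-a}(ℝ^n)`, for `t - a > -1/2`. -/
def transmission (d : ℕ) (a t : ℝ) : Submodule ℂ 𝓢'(Euc (d + 1), ℂ) where
  carrier := {u | ∃ F g, F ∈ sobolev (d + 1) (t - a) ∧ IsCutoff (t - a) F g ∧ u = Xi (-a) g}
  add_mem' := by
    rintro _ _ ⟨F, g, hF, hg, rfl⟩ ⟨F', g', hF', hg', rfl⟩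
    refine ⟨F + F', g + g', add_mem hF hF', ⟨add_mem hg.1 hg'.1, fun φ hφ => ?_⟩, ?_⟩
    · have h1 := hg.2 φ hφ
      have h2 := hg'.2 φ hφ
      rw [add_sub_add_comm]
      change (g - F) φ + (g' - F') φ = 0
      rw [h1, h2, add_zero]
    · rw [map_add]
  zero_mem' := ⟨0, 0, zero_mem _, ⟨zero_mem _, fun _ _ => by rw [sub_zero]; rfl⟩, by rw [map_zero]⟩
  smul_mem' := by
    rintro c _ ⟨F, g, hF, hg, rfl⟩
    refine ⟨c • F, c • g, Submodule.smul_mem _ c hF,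
      ⟨Submodule.smul_mem _ c hg.1, fun φ hφ => ?_⟩, ?_⟩
    · have h : g φ - F φ = 0 := hg.2 φ hφ
      change c • g φ - c • F φ = 0
      rw [← smul_sub, h, smul_zero]
    · rw [map_smul]

/-- The norm of `u = Ξ_+^{-a} e⁺ f` in `H^{a(t)}`: the norm of `f` in the restricted space
`r⁺ H^{t-a}(ℝ^n)`, that is, the infimum of the norms of the `F ∈ H^{t-a}(ℝ^n)` with `r⁺ F = f`. -/
def transmissionENorm (a t : ℝ) (u : 𝓢'(Euc (d + 1), ℂ)) : ℝ≥0∞ :=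
  ⨅ (F : 𝓢'(Euc (d + 1), ℂ)) (g : 𝓢'(Euc (d + 1), ℂ))
    (_ : IsCutoff (t - a) F g ∧ u = Xi (-a) g), sobolevENorm (t - a) F

/-- `K₀ψ`, extended by zero, for `ψ ∈ L²(ℝ^{n-1})`, where `K₀` is the Poisson operator
`ψ ↦ 𝓕⁻¹_{ξ' → x'} (1_{x_n > 0} e^{-⟨ξ'⟩ x_n} ψ̂(ξ'))` of the Dirichlet problem for `1 - Δ`. -/
def poisson (ψ : Lp ℂ 2 (volume : Measure (Euc d))) (x : Euc (d + 1)) : ℂ :=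
  if 0 < nrm x then
    ∫ ξ : Euc d, Complex.exp (2 * Real.pi * inner ℝ (tang x) ξ * Complex.I) *
      Real.exp (-(bracket ((2 * Real.pi) • ξ) * nrm x)) *
      (𝓕 ψ : Lp ℂ 2 (volume : Measure (Euc d))) ξ
  else 0

/-- `x_n^a f`, extended by zero to `x_n ≤ 0`. -/
def nrmPowMul (a : ℝ) (f : Euc (d + 1) → ℂ) (x : Euc (d + 1)) : ℂ :=
  if 0 < nrm x then (nrm x ^ a : ℝ) * f x else 0

/-- `γ` is a continuous linear map `H^{a(t)} → H^{t-a-1/2}(ℝ^{n-1})` that extends the map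
`u = x_n^a φ ↦ φ(·, 0) = γ₀(u / x_n^a)`, where `φ` is the restriction of a Schwartz function on `ℝ^n`
to the half-space. -/
def IsTrace (a t : ℝ) (γ : transmission d a t →ₗ[ℂ] sobolev d (t - a - 1 / 2)) : Prop :=
  (∃ C : ℝ≥0, ∀ u : transmission d a t,
    sobolevENorm (t - a - 1 / 2) (γ u : 𝓢'(Euc d, ℂ)) ≤
      C * transmissionENorm a t (u : 𝓢'(Euc (d + 1), ℂ))) ∧
  ∀ (φ : 𝓢(Euc (d + 1), ℂ)) (u : transmission d a t),
    IsRepBy (u : 𝓢'(Euc (d + 1), ℂ)) (nrmPowMul a φ) →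
      IsRepBy (γ u : 𝓢'(Euc d, ℂ)) fun y => φ (bdry y)

end HalfSpace

end

/-!
Since `t - a > 1/2`, every element of `H^{t-a}` is a square integrable function, so the whole problem
can be treated on the Fourier side in `L²`. Write `λ = ⟨ξ'⟩ + iξ_n`. An element of `H^{a(t)}` is
`u = Ξ_+^{-a} e⁺ r⁺ F` with `F ∈ H^{t-a}`, that is, `û` is `λ^{-a}` times the Fourier transform of the
truncation of `F` (`mem_transmission_iff`).

*Support.* For a profile `q` on the line, the inverse Fourier transform in `ξ'` of
`f(ξ') q(⟨ξ'⟩ x_n)` is explicit; with `q(x) = x_+^b e^{-x}` its Fourier transform is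
`Γ(b+1) f(ξ') λ^{-b-1}`, up to a power of `⟨ξ'⟩` absorbed in `f` (`fourier_gam`). Hence
`x_n^b K₀ψ` has the Fourier transform `Γ(b+1) ψ̂(ξ') λ^{-b-1}` (`ae_eq_nrmPowMul_poisson`), and in
particular `x_n^a K₀ψ = Γ(a+1) Ξ_+^{-a} K₀ψ`. The functions `f(ξ') λ^{-k-1}` and
`f(ξ') conj(λ)^{-k-1}` are complete in `L²(ℝ^n)` by Stone–Weierstrass on each fibre
(`ae_eq_zero_of_forall_xiSymbol`), so support in the upper half-space is the same as orthogonality to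
the second family (`isUpper_of_forall_integral`). This shows that `Ξ_+^{-b}`, `b ≥ 0`, preserves such
support, and that so does `Ξ_+^a`, `a < 1`, on `H^a` (`isUpper_of_fourier_eq_xiSymbol`).

*Trace.* The boundary value of `F ∈ H^r`, `r > 1/2`, has the Fourier transform `∫ F̂(ξ', ξ_n) dξ_n`
(`fiberInt`), and Cauchy–Schwarz gives the bound `H^r → H^{r-1/2}` (`eLpNorm_fiberInt_le`). A function
of `H^r` that vanishes on one side of the boundary has trace zero (`fiberInt_fourier_ae_eq_zero`), so
the trace of `F` depends only on `u`, and `γ₀^a u = Γ(a+1)^{-1} γ₀F` (`IsTraceOf`).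

*Decomposition, `t = 2a`.* If `v` is in `H^{2a}` and supported in the closed half-space, then
`Ξ_+^a v` is an `L²` function of the upper half-space in `H^a`, so `v` belongs to `H^{a(2a)}` with
trace zero; and `x_n^a K₀ψ` belongs to it with trace `ψ`, because `K₀ψ` extends to a function of `H^a`
on the whole space (`extend`). Conversely, if `F` and the extension belonging to `ψ = γ₀^a u` have the
same trace, then their difference can be truncated within `H^a` (`hNorm_cut_lt_top`), and
`Ξ_+^{-a}` of the truncation is the required `v`. The truncation theorem is proved by solving a
Wiener–Hopf equation with the symbol `(λ / conj λ)^{1-a}`. Its real part is bounded below by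
`cos (π(1-a)) > 0`, so that the equation is solved by a contraction; partial fractions and the
vanishing of the traces identify the solution.

*The space `x_n^a 𝒮`.* By Taylor expansion at the boundary, a Schwartz function `φ` is a finite sum of
terms that equal `x_n^k K₀f_k` in the half-space, plus a remainder `R` vanishing to high order. For
the former, the formula with `Γ` gives `x_n^{a+k} K₀f_k = c Ξ_+^{-a} (x_n^k K₀f_k)`; and
`x_n^a R` has so much regularity on the whole space that `Ξ_+^a` can be applied to it
(`exists_isLift`). For density, let `F̂ = f(ξ') conj(λ)^{-m} λ^{-k}`. Partial fractions and the formula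
with `Γ` show that `Ξ_+^{-a} e⁺ r⁺ F` is in `x_n^a 𝒮`, while completeness shows that these `F` span a
dense subspace of `H^{t-a}` (`exists_hNorm_sub_lt`). Density and continuity give uniqueness of the
trace map (`IsTrace.unique`).
-/

noncomputable section

namespace HalfSpace

variable {d : ℕ}

/-! ### Tempered distributions given by square integrable functions -/

/-- The Hilbert space `L²(ℝ^k)`. -/
abbrev L2 (k : ℕ) : Type := Lp ℂ 2 (volume : Measure (Euc k))

/-- The weight `(1 + |ξ|²)^{s/2}` of the Bessel potential of order `s`. -/
def wt {k : ℕ} (s : ℝ) (ξ : Euc k) : ℝ := (1 + ‖ξ‖ ^ 2) ^ (s / 2)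

/-- The norm of `H^s(ℝ^k)` on `L²` functions, computed on the Fourier side, with value `∞` outside
`H^s`. -/
def hNorm {k : ℕ} (s : ℝ) (U : L2 k) : ℝ≥0∞ :=
  eLpNorm (fun ξ => (wt s ξ : ℂ) * (𝓕 U : L2 k) ξ) 2 volume

theorem wt_pos {k : ℕ} (s : ℝ) (ξ : Euc k) : 0 < wt s ξ := by
  unfold wt; positivity

theorem wt_temperate {k : ℕ} (s : ℝ) :
    (fun ξ : Euc k => ((wt s ξ : ℝ) : ℂ)).HasTemperateGrowth := by
  unfold wt; fun_prop

theorem wt_continuous {k : ℕ} (s : ℝ) : Continuous (wt s : Euc k → ℝ) := by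
  have : (wt s : Euc k → ℝ).HasTemperateGrowth := by unfold wt; fun_prop
  exact this.1.continuous

theorem integrable_schwartz_mul_memLp {k : ℕ} (φ : 𝓢(Euc k, ℂ)) {f : Euc k → ℂ}
    (hf : MemLp f 2 volume) : Integrable (fun x => φ x * f x) :=
  (φ.memLp 2).integrable_mul hf

theorem coe_apply {k : ℕ} (U : L2 k) (φ : 𝓢(Euc k, ℂ)) :
    (U : 𝓢'(Euc k, ℂ)) φ = ∫ x, φ x * U x := by
  simp [Lp.toTemperedDistribution_apply]

theorem coe_add {k : ℕ} (U V : L2 k) :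
    ((U + V : L2 k) : 𝓢'(Euc k, ℂ)) = (U : 𝓢'(Euc k, ℂ)) + V :=
  map_add (Lp.toTemperedDistributionCLM ℂ (volume : Measure (Euc k)) 2) U V

theorem coe_sub {k : ℕ} (U V : L2 k) :
    ((U - V : L2 k) : 𝓢'(Euc k, ℂ)) = (U : 𝓢'(Euc k, ℂ)) - V :=
  map_sub (Lp.toTemperedDistributionCLM ℂ (volume : Measure (Euc k)) 2) U V

theorem coe_smul {k : ℕ} (c : ℂ) (U : L2 k) :
    ((c • U : L2 k) : 𝓢'(Euc k, ℂ)) = c • (U : 𝓢'(Euc k, ℂ)) :=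
  map_smul (Lp.toTemperedDistributionCLM ℂ (volume : Measure (Euc k)) 2) c U

/-- Two locally integrable functions that agree as distributions on an open set agree almost
everywhere there. -/
theorem ae_eq_of_schwartz_on {k : ℕ} {s : Set (Euc k)} (hs : IsOpen s) {f g : Euc k → ℂ}
    (hf : LocallyIntegrableOn f s) (hg : LocallyIntegrableOn g s)
    (h : ∀ φ : 𝓢(Euc k, ℂ), HasCompactSupport φ → tsupport φ ⊆ s →
      ∫ x, φ x * f x = ∫ x, φ x * g x) :
    ∀ᵐ x, x ∈ s → f x = g x := by
  have key := hs.ae_eq_zero_of_integral_contDiff_smul_eq_zero (μ := volume) (f := fun x => f x - g x)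
    (hf.sub hg) (fun φ hφ hc hsupp => ?_)
  · filter_upwards [key] with x hx hxs
    exact sub_eq_zero.1 (hx hxs)
  · have hc' : HasCompactSupport (Complex.ofRealCLM ∘ φ) := hc.comp_left rfl
    have hd : ContDiff ℝ (⊤ : ℕ∞) (Complex.ofRealCLM ∘ φ) := by fun_prop
    have hsub : tsupport (Complex.ofRealCLM ∘ φ) ⊆ s :=
      (closure_mono (Function.support_comp_subset rfl φ)).trans hsupp
    have h1 := h (hc'.toSchwartzMap hd) hc' hsub
    have hint : ∀ q : Euc k → ℂ, LocallyIntegrableOn q s →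
        Integrable (fun x => (φ x : ℂ) * q x) := by
      intro q hq
      have h2 : IntegrableOn q (tsupport φ) := hq.integrableOn_compact_subset hsupp hc
      have h3 : IntegrableOn (fun x => (φ x : ℂ) * q x) (tsupport φ) :=
        h2.continuousOn_mul (Complex.continuous_ofReal.comp hφ.continuous).continuousOn hc
      rw [← integrableOn_iff_integrable_of_support_subset (s := tsupport φ)]
      · exact h3
      · intro x hx
        apply subset_tsupport
        intro h0
        apply hx
        simp [h0]
    have h4 : ∫ x, (φ x : ℂ) * f x = ∫ x, (φ x : ℂ) * g x := h1
    simp only [Complex.real_smul, mul_sub]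
    rw [integral_sub (hint f hf) (hint g hg), h4, sub_self]

theorem ae_eq_of_schwartz {k : ℕ} {f g : Euc k → ℂ}
    (hf : LocallyIntegrable f) (hg : LocallyIntegrable g)
    (h : ∀ φ : 𝓢(Euc k, ℂ), ∫ x, φ x * f x = ∫ x, φ x * g x) : f =ᵐ[volume] g := by
  have := ae_eq_of_schwartz_on isOpen_univ (hf.locallyIntegrableOn _) (hg.locallyIntegrableOn _)
    fun φ _ _ => h φ
  filter_upwards [this] with x hx using hx trivial

theorem locallyIntegrable_continuous_mul {k : ℕ} {m : Euc k → ℂ} (hm : Continuous m) (U : L2 k) :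
    LocallyIntegrable (fun x => m x * U x) := by
  have h0 : LocallyIntegrable (U : Euc k → ℂ) := (Lp.memLp U).locallyIntegrable (by norm_num)
  rw [← locallyIntegrableOn_univ] at h0 ⊢
  rw [locallyIntegrableOn_iff isOpen_univ.isLocallyClosed] at h0 ⊢
  exact fun K hK hc => (h0 K hK hc).continuousOn_mul hm.continuousOn hc

theorem smulLeftCLM_coe_eq_iff {k : ℕ} {m : Euc k → ℂ} (hm : m.HasTemperateGrowth) (U V : L2 k) :
    TemperedDistribution.smulLeftCLM ℂ m (U : 𝓢'(Euc k, ℂ)) = V ↔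
      (V : Euc k → ℂ) =ᵐ[volume] fun ξ => m ξ * U ξ := by
  have hev : ∀ φ : 𝓢(Euc k, ℂ), TemperedDistribution.smulLeftCLM ℂ m (U : 𝓢'(Euc k, ℂ)) φ =
      ∫ x, φ x * (m x * U x) := by
    intro φ
    rw [smulLeftCLM_apply_apply, coe_apply]
    refine integral_congr_ae (ae_of_all _ fun x => ?_)
    simp only [SchwartzMap.smulLeftCLM_apply_apply hm, smul_eq_mul]
    ring
  constructor
  · intro h
    refine ae_eq_of_schwartz ((Lp.memLp V).locallyIntegrable (by norm_num))
      (locallyIntegrable_continuous_mul hm.1.continuous U) fun φ => ?_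
    rw [← hev, h, coe_apply]
  · intro h
    ext φ
    rw [hev, coe_apply]
    refine integral_congr_ae ?_
    filter_upwards [h] with x hx
    rw [hx]

theorem fourierMultiplier_coe_eq_iff {k : ℕ} {m : Euc k → ℂ} (hm : m.HasTemperateGrowth)
    (U V : L2 k) : TemperedDistribution.fourierMultiplierCLM ℂ m (U : 𝓢'(Euc k, ℂ)) = V ↔
      ((𝓕 V : L2 k) : Euc k → ℂ) =ᵐ[volume] fun ξ => m ξ * (𝓕 U : L2 k) ξ := by
  rw [← smulLeftCLM_coe_eq_iff hm, ← Lp.fourier_toTemperedDistribution_eq,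
    ← Lp.fourier_toTemperedDistribution_eq, TemperedDistribution.fourierMultiplierCLM_apply]
  constructor
  · intro h
    rw [← h, fourier_fourierInv_eq]
  · intro h
    rw [h, fourierInv_fourier_eq]

theorem besselPotential_coe_eq_iff {k : ℕ} (s : ℝ) (U V : L2 k) :
    besselPotential (Euc k) ℂ s (U : 𝓢'(Euc k, ℂ)) = V ↔
      ((𝓕 V : L2 k) : Euc k → ℂ) =ᵐ[volume] fun ξ => (wt s ξ : ℂ) * (𝓕 U : L2 k) ξ :=
  fourierMultiplier_coe_eq_iff (wt_temperate s) U V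

/-- The `L²` function with a given square integrable Fourier transform. -/
def ofHat {k : ℕ} {g : Euc k → ℂ} (hg : MemLp g 2 volume) : L2 k := 𝓕⁻ (hg.toLp g)

theorem fourier_ofHat {k : ℕ} {g : Euc k → ℂ} (hg : MemLp g 2 volume) :
    ((𝓕 (ofHat hg) : L2 k) : Euc k → ℂ) =ᵐ[volume] g := by
  rw [ofHat, fourier_fourierInv_eq]
  exact hg.coeFn_toLp

theorem eq_of_fourier_ae_eq {k : ℕ} {U V : L2 k}
    (h : ((𝓕 U : L2 k) : Euc k → ℂ) =ᵐ[volume] (𝓕 V : L2 k)) : U = V := by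
  have h1 : (𝓕 U : L2 k) = 𝓕 V := Lp.ext h
  have h2 := congrArg (fun W : L2 k => (𝓕⁻ W : L2 k)) h1
  simpa using h2

theorem fourier_add_ae {k : ℕ} (U V : L2 k) :
    ((𝓕 (U + V) : L2 k) : Euc k → ℂ) =ᵐ[volume] fun ξ => (𝓕 U : L2 k) ξ + (𝓕 V : L2 k) ξ := by
  rw [FourierAdd.fourier_add]
  exact Lp.coeFn_add _ _

theorem fourier_sub_ae {k : ℕ} (U V : L2 k) :
    ((𝓕 (U - V) : L2 k) : Euc k → ℂ) =ᵐ[volume] fun ξ => (𝓕 U : L2 k) ξ - (𝓕 V : L2 k) ξ := by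
  have : (𝓕 (U - V) : L2 k) = 𝓕 U - 𝓕 V := map_sub (Lp.fourierTransformₗᵢ (Euc k) ℂ) U V
  rw [this]
  exact Lp.coeFn_sub _ _

theorem fourier_smul_ae {k : ℕ} (c : ℂ) (U : L2 k) :
    ((𝓕 (c • U) : L2 k) : Euc k → ℂ) =ᵐ[volume] fun ξ => c * (𝓕 U : L2 k) ξ := by
  rw [FourierSMul.fourier_smul]
  exact Lp.coeFn_smul _ _

theorem aestronglyMeasurable_wt_fourier {k : ℕ} (s : ℝ) (U : L2 k) :
    AEStronglyMeasurable (fun ξ => (wt s ξ : ℂ) * (𝓕 U : L2 k) ξ) volume :=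
  (wt_temperate s).1.continuous.aestronglyMeasurable.mul (Lp.aestronglyMeasurable _)

theorem memLp_of_hNorm {k : ℕ} {s : ℝ} {U : L2 k} (h : hNorm s U < ∞) :
    MemLp (fun ξ => (wt s ξ : ℂ) * (𝓕 U : L2 k) ξ) 2 volume :=
  ⟨aestronglyMeasurable_wt_fourier s U, h⟩

theorem enorm_wt {k : ℕ} (s : ℝ) (ξ : Euc k) : ‖(wt s ξ : ℂ)‖ₑ = ENNReal.ofReal (wt s ξ) := by
  rw [← ofReal_norm, Complex.norm_real, Real.norm_of_nonneg (wt_pos s ξ).le]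

theorem wt_mono {k : ℕ} {s r : ℝ} (h : s ≤ r) (ξ : Euc k) : wt s ξ ≤ wt r ξ := by
  unfold wt
  exact Real.rpow_le_rpow_of_exponent_le (by nlinarith [sq_nonneg ‖ξ‖]) (by linarith)

theorem wt_zero {k : ℕ} (ξ : Euc k) : wt 0 ξ = 1 := by simp [wt]

theorem wt_add {k : ℕ} (s r : ℝ) (ξ : Euc k) : wt (s + r) ξ = wt s ξ * wt r ξ := by
  unfold wt
  rw [← Real.rpow_add (by positivity)]
  ring_nf

theorem wt_neg {k : ℕ} (s : ℝ) (ξ : Euc k) : wt (-s) ξ = (wt s ξ)⁻¹ := by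
  unfold wt
  rw [← Real.rpow_neg (by positivity)]
  ring_nf

theorem hNorm_mono {k : ℕ} {s r : ℝ} (h : s ≤ r) (U : L2 k) : hNorm s U ≤ hNorm r U := by
  refine eLpNorm_mono fun ξ => ?_
  rw [norm_mul, norm_mul, Complex.norm_real, Complex.norm_real, Real.norm_of_nonneg (wt_pos _ _).le,
    Real.norm_of_nonneg (wt_pos _ _).le]
  exact mul_le_mul_of_nonneg_right (wt_mono h ξ) (norm_nonneg _)

theorem hNorm_zero_order {k : ℕ} (U : L2 k) : hNorm 0 U = ‖U‖ₑ := by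
  unfold hNorm
  simp only [wt_zero, Complex.ofReal_one, one_mul]
  rw [← Lp.enorm_def, ← ofReal_norm, ← ofReal_norm, Lp.norm_fourier_eq]

theorem hNorm_add_le {k : ℕ} (s : ℝ) (U V : L2 k) : hNorm s (U + V) ≤ hNorm s U + hNorm s V := by
  unfold hNorm
  refine le_trans (le_of_eq ?_) (eLpNorm_add_le (aestronglyMeasurable_wt_fourier s U)
    (aestronglyMeasurable_wt_fourier s V) (by norm_num))
  refine eLpNorm_congr_ae ?_
  filter_upwards [fourier_add_ae U V] with ξ h
  simp only [Pi.add_apply, h]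
  ring

theorem hNorm_smul {k : ℕ} (s : ℝ) (c : ℂ) (U : L2 k) : hNorm s (c • U) = ‖c‖ₑ * hNorm s U := by
  unfold hNorm
  rw [← eLpNorm_const_smul]
  refine eLpNorm_congr_ae ?_
  filter_upwards [fourier_smul_ae c U] with ξ h
  simp only [Pi.smul_apply, h, smul_eq_mul]
  ring

theorem hNorm_sub_le {k : ℕ} (s : ℝ) (U V : L2 k) : hNorm s (U - V) ≤ hNorm s U + hNorm s V := by
  have h := hNorm_add_le s U ((-1 : ℂ) • V)
  rw [hNorm_smul] at h
  simpa [sub_eq_add_neg] using h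

theorem sobolevENorm_coe {k : ℕ} (s : ℝ) (U : L2 k) :
    sobolevENorm s (U : 𝓢'(Euc k, ℂ)) = hNorm s U := by
  unfold sobolevENorm
  have hval : ∀ f : L2 k, besselPotential (Euc k) ℂ s (U : 𝓢'(Euc k, ℂ)) = f →
      ‖f‖ₑ = hNorm s U := by
    intro f hf
    rw [besselPotential_coe_eq_iff] at hf
    rw [hNorm, ← eLpNorm_congr_ae hf, ← Lp.enorm_def, ← ofReal_norm, ← ofReal_norm,
      Lp.norm_fourier_eq]
  refine le_antisymm ?_ (le_iInf₂ fun f hf => (hval f hf).ge)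
  by_cases h : hNorm s U < ∞
  · have hf : besselPotential (Euc k) ℂ s (U : 𝓢'(Euc k, ℂ)) = ofHat (memLp_of_hNorm h) :=
      (besselPotential_coe_eq_iff s U _).2 (fourier_ofHat _)
    exact (iInf₂_le (ofHat (memLp_of_hNorm h)) hf).trans (hval _ hf).le
  · rw [not_lt, top_le_iff] at h
    rw [h]; exact le_top

theorem coe_mem_sobolev_iff {k : ℕ} (s : ℝ) (U : L2 k) :
    (U : 𝓢'(Euc k, ℂ)) ∈ sobolev k s ↔ hNorm s U < ∞ := by
  constructor
  · rintro ⟨f, hf⟩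
    rw [besselPotential_coe_eq_iff] at hf
    rw [hNorm, ← eLpNorm_congr_ae hf]
    exact (Lp.memLp _).2
  · intro h
    exact ⟨ofHat (memLp_of_hNorm h), (besselPotential_coe_eq_iff s U _).2 (fourier_ofHat _)⟩

theorem exists_coe_of_mem_sobolev {k : ℕ} {s : ℝ} (hs : 0 ≤ s) {u : 𝓢'(Euc k, ℂ)}
    (hu : u ∈ sobolev k s) : ∃ U : L2 k, u = U ∧ hNorm s U < ∞ := by
  have h0 : MemSobolev 0 2 u := MemSobolev.mono hs hu
  obtain ⟨U, hU⟩ := memSobolev_zero_iff.1 h0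
  exact ⟨U, hU, (coe_mem_sobolev_iff s U).1 (hU ▸ hu)⟩

theorem exists_coe_of_sobolevENorm {k : ℕ} {s : ℝ} (hs : 0 ≤ s) {u : 𝓢'(Euc k, ℂ)}
    (hu : sobolevENorm s u < ∞) : ∃ U : L2 k, u = U ∧ hNorm s U < ∞ := by
  refine exists_coe_of_mem_sobolev hs ?_
  unfold sobolevENorm at hu
  simp only [iInf_lt_iff] at hu
  obtain ⟨f, hf, -⟩ := hu
  exact ⟨f, hf⟩

theorem IsRepBy.unique {k : ℕ} {u v : 𝓢'(Euc k, ℂ)} {f : Euc k → ℂ} (hu : IsRepBy u f)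
    (hv : IsRepBy v f) : u = v := by
  ext φ
  rw [(hu φ).2, (hv φ).2]

theorem isRepBy_coe_of_ae_eq {k : ℕ} {U : L2 k} {f : Euc k → ℂ}
    (h : (U : Euc k → ℂ) =ᵐ[volume] f) : IsRepBy (U : 𝓢'(Euc k, ℂ)) f := by
  intro φ
  have h1 : (fun x => φ x * U x) =ᵐ[volume] fun x => φ x * f x := by
    filter_upwards [h] with x hx
    rw [hx]
  exact ⟨(integrable_schwartz_mul_memLp φ (Lp.memLp U)).congr h1, by
    rw [coe_apply, integral_congr_ae h1]⟩

/-! ### Splitting off the normal variable -/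

/-- The point `(x', x_n)` of `ℝ^n` with tangential part `y` and normal coordinate `s`. -/
def join (y : Euc d) (s : ℝ) : Euc (d + 1) :=
  WithLp.toLp 2 (Fin.snoc (α := fun _ => ℝ) (fun i => y i) s)

@[simp] theorem nrm_join (y : Euc d) (s : ℝ) : nrm (join y s) = s := by simp [nrm, join]

@[simp] theorem tang_join (y : Euc d) (s : ℝ) : tang (join y s) = y := by
  ext i; simp [tang, join]

@[simp] theorem join_tang_nrm (x : Euc (d + 1)) : join (tang x) (nrm x) = x := by
  ext i
  refine Fin.lastCases ?_ (fun i => ?_) i <;> simp [join, tang, nrm]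

theorem bdry_eq_join (y : Euc d) : bdry y = join y 0 := rfl

theorem norm_sq_eq_tang_nrm (x : Euc (d + 1)) : ‖x‖ ^ 2 = ‖tang x‖ ^ 2 + nrm x ^ 2 := by
  simp [EuclideanSpace.norm_sq_eq, Fin.sum_univ_castSucc, tang, nrm]

theorem inner_eq_tang_nrm (x y : Euc (d + 1)) :
    inner ℝ x y = inner ℝ (tang x) (tang y) + nrm x * nrm y := by
  simp [PiLp.inner_apply, Fin.sum_univ_castSucc, tang, nrm, mul_comm]

theorem norm_tang_le (x : Euc (d + 1)) : ‖tang x‖ ≤ ‖x‖ := by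
  have := norm_sq_eq_tang_nrm x
  exact le_of_sq_le_sq (by nlinarith [sq_nonneg (nrm x)]) (norm_nonneg _)

theorem abs_nrm_le (x : Euc (d + 1)) : |nrm x| ≤ ‖x‖ := by
  have := norm_sq_eq_tang_nrm x
  refine le_of_sq_le_sq ?_ (norm_nonneg _)
  rw [sq_abs]
  nlinarith [sq_nonneg ‖tang x‖]

theorem norm_le_tang_nrm (x : Euc (d + 1)) : ‖x‖ ≤ ‖tang x‖ + |nrm x| := by
  have := norm_sq_eq_tang_nrm x
  refine le_of_sq_le_sq ?_ (by positivity)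
  rw [this, add_sq, sq_abs]
  nlinarith [mul_nonneg (norm_nonneg (tang x)) (abs_nonneg (nrm x))]

/-- The tangential projection as a continuous linear map. -/
def tangCLM (d : ℕ) : Euc (d + 1) →L[ℝ] Euc d :=
  LinearMap.toContinuousLinearMap
    { toFun := tang
      map_add' := fun x y => by ext i; simp [tang]
      map_smul' := fun c x => by ext i; simp [tang] }

@[simp] theorem tangCLM_apply (x : Euc (d + 1)) : tangCLM d x = tang x := rfl

/-- The normal coordinate as a continuous linear map. -/
def nrmCLM (d : ℕ) : Euc (d + 1) →L[ℝ] ℝ :=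
  LinearMap.toContinuousLinearMap
    { toFun := nrm
      map_add' := fun x y => by simp [nrm]
      map_smul' := fun c x => by simp [nrm] }

@[simp] theorem nrmCLM_apply (x : Euc (d + 1)) : nrmCLM d x = nrm x := rfl

@[fun_prop] theorem continuous_tang : Continuous (tang : Euc (d + 1) → Euc d) :=
  (tangCLM d).continuous

@[fun_prop] theorem continuous_nrm : Continuous (nrm : Euc (d + 1) → ℝ) := (nrmCLM d).continuous

@[fun_prop] theorem measurable_tang : Measurable (tang : Euc (d + 1) → Euc d) :=
  continuous_tang.measurable

@[fun_prop] theorem measurable_nrm : Measurable (nrm : Euc (d + 1) → ℝ) :=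
  continuous_nrm.measurable

theorem continuous_join : Continuous fun p : Euc d × ℝ => join p.1 p.2 := by
  unfold join
  refine (PiLp.continuous_toLp 2 _).comp (continuous_pi fun i => ?_)
  refine Fin.lastCases ?_ (fun i => ?_) i
  · simpa using continuous_snd
  · simp only [Fin.snoc_castSucc]
    fun_prop

@[fun_prop] theorem Continuous.join {X : Type*} [TopologicalSpace X] {f : X → Euc d} {g : X → ℝ}
    (hf : Continuous f) (hg : Continuous g) : Continuous fun x => HalfSpace.join (f x) (g x) :=
  continuous_join.comp (hf.prodMk hg)

theorem measurable_join : Measurable fun p : Euc d × ℝ => join p.1 p.2 :=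
  continuous_join.measurable

/-- `ℝ^n ≃ ℝ^{n-1} × ℝ` as a measurable equivalence. -/
def splitEquiv (d : ℕ) : Euc (d + 1) ≃ᵐ Euc d × ℝ where
  toFun x := (tang x, nrm x)
  invFun p := join p.1 p.2
  left_inv x := by simp
  right_inv p := by simp
  measurable_toFun := measurable_tang.prodMk measurable_nrm
  measurable_invFun := measurable_join

theorem measurePreserving_join :
    MeasurePreserving (fun p : Euc d × ℝ => join p.1 p.2) (volume.prod volume) volume := by
  have h1 : MeasurePreserving (fun p : Euc d × ℝ => (p.2, (MeasurableEquiv.toLp 2 (Fin d → ℝ)).symm p.1))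
      (volume.prod volume) (volume.prod volume) :=
    ((MeasurePreserving.id volume).prod
      (EuclideanSpace.volume_preserving_symm_measurableEquiv_toLp (Fin d))).comp
      Measure.measurePreserving_swap
  have h2 := (volume_preserving_piFinSuccAbove (fun _ : Fin (d + 1) => ℝ) (Fin.last d)).symm
  have h3 := (EuclideanSpace.volume_preserving_symm_measurableEquiv_toLp (Fin (d + 1))).symm
  have h4 := h3.comp (h2.comp h1)
  refine (congrArg (fun g => MeasurePreserving g (volume.prod volume) volume) ?_).mp h4
  funext p
  ext i
  refine Fin.lastCases ?_ (fun i => ?_) i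
  · simp only [join, Function.comp_apply, MeasurableEquiv.piFinSuccAbove, MeasurableEquiv.toLp,
      Fin.snoc_last]
    have := Fin.insertNth_apply_same (α := fun _ => ℝ) (Fin.last d) p.2 (fun i => p.1 (Fin.cast rfl i))
    exact this
  · simp only [join, Function.comp_apply, MeasurableEquiv.piFinSuccAbove, MeasurableEquiv.toLp,
      Fin.snoc_castSucc]
    have := Fin.insertNth_apply_succAbove (α := fun _ => ℝ) (Fin.last d) p.2 (fun i => p.1 i) i
    rw [Fin.succAbove_last] at this
    exact this

theorem measurePreserving_split : MeasurePreserving (splitEquiv d) volume (volume.prod volume) :=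
  MeasurePreserving.symm (splitEquiv d).symm measurePreserving_join

theorem lintegral_eq_join (f : Euc (d + 1) → ℝ≥0∞) :
    ∫⁻ x, f x = ∫⁻ p : Euc d × ℝ, f (join p.1 p.2) ∂(volume.prod volume) :=
  (measurePreserving_join.lintegral_comp_emb (splitEquiv d).symm.measurableEmbedding f).symm

theorem lintegral_join {f : Euc (d + 1) → ℝ≥0∞} (hf : AEMeasurable f) :
    ∫⁻ x, f x = ∫⁻ y : Euc d, ∫⁻ s : ℝ, f (join y s) := by
  rw [lintegral_eq_join, lintegral_prod]
  exact hf.comp_quasiMeasurePreserving measurePreserving_join.quasiMeasurePreserving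

theorem integrable_join_iff {E : Type*} [NormedAddCommGroup E] {f : Euc (d + 1) → E} :
    Integrable (fun p : Euc d × ℝ => f (join p.1 p.2)) (volume.prod volume) ↔ Integrable f :=
  measurePreserving_join.integrable_comp_emb (splitEquiv d).symm.measurableEmbedding

theorem integral_eq_join {E : Type*} [NormedAddCommGroup E] [NormedSpace ℝ E]
    (f : Euc (d + 1) → E) :
    ∫ x, f x = ∫ p : Euc d × ℝ, f (join p.1 p.2) ∂(volume.prod volume) :=
  (measurePreserving_join.integral_comp (splitEquiv d).symm.measurableEmbedding f).symm

theorem integral_join {E : Type*} [NormedAddCommGroup E] [NormedSpace ℝ E]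
    {f : Euc (d + 1) → E} (hf : Integrable f) :
    ∫ x, f x = ∫ y : Euc d, ∫ s : ℝ, f (join y s) := by
  rw [integral_eq_join, integral_prod _ (integrable_join_iff.2 hf)]

theorem volume_boundary : volume {x : Euc (d + 1) | nrm x = 0} = 0 := by
  have hm : MeasurableSet {x : Euc (d + 1) | nrm x = 0} := measurable_nrm (measurableSet_singleton 0)
  rw [← lintegral_indicator_one hm, lintegral_join ((measurable_one.indicator hm).aemeasurable)]
  have : ∀ y : Euc d, ∫⁻ s : ℝ, ({x : Euc (d + 1) | nrm x = 0}.indicator 1 (join y s) : ℝ≥0∞) = 0 := by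
    intro y
    have : (fun s : ℝ => ({x : Euc (d + 1) | nrm x = 0}.indicator 1 (join y s) : ℝ≥0∞)) =
        ({0} : Set ℝ).indicator 1 := by
      funext s
      simp [Set.indicator_apply]
    rw [this, lintegral_indicator_one (measurableSet_singleton 0)]
    simp
  simp [this]

theorem ae_nrm_ne_zero : ∀ᵐ x : Euc (d + 1), nrm x ≠ 0 := by
  rw [ae_iff]
  simpa using volume_boundary

/-! ### Square integrable functions supported in a half-space -/

/-- `U` vanishes in the lower half-space. -/
def IsUpper (U : L2 (d + 1)) : Prop := ∀ᵐ x, nrm x < 0 → U x = 0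

/-- `U` vanishes in the upper half-space. -/
def IsLower (U : L2 (d + 1)) : Prop := ∀ᵐ x, 0 < nrm x → U x = 0

theorem isOpen_openHalf : IsOpen (openHalf d) := isOpen_lt continuous_const continuous_nrm

theorem measurableSet_openHalf : MeasurableSet (openHalf d) := isOpen_openHalf.measurableSet

theorem isVanishingOn_coe_iff {k : ℕ} {s : Set (Euc k)} (hs : IsOpen s) (U : L2 k) :
    IsVanishingOn (U : 𝓢'(Euc k, ℂ)) s ↔ ∀ᵐ x, x ∈ s → U x = 0 := by
  constructor
  · intro h
    have hl : LocallyIntegrable (U : Euc k → ℂ) := (Lp.memLp U).locallyIntegrable (by norm_num)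
    refine ae_eq_of_schwartz_on hs (hl.locallyIntegrableOn _)
      ((locallyIntegrable_const (0 : ℂ)).locallyIntegrableOn s) fun φ _ hφ => ?_
    have := h φ hφ
    rw [coe_apply] at this
    simp [this]
  · intro h φ hφ
    rw [coe_apply]
    refine integral_eq_zero_of_ae ?_
    filter_upwards [h] with x hx
    by_cases hxs : x ∈ s
    · simp [hx hxs]
    · have : φ x = 0 := image_eq_zero_of_notMem_tsupport fun h' => hxs (hφ h')
      simp [this]

theorem isVanishingOn_openHalf_iff (U : L2 (d + 1)) :
    IsVanishingOn (U : 𝓢'(Euc (d + 1), ℂ)) (openHalf d) ↔ IsLower U :=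
  isVanishingOn_coe_iff isOpen_openHalf U

theorem dsupport_coe_subset_iff (U : L2 (d + 1)) :
    dsupport (U : 𝓢'(Euc (d + 1), ℂ)) ⊆ closedHalf d ↔ IsUpper U := by
  have hopen : IsOpen {x : Euc (d + 1) | nrm x < 0} := isOpen_lt continuous_nrm continuous_const
  constructor
  · intro h
    rw [IsUpper, ae_iff]
    refine measure_null_of_locally_null _ fun x hx => ?_
    simp only [Classical.not_imp, Set.mem_ofPred_eq] at hx
    have hx' : x ∉ dsupport (U : 𝓢'(Euc (d + 1), ℂ)) := fun h' => not_le.2 hx.1 (h h')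
    obtain ⟨s, hs, hso, hxs⟩ := (notMem_dsupport_iff x).1 hx'
    rw [isVanishingOn_coe_iff hso, ae_iff] at hs
    refine ⟨s ∩ {x | ¬(nrm x < 0 → U x = 0)},
      Filter.inter_mem (mem_nhdsWithin_of_mem_nhds (hso.mem_nhds hxs)) self_mem_nhdsWithin, ?_⟩
    refine measure_mono_null ?_ hs
    rintro z ⟨hz, hz'⟩
    simp only [Classical.not_imp, Set.mem_ofPred_eq] at hz' ⊢
    exact ⟨hz, hz'.2⟩
  · intro h x hx
    by_contra hxC
    have hx0 : nrm x < 0 := not_le.1 hxC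
    refine (notMem_dsupport_iff x).2 ⟨{x | nrm x < 0}, ?_, hopen, hx0⟩ hx
    exact (isVanishingOn_coe_iff hopen U).2 h

/-- The cutoff of `U` to the upper half-space. -/
def cut (U : L2 (d + 1)) : L2 (d + 1) :=
  ((Lp.memLp U).indicator measurableSet_openHalf).toLp ((openHalf d).indicator U)

theorem cut_ae (U : L2 (d + 1)) : (cut U : Euc (d + 1) → ℂ) =ᵐ[volume] (openHalf d).indicator U :=
  MemLp.coeFn_toLp _

theorem isUpper_cut (U : L2 (d + 1)) : IsUpper (cut U) := by
  filter_upwards [cut_ae U] with x hx hn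
  rw [hx, Set.indicator_of_notMem]
  exact not_lt.2 hn.le

theorem isLower_sub_cut (U : L2 (d + 1)) : IsLower (U - cut U) := by
  filter_upwards [cut_ae U, Lp.coeFn_sub U (cut U)] with x hx h2 hn
  rw [h2, Pi.sub_apply, hx, Set.indicator_of_mem (by exact hn), sub_self]

theorem IsUpper.sub {U V : L2 (d + 1)} (hU : IsUpper U) (hV : IsUpper V) : IsUpper (U - V) := by
  filter_upwards [hU, hV, Lp.coeFn_sub U V] with x h1 h2 h3 hn
  rw [h3, Pi.sub_apply, h1 hn, h2 hn, sub_zero]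

theorem IsUpper.add {U V : L2 (d + 1)} (hU : IsUpper U) (hV : IsUpper V) : IsUpper (U + V) := by
  filter_upwards [hU, hV, Lp.coeFn_add U V] with x h1 h2 h3 hn
  rw [h3, Pi.add_apply, h1 hn, h2 hn, add_zero]

theorem IsUpper.smul {U : L2 (d + 1)} (c : ℂ) (hU : IsUpper U) : IsUpper (c • U) := by
  filter_upwards [hU, Lp.coeFn_smul c U] with x h1 h3 hn
  rw [h3, Pi.smul_apply, h1 hn, smul_zero]

theorem IsLower.sub {U V : L2 (d + 1)} (hU : IsLower U) (hV : IsLower V) : IsLower (U - V) := by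
  filter_upwards [hU, hV, Lp.coeFn_sub U V] with x h1 h2 h3 hn
  rw [h3, Pi.sub_apply, h1 hn, h2 hn, sub_zero]

theorem IsLower.add {U V : L2 (d + 1)} (hU : IsLower U) (hV : IsLower V) : IsLower (U + V) := by
  filter_upwards [hU, hV, Lp.coeFn_add U V] with x h1 h2 h3 hn
  rw [h3, Pi.add_apply, h1 hn, h2 hn, add_zero]

theorem IsLower.smul {U : L2 (d + 1)} (c : ℂ) (hU : IsLower U) : IsLower (c • U) := by
  filter_upwards [hU, Lp.coeFn_smul c U] with x h1 h3 hn
  rw [h3, Pi.smul_apply, h1 hn, smul_zero]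

theorem eq_zero_of_isUpper_of_isLower {U : L2 (d + 1)} (hU : IsUpper U) (hL : IsLower U) :
    U = 0 := by
  rw [Lp.eq_zero_iff_ae_eq_zero]
  filter_upwards [hU, hL, ae_nrm_ne_zero] with x h1 h2 h3
  rcases lt_or_gt_of_ne h3 with h | h
  · exact h1 h
  · exact h2 h

/-- An upper function is the cutoff of every function it agrees with in the upper half-space. -/
theorem eq_cut_of_isUpper_of_isLower_sub {U V : L2 (d + 1)} (hU : IsUpper U)
    (h : IsLower (U - V)) : U = cut V := by
  refine sub_eq_zero.1 (eq_zero_of_isUpper_of_isLower (hU.sub (isUpper_cut V)) ?_)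
  have := h.add (isLower_sub_cut V)
  simpa using this

theorem cut_eq_self {U : L2 (d + 1)} (hU : IsUpper U) : cut U = U :=
  (eq_cut_of_isUpper_of_isLower_sub hU (by
    rw [sub_self]
    filter_upwards [Lp.coeFn_zero ℂ 2 (volume : Measure (Euc (d + 1)))] with x hx _
    rw [hx]; rfl)).symm

theorem cut_sub (U V : L2 (d + 1)) : cut (U - V) = cut U - cut V := by
  refine (eq_cut_of_isUpper_of_isLower_sub ((isUpper_cut U).sub (isUpper_cut V)) ?_).symm
  have h := ((isLower_sub_cut V).sub (isLower_sub_cut U))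
  have e : V - cut V - (U - cut U) = cut U - cut V - (U - V) := by abel
  rwa [e] at h

theorem cut_add (U V : L2 (d + 1)) : cut (U + V) = cut U + cut V := by
  refine (eq_cut_of_isUpper_of_isLower_sub ((isUpper_cut U).add (isUpper_cut V)) ?_).symm
  have h := ((isLower_sub_cut V).add (isLower_sub_cut U)).smul (-1 : ℂ)
  have e : (-1 : ℂ) • (V - cut V + (U - cut U)) = cut U + cut V - (U + V) := by
    rw [neg_one_smul]; abel
  rwa [e] at h

theorem cut_smul (c : ℂ) (U : L2 (d + 1)) : cut (c • U) = c • cut U := by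
  refine (eq_cut_of_isUpper_of_isLower_sub ((isUpper_cut U).smul c) ?_).symm
  have h := (isLower_sub_cut U).smul (-c)
  have e : (-c) • (U - cut U) = c • cut U - c • U := by
    rw [smul_sub, neg_smul, neg_smul]; abel
  rwa [e] at h

theorem enorm_cut_le (U : L2 (d + 1)) : ‖cut U‖ₑ ≤ ‖U‖ₑ := by
  rw [Lp.enorm_def, Lp.enorm_def, eLpNorm_congr_ae (cut_ae U)]
  exact eLpNorm_indicator_le _

/-- Bilinear form of Plancherel's theorem: `∫ conj(𝓕 V) 𝓕 U = ∫ conj(V) U`. -/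
theorem integral_conj_fourier_mul {k : ℕ} (U V : L2 k) :
    ∫ ξ, (starRingEnd ℂ) ((𝓕 V : L2 k) ξ) * (𝓕 U : L2 k) ξ =
      ∫ x, (starRingEnd ℂ) (V x) * U x := by
  have h := Lp.inner_fourier_eq V U
  rw [L2.inner_def, L2.inner_def] at h
  simp only [RCLike.inner_apply'] at h
  exact h

/-- Functions supported in opposite half-spaces are orthogonal. -/
theorem integral_conj_fourier_mul_eq_zero {U V : L2 (d + 1)} (hU : IsUpper U) (hV : IsLower V) :
    ∫ ξ, (starRingEnd ℂ) ((𝓕 V : L2 (d + 1)) ξ) * (𝓕 U : L2 (d + 1)) ξ = 0 := by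
  rw [integral_conj_fourier_mul]
  refine integral_eq_zero_of_ae ?_
  filter_upwards [hU, hV, ae_nrm_ne_zero] with x h1 h2 h3
  rcases lt_or_gt_of_ne h3 with h | h
  · simp [h1 h]
  · simp [h2 h]

/-! ### The symbols of the order-reducing operators -/

/-- `⟨2πη⟩`, the symbol that appears in `Ξ_+` at the tangential frequency `η`. -/
def sig (η : Euc d) : ℝ := bracket ((2 * Real.pi) • η)

theorem sig_eq (η : Euc d) : sig η = Real.sqrt (1 + ‖(2 * Real.pi) • η‖ ^ 2) := rfl

theorem one_le_sig (η : Euc d) : 1 ≤ sig η := by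
  rw [sig_eq, Real.one_le_sqrt]
  nlinarith [sq_nonneg ‖(2 * Real.pi) • η‖]

theorem sig_pos (η : Euc d) : 0 < sig η := zero_lt_one.trans_le (one_le_sig η)

theorem sig_sq (η : Euc d) : sig η ^ 2 = 1 + 4 * Real.pi ^ 2 * ‖η‖ ^ 2 := by
  rw [sig_eq, Real.sq_sqrt (by positivity), norm_smul, Real.norm_of_nonneg (by positivity)]
  ring

theorem sig_temperate_rpow (t : ℝ) : (fun η : Euc d => ((sig η ^ t : ℝ) : ℂ)).HasTemperateGrowth := by
  have h : (fun η : Euc d => sig η ^ t) =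
      (fun x : Euc d => (1 + ‖x‖ ^ 2) ^ (t / 2)) ∘
        (((2 * Real.pi) • ContinuousLinearMap.id ℝ (Euc d) : Euc d →L[ℝ] Euc d)) := by
    funext η
    change sig η ^ t = (1 + ‖(2 * Real.pi) • η‖ ^ 2) ^ (t / 2)
    rw [sig_eq, Real.sqrt_eq_rpow, ← Real.rpow_mul (by positivity)]
    ring_nf
  have h2 : (fun η : Euc d => sig η ^ t).HasTemperateGrowth := by
    rw [h]
    exact (Function.hasTemperateGrowth_one_add_norm_sq_rpow (Euc d) (t / 2)).comp
      (ContinuousLinearMap.hasTemperateGrowth _)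
  fun_prop

@[fun_prop] theorem continuous_sig : Continuous (sig : Euc d → ℝ) := by
  have : (sig : Euc d → ℝ) = fun η => Real.sqrt (1 + ‖(2 * Real.pi) • η‖ ^ 2) := rfl
  rw [this]; fun_prop

@[fun_prop] theorem measurable_sig : Measurable (sig : Euc d → ℝ) := continuous_sig.measurable

/-- The function `w ↦ (1 + i w)^t` on the line. -/
def linePow (t : ℝ) (w : ℝ) : ℂ := (1 + Complex.I * (w : ℂ)) ^ (t : ℂ)

theorem one_add_I_mul_mem_slitPlane (w : ℝ) : 1 + Complex.I * (w : ℂ) ∈ Complex.slitPlane := by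
  left; simp

theorem one_add_I_mul_ne_zero (w : ℝ) : 1 + Complex.I * (w : ℂ) ≠ 0 :=
  Complex.slitPlane_ne_zero (one_add_I_mul_mem_slitPlane w)

theorem norm_one_add_I_mul (w : ℝ) : ‖1 + Complex.I * (w : ℂ)‖ = Real.sqrt (1 + w ^ 2) := by
  rw [Complex.norm_def, Complex.normSq_apply]
  simp [sq]

theorem norm_linePow (t w : ℝ) : ‖linePow t w‖ = (1 + w ^ 2) ^ (t / 2) := by
  rw [linePow, Complex.norm_cpow_real, norm_one_add_I_mul, Real.sqrt_eq_rpow,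
    ← Real.rpow_mul (by positivity)]
  ring_nf

theorem linePow_add (s t w : ℝ) : linePow (s + t) w = linePow s w * linePow t w := by
  rw [linePow, Complex.ofReal_add, Complex.cpow_add _ _ (one_add_I_mul_ne_zero w)]
  rfl

theorem linePow_neg (t w : ℝ) : linePow (-t) w = (linePow t w)⁻¹ := by
  rw [linePow, Complex.ofReal_neg, Complex.cpow_neg]; rfl

theorem hasDerivAt_linePow (t w : ℝ) :
    HasDerivAt (linePow t) (t * Complex.I * linePow (t - 1) w) w := by
  have h1 : HasDerivAt (fun z : ℂ => 1 + Complex.I * z) Complex.I (w : ℂ) := by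
    simpa using ((hasDerivAt_id (w : ℂ)).const_mul Complex.I).const_add 1
  have h2 := (h1.cpow_const (c := (t : ℂ)) (one_add_I_mul_mem_slitPlane w)).comp_ofReal
  refine h2.congr_deriv ?_
  simp only [linePow]
  push_cast
  ring

theorem iteratedDeriv_linePow (n : ℕ) (t : ℝ) :
    ∃ c : ℂ, iteratedDeriv n (linePow t) = fun w => c * linePow (t - n) w := by
  induction n with
  | zero => exact ⟨1, by simp⟩
  | succ n ih =>
    obtain ⟨c, hc⟩ := ih
    refine ⟨c * ((t - n : ℝ) * Complex.I), ?_⟩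
    rw [iteratedDeriv_succ, hc]
    funext w
    have h := ((hasDerivAt_linePow (t - n) w).const_mul c).deriv
    rw [h]
    push_cast
    rw [show t - (n : ℝ) - 1 = t - (n + 1) by ring]
    ring

theorem contDiff_linePow (t : ℝ) : ContDiff ℝ (⊤ : ℕ∞) (linePow t) := by
  refine contDiff_infty_iff_deriv.2 ?_
  refine ⟨fun w => (hasDerivAt_linePow t w).differentiableAt, ?_⟩
  rw [contDiff_infty]
  intro n
  induction n generalizing t with
  | zero =>
    refine contDiff_zero.2 ?_
    have : deriv (linePow t) = fun w => t * Complex.I * linePow (t - 1) w :=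
      funext fun w => (hasDerivAt_linePow t w).deriv
    rw [this]
    exact continuous_const.mul (continuous_iff_continuousAt.2 fun w =>
      (hasDerivAt_linePow (t - 1) w).continuousAt)
  | succ n ih =>
    have : deriv (linePow t) = fun w => t * Complex.I * linePow (t - 1) w :=
      funext fun w => (hasDerivAt_linePow t w).deriv
    rw [this]
    refine contDiff_const.mul ?_
    push_cast
    rw [contDiff_succ_iff_deriv]
    exact ⟨fun w => (hasDerivAt_linePow _ w).differentiableAt, by simp, ih _⟩

theorem linePow_temperate (t : ℝ) : (linePow t).HasTemperateGrowth := by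
  refine ⟨contDiff_linePow t, fun n => ?_⟩
  obtain ⟨c, hc⟩ := iteratedDeriv_linePow n t
  obtain ⟨k, hk⟩ := exists_nat_ge (t - n)
  refine ⟨k, ‖c‖, fun w => ?_⟩
  rw [norm_iteratedFDeriv_eq_norm_iteratedDeriv, hc, norm_mul, norm_linePow]
  refine mul_le_mul_of_nonneg_left ?_ (norm_nonneg c)
  calc (1 + w ^ 2) ^ ((t - n) / 2) ≤ (1 + w ^ 2) ^ ((k : ℝ) / 2) :=
        Real.rpow_le_rpow_of_exponent_le (by nlinarith [sq_nonneg w]) (by linarith)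
    _ ≤ ((1 + ‖w‖) ^ 2) ^ ((k : ℝ) / 2) := by
        refine Real.rpow_le_rpow (by positivity) ?_ (by positivity)
        rw [Real.norm_eq_abs]
        nlinarith [abs_nonneg w, sq_abs w]
    _ = (1 + ‖w‖) ^ k := by
        rw [← Real.rpow_natCast, ← Real.rpow_natCast, ← Real.rpow_mul (by positivity)]
        congr 1
        push_cast; ring

@[fun_prop] theorem continuous_linePow (t : ℝ) : Continuous (linePow t) :=
  (contDiff_linePow t).continuous

/-- Scaling by `⟨2πξ'⟩` reduces the symbol to a function of one variable. -/
theorem xiSymbol_eq (t : ℝ) (ξ : Euc (d + 1)) :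
    xiSymbol t ξ = ((sig (tang ξ) ^ t : ℝ) : ℂ) *
      linePow t (2 * Real.pi * (nrm ξ * (sig (tang ξ))⁻¹)) := by
  have hs := sig_pos (tang ξ)
  have h : (bracket ((2 * Real.pi) • tang ξ) : ℂ) + Complex.I * (2 * Real.pi * nrm ξ : ℝ) =
      ((sig (tang ξ) : ℝ) : ℂ) *
        (1 + Complex.I * ((2 * Real.pi * (nrm ξ * (sig (tang ξ))⁻¹) : ℝ) : ℂ)) := by
    have hs' : ((sig (tang ξ) : ℝ) : ℂ) ≠ 0 := by exact_mod_cast hs.ne'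
    rw [show bracket ((2 * Real.pi) • tang ξ) = sig (tang ξ) from rfl]
    push_cast
    field_simp
  rw [xiSymbol, h, Complex.ofReal_cpow hs.le, linePow]
  have hs' : ((sig (tang ξ) : ℝ) : ℂ) ≠ 0 := by exact_mod_cast hs.ne'
  have h1 := one_add_I_mul_ne_zero (2 * Real.pi * (nrm ξ * (sig (tang ξ))⁻¹))
  rw [Complex.cpow_def_of_ne_zero (mul_ne_zero hs' h1), Complex.cpow_def_of_ne_zero hs',
    Complex.cpow_def_of_ne_zero h1, Complex.log_ofReal_mul hs h1, ← Complex.exp_add,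
    ← Complex.ofReal_log hs.le, add_mul]

theorem xiSymbol_temperate (t : ℝ) : (xiSymbol t : Euc (d + 1) → ℂ).HasTemperateGrowth := by
  have h : (xiSymbol t : Euc (d + 1) → ℂ) = fun ξ => ((sig (tangCLM d ξ) ^ t : ℝ) : ℂ) *
      linePow t (2 * Real.pi * (nrmCLM d ξ * (sig (tangCLM d ξ))⁻¹)) := funext fun ξ => xiSymbol_eq t ξ
  have h1 : (fun ξ : Euc (d + 1) => ((sig (tangCLM d ξ) ^ t : ℝ) : ℂ)).HasTemperateGrowth :=
    (sig_temperate_rpow t).comp (tangCLM d).hasTemperateGrowth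
  have h2 : (fun ξ : Euc (d + 1) => (sig (tangCLM d ξ))⁻¹).HasTemperateGrowth := by
    have h3 : (fun ξ : Euc (d + 1) => ((sig (tangCLM d ξ) ^ (-1 : ℝ) : ℝ) : ℂ)).HasTemperateGrowth :=
      (sig_temperate_rpow (-1)).comp (tangCLM d).hasTemperateGrowth
    have h4 := (Complex.reCLM.hasTemperateGrowth).comp h3
    convert h4 using 1
    funext ξ
    simp [Real.rpow_neg_one]
  have h5 : (fun ξ : Euc (d + 1) =>
      2 * Real.pi * (nrmCLM d ξ * (sig (tangCLM d ξ))⁻¹)).HasTemperateGrowth :=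
    (Function.HasTemperateGrowth.const _).mul ((nrmCLM d).hasTemperateGrowth.mul h2)
  rw [h]
  exact h1.mul ((linePow_temperate t).comp h5)

@[fun_prop] theorem continuous_xiSymbol (t : ℝ) : Continuous (xiSymbol t : Euc (d + 1) → ℂ) :=
  (xiSymbol_temperate t).1.continuous

/-- The base `⟨2πξ'⟩ + 2πi ξ_n` of the symbols. -/
def xiBase (ξ : Euc (d + 1)) : ℂ :=
  (sig (tang ξ) : ℂ) + Complex.I * (2 * Real.pi * nrm ξ : ℝ)

theorem xiSymbol_eq_cpow (t : ℝ) (ξ : Euc (d + 1)) : xiSymbol t ξ = xiBase ξ ^ (t : ℂ) := rfl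

theorem xiBase_re (ξ : Euc (d + 1)) : (xiBase ξ).re = sig (tang ξ) := by simp [xiBase]

theorem xiBase_ne_zero (ξ : Euc (d + 1)) : xiBase ξ ≠ 0 := by
  intro h
  have := congrArg Complex.re h
  rw [xiBase_re] at this
  exact (sig_pos _).ne' this

theorem xiSymbol_add (s t : ℝ) (ξ : Euc (d + 1)) :
    xiSymbol (s + t) ξ = xiSymbol s ξ * xiSymbol t ξ := by
  simp only [xiSymbol_eq_cpow]
  rw [Complex.ofReal_add, Complex.cpow_add _ _ (xiBase_ne_zero ξ)]

theorem xiSymbol_zero (ξ : Euc (d + 1)) : xiSymbol 0 ξ = 1 := by simp [xiSymbol_eq_cpow]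

theorem xiSymbol_neg_mul (t : ℝ) (ξ : Euc (d + 1)) : xiSymbol (-t) ξ * xiSymbol t ξ = 1 := by
  rw [← xiSymbol_add, neg_add_cancel, xiSymbol_zero]

theorem xiSymbol_ne_zero (t : ℝ) (ξ : Euc (d + 1)) : xiSymbol t ξ ≠ 0 := by
  intro h
  have := xiSymbol_neg_mul t ξ
  rw [h, mul_zero] at this
  exact zero_ne_one this

theorem norm_xiSymbol (t : ℝ) (ξ : Euc (d + 1)) :
    ‖xiSymbol t ξ‖ = (1 + 4 * Real.pi ^ 2 * ‖ξ‖ ^ 2) ^ (t / 2) := by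
  have h : ‖xiBase ξ‖ = Real.sqrt (1 + 4 * Real.pi ^ 2 * ‖ξ‖ ^ 2) := by
    rw [Complex.norm_def, Complex.normSq_apply]
    congr 1
    have him : (xiBase ξ).im = 2 * Real.pi * nrm ξ := by simp [xiBase]
    rw [xiBase_re, him, norm_sq_eq_tang_nrm]
    have := sig_sq (tang ξ)
    nlinarith
  rw [xiSymbol_eq_cpow, Complex.norm_cpow_real, h, Real.sqrt_eq_rpow,
    ← Real.rpow_mul (by positivity)]
  ring_nf

/-- The constant comparing `⟨2πξ⟩^t` with `⟨ξ⟩^t`. -/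
def xiConst (t : ℝ) : ℝ := (4 * Real.pi ^ 2) ^ (t / 2)

theorem one_le_four_pi_sq : (1 : ℝ) ≤ 4 * Real.pi ^ 2 := by nlinarith [Real.pi_gt_three]

theorem norm_xiSymbol_le {t : ℝ} (ht : 0 ≤ t) (ξ : Euc (d + 1)) :
    ‖xiSymbol t ξ‖ ≤ xiConst t * wt t ξ := by
  rw [norm_xiSymbol, xiConst, wt, ← Real.mul_rpow (by positivity) (by positivity)]
  refine Real.rpow_le_rpow (by positivity) ?_ (by positivity)
  nlinarith [one_le_four_pi_sq]

theorem norm_xiSymbol_neg_le {t : ℝ} (ht : 0 ≤ t) (ξ : Euc (d + 1)) :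
    ‖xiSymbol (-t) ξ‖ ≤ wt (-t) ξ := by
  rw [norm_xiSymbol, wt]
  refine Real.rpow_le_rpow_of_nonpos (by positivity) ?_ (by linarith)
  nlinarith [one_le_four_pi_sq, sq_nonneg ‖ξ‖, mul_le_mul_of_nonneg_right one_le_four_pi_sq (sq_nonneg ‖ξ‖)]

theorem wt_le_norm_xiSymbol {t : ℝ} (ht : 0 ≤ t) (ξ : Euc (d + 1)) :
    wt t ξ ≤ ‖xiSymbol t ξ‖ := by
  have h := norm_xiSymbol_neg_le ht ξ
  rw [wt_neg] at h
  have h1 : ‖xiSymbol (-t) ξ‖ * ‖xiSymbol t ξ‖ = 1 := by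
    rw [← norm_mul, xiSymbol_neg_mul, norm_one]
  have h2 : 0 < ‖xiSymbol t ξ‖ := norm_pos_iff.2 (xiSymbol_ne_zero t ξ)
  have h3 := mul_le_mul_of_nonneg_right h h2.le
  rw [h1, inv_mul_eq_div, le_div_iff₀ (wt_pos t ξ)] at h3
  linarith

theorem norm_xiSymbol_nonpos_le_one {t : ℝ} (ht : t ≤ 0) (ξ : Euc (d + 1)) :
    ‖xiSymbol t ξ‖ ≤ 1 := by
  rw [norm_xiSymbol]
  exact Real.rpow_le_one_of_one_le_of_nonpos (by nlinarith [sq_nonneg (Real.pi * ‖ξ‖)])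
    (by linarith)

theorem xiSymbol_neg_nat (k : ℕ) (ξ : Euc (d + 1)) :
    xiSymbol (-(k : ℝ)) ξ = ((xiBase ξ)⁻¹) ^ k := by
  rw [xiSymbol_eq_cpow, Complex.ofReal_neg, Complex.cpow_neg, Complex.ofReal_natCast,
    Complex.cpow_natCast, inv_pow]

theorem inv_xiBase_mul_conj (ξ : Euc (d + 1)) :
    (xiBase ξ)⁻¹ * (starRingEnd ℂ) (xiBase ξ)⁻¹ =
      ((2 * sig (tang ξ) : ℝ) : ℂ)⁻¹ * ((xiBase ξ)⁻¹ + (starRingEnd ℂ) (xiBase ξ)⁻¹) := by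
  have h1 := xiBase_ne_zero ξ
  have h2 : (starRingEnd ℂ) (xiBase ξ) ≠ 0 := by simpa using h1
  have h3 : ((2 * sig (tang ξ) : ℝ) : ℂ) = xiBase ξ + (starRingEnd ℂ) (xiBase ξ) := by
    rw [Complex.add_conj, xiBase_re]
  have h4 : ((2 * sig (tang ξ) : ℝ) : ℂ) ≠ 0 := by
    exact_mod_cast (mul_pos two_pos (sig_pos _)).ne'
  rw [map_inv₀]
  rw [eq_inv_mul_iff_mul_eq₀ h4, h3]
  field_simp
  ring

/-! ### Partial Fourier inversion -/

theorem eLpNorm_two_sq {α : Type*} [MeasurableSpace α] {μ : Measure α} (f : α → ℂ) :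
    eLpNorm f 2 μ ^ 2 = ∫⁻ x, ‖f x‖ₑ ^ 2 ∂μ := by
  have := eLpNorm_nnreal_pow_eq_lintegral (f := f) (μ := μ) (p := 2) two_ne_zero
  simpa using this

theorem memLp_two_iff {α : Type*} [MeasurableSpace α] {μ : Measure α} {f : α → ℂ}
    (hf : AEStronglyMeasurable f μ) : MemLp f 2 μ ↔ ∫⁻ x, ‖f x‖ₑ ^ 2 ∂μ < ∞ := by
  rw [← eLpNorm_two_sq]
  constructor
  · intro h
    exact ENNReal.pow_lt_top h.2
  · intro h
    refine ⟨hf, ?_⟩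
    by_contra hc
    rw [not_lt, top_le_iff] at hc
    rw [hc] at h
    simp at h

/-- The restriction of a Schwartz function to a line in the normal direction. -/
def sliceNrm (η : Euc d) : 𝓢(Euc (d + 1), ℂ) →L[ℂ] 𝓢(ℝ, ℂ) :=
  SchwartzMap.compCLM ℂ (g := fun s : ℝ => join η s)
    (by
      have h : (fun s : ℝ => join η s) = fun s : ℝ => join η 0 + s • join (0 : Euc d) 1 := by
        funext s
        ext i
        refine Fin.lastCases ?_ (fun i => ?_) i <;> simp [join]
      rw [h]
      fun_prop)
    ⟨1, 1, fun s => by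
      have := abs_nrm_le (join η s)
      rw [nrm_join] at this
      rw [Real.norm_eq_abs]; linarith⟩

@[simp] theorem sliceNrm_apply (η : Euc d) (φ : 𝓢(Euc (d + 1), ℂ)) (s : ℝ) :
    sliceNrm η φ s = φ (join η s) := rfl

/-- The restriction of a Schwartz function to a hyperplane parallel to the boundary. -/
def sliceTang (s : ℝ) : 𝓢(Euc (d + 1), ℂ) →L[ℂ] 𝓢(Euc d, ℂ) :=
  SchwartzMap.compCLM ℂ (g := fun η : Euc d => join η s)
    (by
      have h : (fun η : Euc d => join η s) = fun η : Euc d =>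
          (LinearMap.toContinuousLinearMap
            ({ toFun := fun η => join η 0
               map_add' := fun x y => by
                ext i
                refine Fin.lastCases ?_ (fun i => ?_) i <;> simp [join]
               map_smul' := fun c x => by
                ext i
                refine Fin.lastCases ?_ (fun i => ?_) i <;> simp [join] } :
              Euc d →ₗ[ℝ] Euc (d + 1))) η + join 0 s := by
        funext η
        ext i
        refine Fin.lastCases ?_ (fun i => ?_) i <;> simp [join]
      rw [h]
      fun_prop)
    ⟨1, 1, fun η => by
      have := norm_tang_le (join η s)
      rw [tang_join] at this
      linarith⟩

@[simp] theorem sliceTang_apply (s : ℝ) (φ : 𝓢(Euc (d + 1), ℂ)) (η : Euc d) :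
    sliceTang s φ η = φ (join η s) := rfl

theorem exists_schwartz_bound {k : ℕ} (φ : 𝓢(Euc k, ℂ)) (N : ℕ) :
    ∃ C, 0 ≤ C ∧ ∀ x, ‖φ x‖ ≤ C * (1 + ‖x‖) ^ (-(N : ℝ)) := by
  obtain ⟨C, hC⟩ : ∃ C, ∀ x, (1 + ‖x‖) ^ N * ‖φ x‖ ≤ C := by
    refine ⟨2 ^ N * ((Finset.Iic (N, 0)).sup fun m => SchwartzMap.seminorm ℂ m.1 m.2) φ,
      fun x => ?_⟩
    have := SchwartzMap.one_add_le_sup_seminorm_apply (𝕜 := ℂ) (m := (N, 0)) (k := N) (n := 0)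
      le_rfl le_rfl φ x
    simpa using this
  refine ⟨C, le_trans (by positivity) (hC 0), fun x => ?_⟩
  rw [Real.rpow_neg (by positivity), Real.rpow_natCast, ← div_eq_mul_inv,
    le_div_iff₀ (by positivity)]
  linarith [hC x]

/-- The inverse partial Fourier transform `∫ e^{2πi x'·η} φ(x', y) dx'`. -/
def pft (φ : Euc (d + 1) → ℂ) (η : Euc d) (y : ℝ) : ℂ :=
  ∫ x : Euc d, Complex.exp ((2 * Real.pi * inner ℝ x η : ℝ) * Complex.I) * φ (join x y)

theorem norm_exp_ofReal_mul_I_mul (r : ℝ) (z : ℂ) :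
    ‖Complex.exp ((r : ℝ) * Complex.I) * z‖ = ‖z‖ := by
  rw [norm_mul, Complex.norm_exp_ofReal_mul_I, one_mul]

theorem continuous_pft (φ : 𝓢(Euc (d + 1), ℂ)) (η : Euc d) : Continuous (pft φ η) := by
  obtain ⟨N, hN⟩ := (inferInstance : (volume : Measure (Euc d)).HasTemperateGrowth).exists_integrable
  obtain ⟨C, hC0, hC⟩ := exists_schwartz_bound φ N
  unfold pft
  refine continuous_of_dominated (bound := fun x => C * (1 + ‖x‖) ^ (-(N : ℝ))) ?_ ?_
    (hN.const_mul C) ?_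
  · intro y
    refine Continuous.aestronglyMeasurable ?_
    have := φ.continuous
    fun_prop
  · intro y
    refine ae_of_all _ fun x => ?_
    rw [norm_exp_ofReal_mul_I_mul]
    refine (hC _).trans (mul_le_mul_of_nonneg_left ?_ hC0)
    have h := norm_tang_le (join x y)
    rw [tang_join] at h
    exact Real.rpow_le_rpow_of_nonpos (by positivity) (by linarith) (by simp)
  · refine ae_of_all _ fun x => ?_
    have := φ.continuous
    fun_prop

theorem integrable_exp_inner_mul_join (φ : 𝓢(Euc (d + 1), ℂ)) (η : Euc d) :
    Integrable (fun p : Euc d × ℝ =>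
      Complex.exp ((2 * Real.pi * inner ℝ p.1 η : ℝ) * Complex.I) * φ (join p.1 p.2))
      (volume.prod volume) := by
  have h := integrable_join_iff.2 φ.integrable
  refine h.mono ?_ (ae_of_all _ fun p => by rw [norm_exp_ofReal_mul_I_mul])
  refine Continuous.aestronglyMeasurable ?_
  have := φ.continuous
  fun_prop

theorem integrable_pft (φ : 𝓢(Euc (d + 1), ℂ)) (η : Euc d) : Integrable (pft φ η) :=
  (integrable_exp_inner_mul_join φ η).integral_prod_right

theorem fourierInv_pft (φ : 𝓢(Euc (d + 1), ℂ)) (η : Euc d) (s : ℝ) :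
    𝓕⁻ (pft φ η) s = (𝓕⁻ φ : 𝓢(Euc (d + 1), ℂ)) (join η s) := by
  rw [SchwartzMap.fourierInv_coe, Real.fourierInv_eq', Real.fourierInv_eq', integral_eq_join]
  rw [integral_prod_symm]
  · refine integral_congr_ae (ae_of_all _ fun y => ?_)
    simp only [pft, smul_eq_mul]
    rw [← integral_const_mul]
    refine integral_congr_ae (ae_of_all _ fun x => ?_)
    simp only [inner_eq_tang_nrm, tang_join, nrm_join]
    rw [← mul_assoc, ← Complex.exp_add]
    congr 2
    simp only [RCLike.inner_apply, conj_trivial]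
    push_cast
    ring
  · have h := integrable_join_iff.2 φ.integrable
    refine h.mono ?_ (ae_of_all _ fun p => by rw [smul_eq_mul, norm_exp_ofReal_mul_I_mul])
    refine Continuous.aestronglyMeasurable ?_
    have := φ.continuous
    fun_prop

theorem fourier_sliceNrm_fourierInv (φ : 𝓢(Euc (d + 1), ℂ)) (η : Euc d) :
    𝓕 (fun s : ℝ => (𝓕⁻ φ : 𝓢(Euc (d + 1), ℂ)) (join η s)) = pft φ η := by
  have h1 : (fun s : ℝ => (𝓕⁻ φ : 𝓢(Euc (d + 1), ℂ)) (join η s)) = 𝓕⁻ (pft φ η) :=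
    funext fun s => (fourierInv_pft φ η s).symm
  have h2 : Integrable (𝓕⁻ (pft φ η)) := by
    rw [← h1]; exact (sliceNrm η (𝓕⁻ φ)).integrable
  rw [h1]
  refine Continuous.fourier_fourierInv_eq (continuous_pft φ η) (integrable_pft φ η) ?_
  have h3 : 𝓕 (pft φ η) = fun s => 𝓕⁻ (pft φ η) (-s) := by
    funext s
    rw [Real.fourierInv_eq_fourier_neg, neg_neg]
  rw [h3]
  exact h2.comp_neg

theorem integral_mul_eq_fourier {k : ℕ} (φ : 𝓢(Euc k, ℂ)) (V : L2 k) :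
    ∫ x, φ x * V x = ∫ ξ, (𝓕⁻ φ : 𝓢(Euc k, ℂ)) ξ * (𝓕 V : L2 k) ξ := by
  rw [← coe_apply, ← coe_apply, ← Lp.fourier_toTemperedDistribution_eq,
    TemperedDistribution.fourier_apply, fourier_fourierInv_eq]

/-! ### Functions with a scaled profile in the normal variable -/

/-- The Fourier transform of `𝓕⁻_{η → x'} (f(η) q(⟨2πη⟩ x_n))`, for a profile `q` on the line. -/
def profile (q : ℝ → ℂ) (f : Euc d → ℂ) (ξ : Euc (d + 1)) : ℂ :=
  f (tang ξ) * (((sig (tang ξ))⁻¹ : ℝ) : ℂ) * 𝓕 q (nrm ξ * (sig (tang ξ))⁻¹)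

theorem fourier_scale (q : ℝ → ℂ) {σ : ℝ} (hσ : 0 < σ) (s : ℝ) :
    𝓕 (fun y => q (σ * y)) s = ((σ⁻¹ : ℝ) : ℂ) * 𝓕 q (s * σ⁻¹) := by
  rw [Real.fourier_real_eq_integral_exp_smul, Real.fourier_real_eq_integral_exp_smul]
  have h := Measure.integral_comp_mul_left
    (fun v : ℝ => Complex.exp ((-2 * Real.pi * v * (s * σ⁻¹) : ℝ) * Complex.I) • q v) σ
  rw [abs_of_pos (inv_pos.2 hσ), Complex.real_smul] at h
  rw [← h]
  refine integral_congr_ae (ae_of_all _ fun y => ?_)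
  simp only
  congr 4
  field_simp

theorem integral_fourier_mul_real {f g : ℝ → ℂ} (hf : Integrable f) (hg : Integrable g) :
    ∫ s, 𝓕 f s * g s = ∫ y, f y * 𝓕 g y := by
  have := VectorFourier.integral_fourierIntegral_smul_eq_flip (μ := volume) (ν := volume)
    (L := innerₗ ℝ) (f := f) (g := g) Real.continuous_fourierChar continuous_inner hf hg
  simp only [smul_eq_mul, flip_innerₗ] at this
  exact this

/-- Pairing with a scaled profile is, fibre by fibre, a pairing on the line with `y ↦ q(⟨2πη⟩ y)`; so the
support of `q` determines on which side of the boundary the function lives. -/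
theorem integral_profile_mul {q : ℝ → ℂ} (hq : Integrable q) {f : Euc d → ℂ}
    (hm : MemLp (profile q f) 2 volume) (φ : 𝓢(Euc (d + 1), ℂ)) :
    ∫ ξ, (𝓕⁻ φ : 𝓢(Euc (d + 1), ℂ)) ξ * profile q f ξ =
      ∫ η : Euc d, f η * ∫ y : ℝ, q (sig η * y) * pft φ η y := by
  rw [integral_join (integrable_schwartz_mul_memLp _ hm)]
  refine integral_congr_ae (ae_of_all _ fun η => ?_)
  have hσ := sig_pos η
  simp only [profile, tang_join, nrm_join]
  have h := integral_fourier_mul_real (f := fun y => q (sig η * y))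
    (g := fun s : ℝ => (𝓕⁻ φ : 𝓢(Euc (d + 1), ℂ)) (join η s)) (hq.comp_mul_left' hσ.ne')
    (sliceNrm η (𝓕⁻ φ)).integrable
  rw [fourier_sliceNrm_fourierInv] at h
  rw [← h, ← integral_const_mul]
  refine integral_congr_ae (ae_of_all _ fun s => ?_)
  simp only
  rw [fourier_scale q hσ]
  ring

theorem aestronglyMeasurable_comp_tang {f : Euc d → ℂ} (hf : AEStronglyMeasurable f volume) :
    AEStronglyMeasurable (fun ξ : Euc (d + 1) => f (tang ξ)) volume := by
  have h : AEStronglyMeasurable (fun p : Euc d × ℝ => f p.1) (volume.prod volume) := hf.comp_fst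
  exact h.comp_measurePreserving (measurePreserving_split (d := d))

theorem aestronglyMeasurable_profile {q : ℝ → ℂ} (hq : Continuous (𝓕 q)) {f : Euc d → ℂ}
    (hf : AEStronglyMeasurable f volume) : AEStronglyMeasurable (profile q f) volume := by
  unfold profile
  refine ((aestronglyMeasurable_comp_tang hf).mul ?_).mul ?_
  · refine Measurable.aestronglyMeasurable ?_
    fun_prop
  · refine Measurable.aestronglyMeasurable (hq.measurable.comp ?_)
    fun_prop

theorem continuous_fourier_of_integrable {q : ℝ → ℂ} (hq : Integrable q) : Continuous (𝓕 q) :=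
  VectorFourier.fourierIntegral_continuous Real.continuous_fourierChar continuous_inner hq

theorem lintegral_comp_mul_inv (g : ℝ → ℝ≥0∞) {σ : ℝ} (hσ : 0 < σ) :
    ∫⁻ s, g (s * σ⁻¹) = ENNReal.ofReal σ * ∫⁻ s, g s := by
  have h := (Homeomorph.mulRight₀ σ⁻¹ (inv_ne_zero hσ.ne')).measurableEmbedding.lintegral_map
    (μ := volume) g
  simp only [Homeomorph.coe_mulRight₀] at h
  rw [← h, Real.map_volume_mul_right (inv_ne_zero hσ.ne'), inv_inv, abs_of_pos hσ,
    lintegral_smul_measure, smul_eq_mul]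

theorem memLp_profile {q : ℝ → ℂ} (hq : Integrable q) (hq2 : MemLp (𝓕 q) 2 volume) {f : Euc d → ℂ}
    (hf : MemLp f 2 volume) : MemLp (profile q f) 2 volume := by
  have hm := aestronglyMeasurable_profile (continuous_fourier_of_integrable hq) hf.1
  rw [memLp_two_iff hm]
  have hf1 := hf.1
  rw [memLp_two_iff hf.1] at hf
  rw [memLp_two_iff hq2.1] at hq2
  rw [lintegral_join (hm.enorm.pow_const 2)]
  have : ∀ η : Euc d, ∫⁻ s : ℝ, ‖profile q f (join η s)‖ₑ ^ 2 ≤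
      ‖f η‖ₑ ^ 2 * ∫⁻ s, ‖𝓕 q s‖ₑ ^ 2 := by
    intro η
    have hσ := sig_pos η
    simp only [profile, tang_join, nrm_join, enorm_mul, mul_pow]
    rw [lintegral_const_mul', lintegral_comp_mul_inv (fun s => ‖𝓕 q s‖ₑ ^ 2) hσ, mul_assoc,
      ← mul_assoc (‖(((sig η)⁻¹ : ℝ) : ℂ)‖ₑ ^ 2)]
    · refine mul_le_mul' le_rfl (mul_le_of_le_one_left' ?_)
      rw [← ofReal_norm, Complex.norm_real, Real.norm_of_nonneg (inv_nonneg.2 hσ.le),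
        ← ENNReal.ofReal_pow (inv_nonneg.2 hσ.le), ← ENNReal.ofReal_mul (by positivity),
        ENNReal.ofReal_le_one]
      have := one_le_sig η
      rw [pow_two, mul_assoc, inv_mul_cancel₀ hσ.ne', mul_one]
      exact inv_le_one_of_one_le₀ this
    · finiteness
  refine (lintegral_mono this).trans_lt ?_
  rw [lintegral_mul_const'' _ (hf1.enorm.pow_const 2)]
  exact ENNReal.mul_lt_top hf hq2

theorem pft_eq_zero {φ : Euc (d + 1) → ℂ} {y : ℝ} (h : ∀ x, nrm x = y → φ x = 0) (η : Euc d) :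
    pft φ η y = 0 := by
  unfold pft
  simp [h _ (nrm_join _ y)]

/-- A profile supported in the right half-line belongs to a function supported in the upper
half-space. -/
theorem isUpper_of_profile {q : ℝ → ℂ} (hq : Integrable q) (hq0 : ∀ x < 0, q x = 0)
    {f : Euc d → ℂ} {V : L2 (d + 1)}
    (hV : ((𝓕 V : L2 (d + 1)) : Euc (d + 1) → ℂ) =ᵐ[volume] profile q f) : IsUpper V := by
  have hm : MemLp (profile q f) 2 volume := (memLp_congr_ae hV).1 (Lp.memLp _)
  refine (isVanishingOn_coe_iff (s := {x | nrm x < 0})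
    (isOpen_lt continuous_nrm continuous_const) V).1 fun φ hφ => ?_
  rw [coe_apply, integral_mul_eq_fourier, integral_congr_ae (g := fun ξ =>
    (𝓕⁻ φ : 𝓢(Euc (d + 1), ℂ)) ξ * profile q f ξ) (by filter_upwards [hV] with x hx; rw [hx]),
    integral_profile_mul hq hm]
  refine integral_eq_zero_of_ae (ae_of_all _ fun η => ?_)
  simp only [Pi.zero_apply]
  rw [integral_eq_zero_of_ae, mul_zero]
  refine ae_of_all _ fun y => ?_
  simp only [Pi.zero_apply]
  rcases lt_or_ge y 0 with hy | hy
  · rw [hq0 _ (mul_neg_of_pos_of_neg (sig_pos η) hy), zero_mul]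
  · rw [pft_eq_zero (fun x hx => ?_), mul_zero]
    refine image_eq_zero_of_notMem_tsupport fun h' => ?_
    have : nrm x < 0 := hφ h'
    linarith

theorem isLower_of_profile {q : ℝ → ℂ} (hq : Integrable q) (hq0 : ∀ x, 0 < x → q x = 0)
    {f : Euc d → ℂ} {V : L2 (d + 1)}
    (hV : ((𝓕 V : L2 (d + 1)) : Euc (d + 1) → ℂ) =ᵐ[volume] profile q f) : IsLower V := by
  have hm : MemLp (profile q f) 2 volume := (memLp_congr_ae hV).1 (Lp.memLp _)
  refine (isVanishingOn_openHalf_iff V).1 fun φ hφ => ?_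
  rw [coe_apply, integral_mul_eq_fourier, integral_congr_ae (g := fun ξ =>
    (𝓕⁻ φ : 𝓢(Euc (d + 1), ℂ)) ξ * profile q f ξ) (by filter_upwards [hV] with x hx; rw [hx]),
    integral_profile_mul hq hm]
  refine integral_eq_zero_of_ae (ae_of_all _ fun η => ?_)
  simp only [Pi.zero_apply]
  rw [integral_eq_zero_of_ae, mul_zero]
  refine ae_of_all _ fun y => ?_
  simp only [Pi.zero_apply]
  rcases lt_or_ge 0 y with hy | hy
  · rw [hq0 _ (mul_pos (sig_pos η) hy), zero_mul]
  · rw [pft_eq_zero (fun x hx => ?_), mul_zero]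
    refine image_eq_zero_of_notMem_tsupport fun h' => ?_
    have : 0 < nrm x := hφ h'
    linarith

/-! ### Gamma profiles and the Poisson operator -/

/-- The profile `x_+^b e^{-x}`. -/
def gam (b : ℝ) (x : ℝ) : ℂ := if 0 < x then ((x ^ b * Real.exp (-x) : ℝ) : ℂ) else 0

theorem gam_eq_indicator (b : ℝ) :
    gam b = (Set.Ioi 0).indicator fun x => ((x ^ b * Real.exp (-x) : ℝ) : ℂ) := by
  funext x
  simp [gam, Set.indicator_apply]

theorem integrable_gam {b : ℝ} (hb : -1 < b) : Integrable (gam b) := by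
  rw [gam_eq_indicator, integrable_indicator_iff measurableSet_Ioi]
  have h := (Real.GammaIntegral_convergent (s := b + 1) (by linarith)).ofReal (𝕜 := ℂ)
  refine h.congr (ae_of_all _ fun x => ?_)
  simp [mul_comm]

theorem gam_add_one {b x : ℝ} : (x : ℂ) * gam b x = gam (b + 1) x := by
  unfold gam
  split_ifs with h
  · rw [Real.rpow_add_one h.ne']; push_cast; ring
  · simp

theorem linePow_one (w : ℝ) : linePow 1 w = 1 + Complex.I * w := by simp [linePow]

theorem fourier_gam_eq (b s : ℝ) : 𝓕 (gam b) s =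
    ∫ x in Set.Ioi (0 : ℝ), ((x ^ b : ℝ) : ℂ) *
      Complex.exp (-((1 + Complex.I * (2 * Real.pi * s : ℝ)) * x)) := by
  rw [Real.fourier_real_eq_integral_exp_smul, gam_eq_indicator, ← integral_indicator measurableSet_Ioi]
  refine integral_congr_ae (ae_of_all _ fun x => ?_)
  simp only [Set.indicator_apply]
  split_ifs with h
  · rw [smul_eq_mul, Complex.ofReal_mul (x ^ b), Complex.ofReal_exp, mul_left_comm,
      ← Complex.exp_add]
    congr 2
    push_cast; ring
  · simp

theorem integrableOn_rpow_mul_cexp {b : ℝ} (hb : -1 < b) (w : ℝ) :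
    IntegrableOn (fun x : ℝ => ((x ^ b : ℝ) : ℂ) * Complex.exp (-((1 + Complex.I * w) * x)))
      (Set.Ioi 0) := by
  have h := Real.GammaIntegral_convergent (s := b + 1) (by linarith)
  refine h.mono' ?_ ?_
  · refine Measurable.aestronglyMeasurable ?_
    fun_prop
  · filter_upwards [ae_restrict_mem measurableSet_Ioi] with x hx
    have hx0 : (0 : ℝ) < x := hx
    rw [norm_mul, Complex.norm_real, Complex.norm_exp, Real.norm_of_nonneg (by positivity)]
    simp [mul_comm]

/-- Integration by parts: `d/dx (x^{b+1} e^{-zx}) = (b+1) x^b e^{-zx} - z x^{b+1} e^{-zx}` with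
`z = 1 + 2πis`. -/
theorem fourier_gam_add_one {b : ℝ} (hb : -1 < b) (s : ℝ) :
    (1 + Complex.I * (2 * Real.pi * s : ℝ)) * 𝓕 (gam (b + 1)) s = (b + 1 : ℝ) * 𝓕 (gam b) s := by
  set z : ℂ := 1 + Complex.I * (2 * Real.pi * s : ℝ) with hz
  have hderiv : ∀ x ∈ Set.Ioi (0 : ℝ), HasDerivAt
      (fun x : ℝ => ((x ^ (b + 1) : ℝ) : ℂ) * Complex.exp (-(z * x)))
      ((b + 1 : ℝ) * (((x ^ b : ℝ) : ℂ) * Complex.exp (-(z * x))) -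
        z * (((x ^ (b + 1) : ℝ) : ℂ) * Complex.exp (-(z * x)))) x := by
    intro x hx
    have hx0 : (0 : ℝ) < x := hx
    have h1 : HasDerivAt (fun x : ℝ => ((x ^ (b + 1) : ℝ) : ℂ)) (((b + 1) * x ^ b : ℝ) : ℂ) x := by
      have := (Real.hasDerivAt_rpow_const (x := x) (p := b + 1) (Or.inl hx0.ne')).ofReal_comp
      simpa using this
    have h2 : HasDerivAt (fun x : ℝ => Complex.exp (-(z * x))) (Complex.exp (-(z * x)) * (-z)) x := by
      have h3 : HasDerivAt (fun y : ℂ => -(z * y)) (-z) (x : ℂ) := by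
        exact ((hasDerivAt_id (x : ℂ)).const_mul z).neg.congr_deriv (by ring)
      exact h3.cexp.comp_ofReal
    refine (h1.mul h2).congr_deriv ?_
    push_cast; ring
  have hi1 := integrableOn_rpow_mul_cexp hb (2 * Real.pi * s)
  have hi2 := integrableOn_rpow_mul_cexp (b := b + 1) (by linarith) (2 * Real.pi * s)
  have hnorm : ∀ x : ℝ, 0 ≤ x → ‖((x ^ (b + 1) : ℝ) : ℂ) * Complex.exp (-(z * x))‖ =
      x ^ (b + 1) * Real.exp (-x) := by
    intro x hx
    rw [norm_mul, Complex.norm_real, Complex.norm_exp, Real.norm_of_nonneg (by positivity)]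
    simp [hz]
  have hcont : ContinuousWithinAt (fun x : ℝ => ((x ^ (b + 1) : ℝ) : ℂ) * Complex.exp (-(z * x)))
      (Set.Ici 0) 0 := by
    have : Continuous fun x : ℝ => x ^ (b + 1) := Real.continuous_rpow_const (by linarith)
    refine Continuous.continuousWithinAt ?_
    fun_prop
  have hlim : Filter.Tendsto (fun x : ℝ => ((x ^ (b + 1) : ℝ) : ℂ) * Complex.exp (-(z * x)))
      Filter.atTop (nhds 0) := by
    rw [tendsto_zero_iff_norm_tendsto_zero]
    have := tendsto_rpow_mul_exp_neg_mul_atTop_nhds_zero (b + 1) 1 one_pos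
    refine this.congr' ?_
    filter_upwards [Filter.eventually_ge_atTop 0] with x hx
    rw [hnorm x hx]; simp
  have h := integral_Ioi_of_hasDerivAt_of_tendsto hcont hderiv
    ((hi1.const_mul _).sub (hi2.const_mul _)) hlim
  rw [integral_sub (hi1.const_mul _) (hi2.const_mul _), integral_const_mul, integral_const_mul,
    ← fourier_gam_eq, ← fourier_gam_eq] at h
  have h0 : ((((0 : ℝ) ^ (b + 1) : ℝ) : ℂ)) = 0 := by
    rw [Real.zero_rpow (by linarith)]; simp
  rw [h0, zero_mul, sub_zero] at h
  exact (sub_eq_zero.1 h).symm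

/-- `𝓕 (x_+^b e^{-x}) = Γ(b+1) (1 + 2πis)^{-b-1}`: the product of the left side with `(1 + 2πis)^{b+1}`
has derivative zero. -/
theorem fourier_gam {b : ℝ} (hb : -1 < b) (s : ℝ) :
    𝓕 (gam b) s = (Real.Gamma (b + 1) : ℂ) * linePow (-(b + 1)) (2 * Real.pi * s) := by
  have hd : ∀ s : ℝ, HasDerivAt (fun s => 𝓕 (gam b) s * linePow (b + 1) (2 * Real.pi * s)) 0 s := by
    intro s
    have h1 : HasDerivAt (𝓕 (gam b)) (-2 * Real.pi * Complex.I * 𝓕 (gam (b + 1)) s) s := by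
      have hi : Integrable fun x : ℝ => x • gam b x := by
        simp only [Complex.real_smul, gam_add_one]
        exact integrable_gam (by linarith)
      have h := Real.hasDerivAt_fourier (integrable_gam hb) hi s
      refine h.congr_deriv ?_
      have : (fun x : ℝ => (-2 * (Real.pi : ℂ) * Complex.I * x) • gam b x) =
          fun x => (-2 * Real.pi * Complex.I) • gam (b + 1) x := by
        funext x
        rw [← gam_add_one, smul_eq_mul, smul_eq_mul]; ring
      rw [this, Real.fourier_real_eq_integral_exp_smul, Real.fourier_real_eq_integral_exp_smul,
        ← integral_const_mul]
      refine integral_congr_ae (ae_of_all _ fun x => ?_)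
      simp only [smul_eq_mul]; ring
    have h2 : HasDerivAt (fun s : ℝ => linePow (b + 1) (2 * Real.pi * s))
        ((b + 1 : ℝ) * Complex.I * linePow b (2 * Real.pi * s) * (2 * Real.pi : ℝ)) s := by
      have h3 : HasDerivAt (fun s : ℝ => 2 * Real.pi * s) (2 * Real.pi) s := by
        simpa using (hasDerivAt_id s).const_mul (2 * Real.pi)
      have h4 := (hasDerivAt_linePow (b + 1) (2 * Real.pi * s)).scomp s h3
      refine h4.congr_deriv ?_
      rw [Complex.real_smul, show b + 1 - 1 = b by ring]
      ring
    refine (h1.mul h2).congr_deriv ?_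
    have h5 := fourier_gam_add_one hb s
    rw [linePow_add b 1, linePow_one]
    push_cast at h5 ⊢
    linear_combination (-2 * Real.pi * Complex.I * linePow b (2 * Real.pi * s)) * h5
  have hconst := is_const_of_deriv_eq_zero (𝕜 := ℝ)
    (f := fun s => 𝓕 (gam b) s * linePow (b + 1) (2 * Real.pi * s))
    (fun s => (hd s).differentiableAt) (fun s => (hd s).deriv) s 0
  have h0 : 𝓕 (gam b) 0 = (Real.Gamma (b + 1) : ℂ) := by
    rw [fourier_gam_eq, Real.Gamma_eq_integral (by linarith), ← integral_complex_ofReal]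
    refine integral_congr_ae (ae_of_all _ fun x => ?_)
    simp [mul_comm]
  simp only [h0, mul_zero] at hconst
  rw [linePow_neg, eq_mul_inv_iff_mul_eq₀, hconst]
  · simp [linePow]
  · exact fun h => by
      have := congrArg norm h
      rw [norm_linePow, norm_zero] at this
      exact (Real.rpow_pos_of_pos (by positivity) _).ne' this

theorem memLp_linePow {t : ℝ} (ht : t ≤ -1) :
    MemLp (fun s : ℝ => linePow t (2 * Real.pi * s)) 2 volume := by
  rw [memLp_two_iff (by fun_prop)]
  have h : Integrable fun s : ℝ => (1 + s ^ 2)⁻¹ := integrable_inv_one_add_sq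
  refine lt_of_le_of_lt (lintegral_mono fun s => ?_) h.lintegral_lt_top
  rw [← ofReal_norm, ← ENNReal.ofReal_pow (norm_nonneg _), norm_linePow]
  refine ENNReal.ofReal_le_ofReal ?_
  rw [← Real.rpow_natCast, ← Real.rpow_mul (by positivity)]
  have h1 : (1 + (2 * Real.pi * s) ^ 2) ^ (t / 2 * ((2 : ℕ) : ℝ)) ≤
      (1 + (2 * Real.pi * s) ^ 2) ^ (-1 : ℝ) :=
    Real.rpow_le_rpow_of_exponent_le (by nlinarith [sq_nonneg (2 * Real.pi * s)])
      (by push_cast; linarith)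
  refine h1.trans ?_
  rw [Real.rpow_neg_one]
  refine inv_anti₀ (by positivity) ?_
  nlinarith [one_le_four_pi_sq, sq_nonneg s]

theorem memLp_fourier_gam {b : ℝ} (hb : 0 ≤ b) : MemLp (𝓕 (gam b)) 2 volume := by
  have : 𝓕 (gam b) = fun s => (Real.Gamma (b + 1) : ℂ) * linePow (-(b + 1)) (2 * Real.pi * s) :=
    funext fun s => fourier_gam (by linarith) s
  rw [this]
  exact (memLp_linePow (by linarith)).const_mul _

/-- With the gamma profile, scaled functions have the Fourier transforms `f(ξ') (⟨ξ'⟩ + iξ_n)^{-b-1}`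
up to a constant. -/
theorem profile_gam {b : ℝ} (hb : -1 < b) (f : Euc d → ℂ) (ξ : Euc (d + 1)) :
    profile (gam b) (fun η => ((sig η ^ (-b) : ℝ) : ℂ) * f η) ξ =
      f (tang ξ) * (Real.Gamma (b + 1) * xiSymbol (-(b + 1)) ξ) := by
  have hσ := sig_pos (tang ξ)
  have h : ((sig (tang ξ) ^ (-(b + 1)) : ℝ) : ℂ) =
      ((sig (tang ξ) ^ (-b) : ℝ) : ℂ) * (((sig (tang ξ))⁻¹ : ℝ) : ℂ) := by
    rw [← Complex.ofReal_mul, ← Real.rpow_neg_one, ← Real.rpow_add hσ]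
    congr 2; ring
  rw [profile, fourier_gam hb, xiSymbol_eq, h]
  ring

theorem fourier_reflect (q : ℝ → ℂ) (s : ℝ) : 𝓕 (fun x => q (-x)) s = 𝓕 q (-s) := by
  rw [Real.fourier_real_eq_integral_exp_smul, Real.fourier_real_eq_integral_exp_smul,
    ← integral_neg_eq_self]
  refine integral_congr_ae (ae_of_all _ fun x => ?_)
  simp

theorem conj_linePow (t w : ℝ) : (starRingEnd ℂ) (linePow t w) = linePow t (-w) := by
  have h := Complex.cpow_conj (1 + Complex.I * (w : ℂ)) (t : ℂ)
    (Complex.slitPlane_arg_ne_pi (one_add_I_mul_mem_slitPlane w))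
  rw [Complex.conj_ofReal] at h
  rw [linePow, linePow, h, Complex.conj_conj]
  simp

/-- Reflection of the profile in the boundary conjugates the symbol. -/
theorem profile_gam_reflect {b : ℝ} (hb : -1 < b) (f : Euc d → ℂ) (ξ : Euc (d + 1)) :
    profile (fun x => gam b (-x)) (fun η => ((sig η ^ (-b) : ℝ) : ℂ) * f η) ξ =
      f (tang ξ) * (Real.Gamma (b + 1) * (starRingEnd ℂ) (xiSymbol (-(b + 1)) ξ)) := by
  have hσ := sig_pos (tang ξ)
  have h : ((sig (tang ξ) ^ (-(b + 1)) : ℝ) : ℂ) =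
      ((sig (tang ξ) ^ (-b) : ℝ) : ℂ) * (((sig (tang ξ))⁻¹ : ℝ) : ℂ) := by
    rw [← Complex.ofReal_mul, ← Real.rpow_neg_one, ← Real.rpow_add hσ]
    congr 2; ring
  rw [profile, fourier_reflect, fourier_gam hb, xiSymbol_eq, map_mul, Complex.conj_ofReal, h,
    conj_linePow]
  ring_nf

theorem memLp_sig_rpow_mul {t : ℝ} (ht : t ≤ 0) {f : Euc d → ℂ} (hf : MemLp f 2 volume) :
    MemLp (fun η => ((sig η ^ t : ℝ) : ℂ) * f η) 2 volume := by
  refine hf.mono ?_ (ae_of_all _ fun η => ?_)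
  · exact ((sig_temperate_rpow t).1.continuous.aestronglyMeasurable).mul hf.1
  · rw [norm_mul, Complex.norm_real, Real.norm_of_nonneg (Real.rpow_nonneg (sig_pos η).le _)]
    exact mul_le_of_le_one_left (norm_nonneg _)
      (Real.rpow_le_one_of_one_le_of_nonpos (one_le_sig η) ht)

theorem gamma_ne_zero {b : ℝ} (hb : 0 ≤ b) : ((Real.Gamma (b + 1) : ℝ) : ℂ) ≠ 0 := by
  exact_mod_cast (Real.Gamma_pos_of_pos (by linarith)).ne'

theorem memLp_mul_xiSymbol {b : ℝ} (hb : 0 ≤ b) {f : Euc d → ℂ} (hf : MemLp f 2 volume) :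
    MemLp (fun ξ : Euc (d + 1) => f (tang ξ) * xiSymbol (-(b + 1)) ξ) 2 volume := by
  have h := (memLp_profile (integrable_gam (b := b) (by linarith)) (memLp_fourier_gam hb)
    (memLp_sig_rpow_mul (t := -b) (by linarith) hf)).const_mul (Real.Gamma (b + 1) : ℂ)⁻¹
  refine (memLp_congr_ae (ae_of_all _ fun ξ => ?_)).1 h
  rw [profile_gam (by linarith)]
  have := gamma_ne_zero hb
  field_simp

theorem memLp_mul_conj_xiSymbol {b : ℝ} (hb : 0 ≤ b) {f : Euc d → ℂ} (hf : MemLp f 2 volume) :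
    MemLp (fun ξ : Euc (d + 1) => f (tang ξ) * (starRingEnd ℂ) (xiSymbol (-(b + 1)) ξ)) 2 volume := by
  have h := memLp_mul_xiSymbol hb hf
  refine h.mono ?_ (ae_of_all _ fun ξ => by simp)
  refine (aestronglyMeasurable_comp_tang hf.1).mul ?_
  exact (Complex.continuous_conj.comp (continuous_xiSymbol _)).aestronglyMeasurable

theorem isUpper_of_fourier {b : ℝ} (hb : 0 ≤ b) {f : Euc d → ℂ} {V : L2 (d + 1)}
    (hV : ((𝓕 V : L2 (d + 1)) : Euc (d + 1) → ℂ) =ᵐ[volume]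
      fun ξ => f (tang ξ) * xiSymbol (-(b + 1)) ξ) : IsUpper V := by
  refine isUpper_of_profile (q := gam b) (integrable_gam (by linarith))
    (fun x hx => if_neg (not_lt.2 hx.le))
    (f := fun η => ((sig η ^ (-b) : ℝ) : ℂ) * ((Real.Gamma (b + 1) : ℂ)⁻¹ * f η)) ?_
  filter_upwards [hV] with ξ h
  rw [h, profile_gam (f := fun η => (Real.Gamma (b + 1) : ℂ)⁻¹ * f η) (by linarith)]
  have := gamma_ne_zero hb
  field_simp

theorem isLower_of_fourier {b : ℝ} (hb : 0 ≤ b) {f : Euc d → ℂ} {V : L2 (d + 1)}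
    (hV : ((𝓕 V : L2 (d + 1)) : Euc (d + 1) → ℂ) =ᵐ[volume]
      fun ξ => f (tang ξ) * (starRingEnd ℂ) (xiSymbol (-(b + 1)) ξ)) : IsLower V := by
  refine isLower_of_profile (q := fun x => gam b (-x)) (integrable_gam (by linarith)).comp_neg
    (fun x hx => if_neg (by linarith))
    (f := fun η => ((sig η ^ (-b) : ℝ) : ℂ) * ((Real.Gamma (b + 1) : ℂ)⁻¹ * f η)) ?_
  filter_upwards [hV] with ξ h
  rw [h, profile_gam_reflect (f := fun η => (Real.Gamma (b + 1) : ℂ)⁻¹ * f η) (by linarith)]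
  have := gamma_ne_zero hb
  field_simp

/-! ### The Poisson operator -/

theorem exp_neg_mul_sig_le {ε : ℝ} (hε : 0 < ε) : ∃ C : ℝ, ∀ η : Euc d,
    Real.exp (-(sig η * ε)) ≤ C * (1 + ‖η‖ ^ 2) ^ (-(2 * (d + 1) : ℝ) / 2) := by
  refine ⟨(2 * (d + 1)).factorial / ε ^ (2 * (d + 1)), fun η => ?_⟩
  have hσ := sig_pos η
  have h1 := Real.pow_div_factorial_le_exp (sig η * ε) (by positivity) (2 * (d + 1))
  have h2 : (1 + ‖η‖ ^ 2) ^ (d + 1) ≤ sig η ^ (2 * (d + 1)) := by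
    rw [pow_mul, sig_sq]
    have := one_le_four_pi_sq
    gcongr
    exact le_mul_of_one_le_left (by positivity) this
  have h3 : (1 + ‖η‖ ^ 2) ^ (-(2 * (d + 1) : ℝ) / 2) = ((1 + ‖η‖ ^ 2) ^ (d + 1))⁻¹ := by
    rw [show -(2 * (d + 1) : ℝ) / 2 = -((d + 1 : ℕ) : ℝ) by push_cast; ring,
      Real.rpow_neg (by positivity), Real.rpow_natCast]
  have hp : 0 < (1 + ‖η‖ ^ 2) ^ (d + 1) := by positivity
  rw [h3, Real.exp_neg, ← div_eq_mul_inv, div_div, inv_le_comm₀ (Real.exp_pos _) (by positivity),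
    inv_div]
  refine le_trans ?_ h1
  rw [mul_pow, mul_comm]
  gcongr

theorem memLp_exp_neg_mul_sig {ε : ℝ} (hε : 0 < ε) :
    MemLp (fun η : Euc d => Real.exp (-(sig η * ε))) 2 volume := by
  obtain ⟨C, hC⟩ := exp_neg_mul_sig_le (d := d) (ε := 2 * ε) (by linarith)
  have hc : Continuous fun η : Euc d => Real.exp (-(sig η * ε)) :=
    Real.continuous_exp.comp ((continuous_sig.mul continuous_const).neg)
  rw [memLp_two_iff_integrable_sq hc.aestronglyMeasurable]
  have hi := (integrable_rpow_neg_one_add_norm_sq (E := Euc d) (μ := volume)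
    (r := 2 * (d + 1)) (by simp; linarith)).const_mul C
  refine hi.mono' (hc.pow 2).aestronglyMeasurable (ae_of_all _ fun η => ?_)
  rw [Real.norm_of_nonneg (by positivity), ← Real.exp_nat_mul]
  refine le_trans (le_of_eq ?_) (hC η)
  congr 1
  push_cast
  ring

theorem integrable_exp_neg_mul_sig_mul_norm {ε : ℝ} (hε : 0 < ε) {f : Euc d → ℂ}
    (hf : MemLp f 2 volume) :
    Integrable fun η => Real.exp (-(sig η * ε)) * ‖f η‖ :=
  (memLp_exp_neg_mul_sig hε).integrable_mul hf.norm

/-- The integrand of the Poisson integral. -/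
def poissonKer (f : Euc d → ℂ) (x : Euc (d + 1)) (η : Euc d) : ℂ :=
  Complex.exp ((2 * Real.pi * inner ℝ (tang x) η : ℝ) * Complex.I) *
    (Real.exp (-(sig η * nrm x)) * f η)

theorem norm_poissonKer (f : Euc d → ℂ) (x : Euc (d + 1)) (η : Euc d) :
    ‖poissonKer f x η‖ = Real.exp (-(sig η * nrm x)) * ‖f η‖ := by
  rw [poissonKer, norm_exp_ofReal_mul_I_mul, norm_mul, Complex.norm_real,
    Real.norm_of_nonneg (Real.exp_pos _).le]

theorem poisson_of_pos (ψ : L2 d) {x : Euc (d + 1)} (hx : 0 < nrm x) :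
    poisson ψ x = ∫ η, poissonKer (𝓕 ψ : L2 d) x η := by
  rw [poisson, if_pos hx]
  refine integral_congr_ae (ae_of_all _ fun η => ?_)
  simp only [poissonKer, sig]
  push_cast
  ring

theorem aestronglyMeasurable_poissonKer {f : Euc d → ℂ} (hf : AEStronglyMeasurable f volume) :
    AEStronglyMeasurable (fun p : Euc (d + 1) × Euc d => poissonKer f p.1 p.2)
      (volume.prod volume) := by
  unfold poissonKer
  refine AEStronglyMeasurable.mul ?_ (AEStronglyMeasurable.mul ?_ hf.comp_snd)
  · refine Continuous.aestronglyMeasurable ?_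
    fun_prop
  · refine Continuous.aestronglyMeasurable ?_
    have := continuous_sig (d := d)
    fun_prop

theorem continuousOn_integral_poissonKer {f : Euc d → ℂ} (hf : MemLp f 2 volume) :
    ContinuousOn (fun x : Euc (d + 1) => ∫ η, poissonKer f x η) (openHalf d) := by
  intro x hx
  refine ContinuousAt.continuousWithinAt ?_
  have hx' : 0 < nrm x := hx
  refine continuousAt_of_dominated (bound := fun η => Real.exp (-(sig η * (nrm x / 2))) * ‖f η‖)
    (Filter.Eventually.of_forall fun z => ?_) ?_
    (integrable_exp_neg_mul_sig_mul_norm (by linarith) hf) (ae_of_all _ fun η => ?_)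
  · unfold poissonKer
    have := continuous_sig (d := d)
    refine AEStronglyMeasurable.mul ?_ (AEStronglyMeasurable.mul ?_ hf.1)
    · refine Continuous.aestronglyMeasurable ?_
      fun_prop
    · refine Continuous.aestronglyMeasurable ?_
      fun_prop
  · have : ∀ᶠ z in nhds x, nrm x / 2 < nrm z :=
      continuous_nrm.continuousAt.eventually_const_lt (by linarith)
    filter_upwards [this] with z hz
    refine ae_of_all _ fun η => ?_
    rw [norm_poissonKer]
    have := sig_pos η
    gcongr
  · unfold poissonKer
    fun_prop

theorem continuousOn_poisson (ψ : L2 d) : ContinuousOn (poisson ψ) (openHalf d) :=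
  (continuousOn_integral_poissonKer (Lp.memLp (𝓕 ψ))).congr fun _ hx => poisson_of_pos ψ hx

/-- A compactly supported function in the open half-space stays away from the boundary. -/
theorem exists_pos_le_nrm {φ : Euc (d + 1) → ℂ} (hc : HasCompactSupport φ)
    (hs : tsupport φ ⊆ openHalf d) : ∃ ε > 0, ∀ x, nrm x < ε → φ x = 0 := by
  rcases (tsupport φ).eq_empty_or_nonempty with he | hne
  · exact ⟨1, one_pos, fun x _ => image_eq_zero_of_notMem_tsupport (by simp [he])⟩
  · obtain ⟨z, hz, hmin⟩ := IsCompact.exists_isMinOn hc hne continuous_nrm.continuousOn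
    refine ⟨nrm z, hs hz, fun x hx => image_eq_zero_of_notMem_tsupport fun h => ?_⟩
    exact absurd (hmin h) (not_le.2 hx)

/-- The `L²` function whose Fourier transform is `(𝓕 ψ)(ξ') Γ(b+1) (⟨ξ'⟩ + i ξ_n)^{-b-1}` is
`x_n^b K₀ψ`. -/
theorem ae_eq_nrmPowMul_poisson {b : ℝ} (hb : 0 ≤ b) {ψ : L2 d} {V : L2 (d + 1)}
    (hV : ((𝓕 V : L2 (d + 1)) : Euc (d + 1) → ℂ) =ᵐ[volume]
      fun ξ => (Real.Gamma (b + 1) : ℂ) * (𝓕 ψ : L2 d) (tang ξ) * xiSymbol (-(b + 1)) ξ) :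
    (V : Euc (d + 1) → ℂ) =ᵐ[volume] nrmPowMul b (poisson ψ) := by
  set f : Euc d → ℂ := ((𝓕 ψ : L2 d) : Euc d → ℂ) with hf
  have hf2 : MemLp f 2 volume := Lp.memLp _
  have hup : IsUpper V := isUpper_of_fourier hb (f := fun η => (Real.Gamma (b + 1) : ℂ) * f η) hV
  have hcont : ContinuousOn (nrmPowMul b (poisson ψ)) (openHalf d) := by
    have h1 : ContinuousOn (fun x : Euc (d + 1) => ((nrm x ^ b : ℝ) : ℂ) * poisson ψ x)
        (openHalf d) := by
      refine ContinuousOn.mul ?_ (continuousOn_poisson ψ)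
      refine Complex.continuous_ofReal.comp_continuousOn ?_
      exact continuous_nrm.continuousOn.rpow_const fun x hx => Or.inl (ne_of_gt hx)
    refine h1.congr fun x hx => ?_
    exact if_pos (show 0 < nrm x from hx)
  have hpos : ∀ᵐ x, x ∈ openHalf d → V x = nrmPowMul b (poisson ψ) x := by
    refine ae_eq_of_schwartz_on isOpen_openHalf
      (((Lp.memLp V).locallyIntegrable (by norm_num)).locallyIntegrableOn _)
      (hcont.locallyIntegrableOn measurableSet_openHalf) fun φ hφc hφs => ?_
    obtain ⟨ε, hε, hφ0⟩ := exists_pos_le_nrm hφc hφs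
    set g : Euc d → ℂ := fun η => ((sig η ^ (-b) : ℝ) : ℂ) * f η
    have hVp : ((𝓕 V : L2 (d + 1)) : Euc (d + 1) → ℂ) =ᵐ[volume] profile (gam b) g := by
      filter_upwards [hV] with ξ h
      rw [h, profile_gam (by linarith)]
      ring
    have hm : MemLp (profile (gam b) g) 2 volume := (memLp_congr_ae hVp).1 (Lp.memLp _)
    rw [integral_mul_eq_fourier, integral_congr_ae (g := fun ξ =>
      (𝓕⁻ φ : 𝓢(Euc (d + 1), ℂ)) ξ * profile (gam b) g ξ)
      (by filter_upwards [hVp] with x hx; rw [hx]), integral_profile_mul (integrable_gam (by linarith)) hm]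
    -- the double integral over `(x, η)`
    set w : Euc (d + 1) → ℂ := fun x => φ x * ((nrm x ^ b : ℝ) : ℂ) with hw
    have hwc : Continuous w := by
      rw [continuous_iff_continuousAt]
      intro x
      rcases lt_or_ge 0 (nrm x) with h | h
      · refine φ.continuous.continuousAt.mul (Complex.continuous_ofReal.continuousAt.comp ?_)
        exact continuous_nrm.continuousAt.rpow_const (Or.inl h.ne')
      · have : w =ᶠ[nhds x] fun _ => 0 := by
          have : ∀ᶠ z in nhds x, nrm z < ε :=
            continuous_nrm.continuousAt.eventually_lt_const (by linarith)
          filter_upwards [this] with z hz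
          simp [hw, hφ0 z hz]
        exact continuousAt_const.congr this.symm
    have hwi : Integrable w := by
      refine hwc.integrable_of_hasCompactSupport ?_
      exact hφc.mul_right
    have hF : Integrable (fun p : Euc (d + 1) × Euc d => w p.1 * poissonKer f p.1 p.2)
        (volume.prod volume) := by
      refine (hwi.norm.mul_prod (integrable_exp_neg_mul_sig_mul_norm hε hf2)).mono'
        (hwc.aestronglyMeasurable.comp_fst.mul (aestronglyMeasurable_poissonKer hf2.1))
        (ae_of_all _ fun p => ?_)
      rw [norm_mul, norm_poissonKer]
      rcases lt_or_ge (nrm p.1) ε with h | h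
      · simp [hw, hφ0 _ h]
      · have := sig_pos p.2
        gcongr
    have hR : ∫ x, φ x * nrmPowMul b (poisson ψ) x =
        ∫ x, ∫ η, w x * poissonKer f x η := by
      refine integral_congr_ae (ae_of_all _ fun x => ?_)
      simp only
      rw [integral_const_mul]
      rcases lt_or_ge 0 (nrm x) with h | h
      · rw [nrmPowMul, if_pos h, poisson_of_pos ψ h, hw]
        simp only
        ring
      · simp [hw, hφ0 x (by linarith)]
    rw [hR, integral_integral_swap hF]
    refine integral_congr_ae ?_
    filter_upwards [hF.prod_left_ae] with η hη
    rw [integral_eq_join, integral_prod_symm _ (integrable_join_iff.2 hη), ← integral_const_mul]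
    refine integral_congr_ae (ae_of_all _ fun y => ?_)
    simp only [pft, g]
    rw [← integral_const_mul, ← integral_const_mul]
    refine integral_congr_ae (ae_of_all _ fun z => ?_)
    simp only [poissonKer, tang_join, nrm_join, hw]
    rcases lt_or_ge y ε with hy | hy
    · simp [hφ0 (join z y) (by simpa using hy)]
    · have hy0 : 0 < y := by linarith
      have hσ := sig_pos η
      rw [gam, if_pos (mul_pos hσ hy0), Real.mul_rpow hσ.le hy0.le, Real.rpow_neg hσ.le]
      have : ((sig η ^ b : ℝ) : ℂ) ≠ 0 := by exact_mod_cast (Real.rpow_pos_of_pos hσ b).ne'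
      push_cast at this ⊢
      field_simp
  filter_upwards [hpos, hup, ae_nrm_ne_zero] with x h1 h2 h3
  rcases lt_or_gt_of_ne h3 with h | h
  · rw [h2 h, nrmPowMul, if_neg (not_lt.2 h.le)]
  · exact h1 h

theorem comp_tang_ae_eq {f g : Euc d → ℂ} (h : f =ᵐ[volume] g) :
    (fun ξ : Euc (d + 1) => f (tang ξ)) =ᵐ[volume] fun ξ => g (tang ξ) := by
  have h1 : ∀ᵐ p : Euc d × ℝ ∂(volume.prod volume), f p.1 = g p.1 :=
    Measure.quasiMeasurePreserving_fst.ae h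
  exact (measurePreserving_split (d := d)).quasiMeasurePreserving.ae h1

/-- `x_n^b K₀ψ` as an `L²` function. -/
def powPoisson {b : ℝ} (hb : 0 ≤ b) (ψ : L2 d) : L2 (d + 1) :=
  ofHat (memLp_mul_xiSymbol hb ((Lp.memLp (𝓕 ψ : L2 d)).const_mul (Real.Gamma (b + 1) : ℂ)))

theorem fourier_powPoisson {b : ℝ} (hb : 0 ≤ b) (ψ : L2 d) :
    ((𝓕 (powPoisson hb ψ) : L2 (d + 1)) : Euc (d + 1) → ℂ) =ᵐ[volume]
      fun ξ => (Real.Gamma (b + 1) : ℂ) * (𝓕 ψ : L2 d) (tang ξ) * xiSymbol (-(b + 1)) ξ :=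
  fourier_ofHat _

theorem powPoisson_ae {b : ℝ} (hb : 0 ≤ b) (ψ : L2 d) :
    (powPoisson hb ψ : Euc (d + 1) → ℂ) =ᵐ[volume] nrmPowMul b (poisson ψ) :=
  ae_eq_nrmPowMul_poisson hb (fourier_powPoisson hb ψ)

theorem isUpper_powPoisson {b : ℝ} (hb : 0 ≤ b) (ψ : L2 d) : IsUpper (powPoisson hb ψ) :=
  isUpper_of_fourier hb (f := fun η => (Real.Gamma (b + 1) : ℂ) * (𝓕 ψ : L2 d) η)
    (fourier_powPoisson hb ψ)

/-! ### Completeness of the powers of `(σ ± iη)⁻¹` -/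

/-- An integrable real function that annihilates a point-separating star algebra of bounded
continuous functions vanishes almost everywhere. -/
theorem ae_eq_zero_of_separatesPoints_real {A : StarSubalgebra ℂ (BoundedContinuousFunction ℝ ℂ)}
    (hA : (A.map (BoundedContinuousFunction.toContinuousMapStarₐ ℂ)).SeparatesPoints)
    {u : ℝ → ℝ} (hu : Integrable u) (h : ∀ a ∈ A, ∫ x, a x * (u x : ℂ) = 0) : u =ᵐ[volume] 0 := by
  have hm := hu.1.aemeasurable
  have hn := hu.neg.1.aemeasurable
  have i1 : IsFiniteMeasure (volume.withDensity fun x => ENNReal.ofReal (u x)) :=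
    isFiniteMeasure_withDensity_ofReal hu.2
  have i2 : IsFiniteMeasure (volume.withDensity fun x => ENNReal.ofReal ((-u) x)) :=
    isFiniteMeasure_withDensity_ofReal hu.neg.2
  have key : ∀ v : ℝ → ℝ, Integrable v → ∀ a : BoundedContinuousFunction ℝ ℂ,
      ∫ x, a x ∂(volume.withDensity fun x => ENNReal.ofReal (v x)) =
        ∫ x, a x * ((max (v x) 0 : ℝ) : ℂ) := by
    intro v hv a
    rw [integral_withDensity_eq_integral_toReal_smul₀ hv.1.aemeasurable.ennreal_ofReal
      (ae_of_all _ fun x => ENNReal.ofReal_lt_top)]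
    refine integral_congr_ae (ae_of_all _ fun x => ?_)
    simp only [ENNReal.toReal_ofReal', Complex.real_smul]
    ring
  have hint : ∀ v : ℝ → ℝ, Integrable v → ∀ a : BoundedContinuousFunction ℝ ℂ,
      Integrable fun x => a x * ((max (v x) 0 : ℝ) : ℂ) := by
    intro v hv a
    refine Integrable.bdd_mul (c := ‖a‖) ?_ a.continuous.aestronglyMeasurable
      (ae_of_all _ fun x => a.norm_coe_le_norm x)
    exact (hv.pos_part).ofReal
  have heq : (volume.withDensity fun x => ENNReal.ofReal (u x)) =
      volume.withDensity fun x => ENNReal.ofReal ((-u) x) := by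
    refine ext_of_forall_mem_subalgebra_integral_eq_of_pseudoEMetric_complete_countable hA
      fun a ha => ?_
    rw [key u hu, key (-u) hu.neg, ← sub_eq_zero, ← integral_sub (hint u hu a) (hint (-u) hu.neg a),
      ← h a ha]
    refine integral_congr_ae (ae_of_all _ fun x => ?_)
    simp only [Pi.neg_apply]
    rw [← mul_sub, ← Complex.ofReal_sub, max_zero_sub_max_neg_zero_eq_self]
  rw [withDensity_eq_iff hm.ennreal_ofReal hn.ennreal_ofReal
    hu.lintegral_lt_top.ne] at heq
  filter_upwards [heq] with x hx
  have hx' : max (u x) 0 = max (-u x) 0 := by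
    have := congrArg ENNReal.toReal hx
    simpa [ENNReal.toReal_ofReal'] using this
  have := max_zero_sub_max_neg_zero_eq_self (u x)
  simp only [Pi.zero_apply]
  linarith

theorem ae_eq_zero_of_separatesPoints {A : StarSubalgebra ℂ (BoundedContinuousFunction ℝ ℂ)}
    (hA : (A.map (BoundedContinuousFunction.toContinuousMapStarₐ ℂ)).SeparatesPoints)
    {g : ℝ → ℂ} (hg : Integrable g) (h : ∀ a ∈ A, ∫ x, a x * g x = 0) : g =ᵐ[volume] 0 := by
  have hi : ∀ a : BoundedContinuousFunction ℝ ℂ, Integrable fun x => a x * g x := fun a =>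
    hg.bdd_mul (c := ‖a‖) a.continuous.aestronglyMeasurable
      (ae_of_all _ fun x => a.norm_coe_le_norm x)
  have hi' : ∀ a : BoundedContinuousFunction ℝ ℂ,
      Integrable fun x => a x * (starRingEnd ℂ) (g x) := fun a =>
    (Complex.conjCLE.integrable_comp_iff.2 hg).bdd_mul (c := ‖a‖) a.continuous.aestronglyMeasurable
      (ae_of_all _ fun x => a.norm_coe_le_norm x)
  have h' : ∀ a ∈ A, ∫ x, a x * (starRingEnd ℂ) (g x) = 0 := by
    intro a ha
    have := h (star a) (star_mem ha)
    have e := integral_conj (𝕜 := ℂ) (f := fun x => (star a) x * g x) (μ := volume)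
    rw [this, map_zero] at e
    rw [← e]
    refine integral_congr_ae (ae_of_all _ fun x => ?_)
    simp
  have hre : (fun x => (g x).re) =ᵐ[volume] 0 := by
    refine ae_eq_zero_of_separatesPoints_real hA hg.re fun a ha => ?_
    have e : ∀ x, a x * (((g x).re : ℝ) : ℂ) =
        (1 / 2 : ℂ) * (a x * g x) + (1 / 2 : ℂ) * (a x * (starRingEnd ℂ) (g x)) := by
      intro x
      rw [Complex.re_eq_add_conj]
      ring
    simp only [e]
    rw [integral_add ((hi a).const_mul _) ((hi' a).const_mul _), integral_const_mul,
      integral_const_mul, h a ha, h' a ha]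
    simp
  have him : (fun x => (g x).im) =ᵐ[volume] 0 := by
    refine ae_eq_zero_of_separatesPoints_real hA hg.im fun a ha => ?_
    have e : ∀ x, a x * (((g x).im : ℝ) : ℂ) =
        (1 / (2 * Complex.I) : ℂ) * (a x * g x) -
          (1 / (2 * Complex.I) : ℂ) * (a x * (starRingEnd ℂ) (g x)) := by
      intro x
      rw [Complex.im_eq_sub_conj]
      ring
    simp only [e]
    rw [integral_sub ((hi a).const_mul _) ((hi' a).const_mul _), integral_const_mul,
      integral_const_mul, h a ha, h' a ha]
    simp
  filter_upwards [hre, him] with x h1 h2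
  exact Complex.ext h1 h2

/-- The function `s ↦ (σ + 2πis)⁻¹`. -/
def invLine (σ : ℝ) (s : ℝ) : ℂ := ((σ : ℂ) + Complex.I * (2 * Real.pi * s : ℝ))⁻¹

theorem line_ne_zero {σ : ℝ} (hσ : 0 < σ) (s : ℝ) :
    (σ : ℂ) + Complex.I * (2 * Real.pi * s : ℝ) ≠ 0 := by
  intro h
  have := congrArg Complex.re h
  simp at this
  exact hσ.ne' this

theorem continuous_invLine {σ : ℝ} (hσ : 0 < σ) : Continuous (invLine σ) :=
  Continuous.inv₀ (by fun_prop) (line_ne_zero hσ)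

theorem norm_invLine_le {σ : ℝ} (hσ : 1 ≤ σ) (s : ℝ) :
    ‖invLine σ s‖ ≤ ‖linePow (-1) (2 * Real.pi * s)‖ := by
  rw [linePow_neg, linePow_one, invLine, norm_inv, norm_inv]
  refine inv_anti₀ (norm_pos_iff.2 (one_add_I_mul_ne_zero _)) ?_
  rw [norm_one_add_I_mul, ← Real.sqrt_sq (norm_nonneg ((σ : ℂ) + _)), Complex.sq_norm,
    Complex.normSq_apply]
  refine Real.sqrt_le_sqrt ?_
  simp
  nlinarith

theorem norm_invLine_le_one {σ : ℝ} (hσ : 1 ≤ σ) (s : ℝ) : ‖invLine σ s‖ ≤ 1 := by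
  refine (norm_invLine_le hσ s).trans ?_
  rw [norm_linePow]
  exact Real.rpow_le_one_of_one_le_of_nonpos (by nlinarith [sq_nonneg (2 * Real.pi * s)]) (by norm_num)

theorem memLp_invLine {σ : ℝ} (hσ : 1 ≤ σ) : MemLp (invLine σ) 2 volume :=
  (memLp_linePow le_rfl).mono (continuous_invLine (by linarith)).aestronglyMeasurable
    (ae_of_all _ (norm_invLine_le hσ))

theorem invLine_mul_conj {σ : ℝ} (hσ : 0 < σ) (s : ℝ) :
    invLine σ s * (starRingEnd ℂ) (invLine σ s) =
      ((2 * σ : ℝ) : ℂ)⁻¹ * (invLine σ s + (starRingEnd ℂ) (invLine σ s)) := by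
  have h1 := line_ne_zero hσ s
  have h2 := (map_ne_zero (starRingEnd ℂ)).2 h1
  have h3 : ((2 * σ : ℝ) : ℂ) ≠ 0 := by exact_mod_cast (by positivity : (2 * σ : ℝ) ≠ 0)
  have h4 : ((σ : ℂ) + Complex.I * (2 * Real.pi * s : ℝ)) +
      (starRingEnd ℂ) ((σ : ℂ) + Complex.I * (2 * Real.pi * s : ℝ)) = ((2 * σ : ℝ) : ℂ) := by
    rw [Complex.add_conj]
    simp
  simp only [invLine, map_inv₀]
  rw [inv_add_inv h1 h2, h4]
  field_simp

/-- The functions `(σ + 2πis)^{-k-1}` and `(σ - 2πis)^{-k-1}` are complete in `L²(ℝ)`. -/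
theorem ae_eq_zero_of_invLine {σ : ℝ} (hσ : 1 ≤ σ) {g : ℝ → ℂ} (hg : MemLp g 2 volume)
    (h1 : ∀ k : ℕ, ∫ s, invLine σ s ^ (k + 1) * g s = 0)
    (h2 : ∀ k : ℕ, ∫ s, (starRingEnd ℂ) (invLine σ s) ^ (k + 1) * g s = 0) : g =ᵐ[volume] 0 := by
  have hσ0 : 0 < σ := by linarith
  have hc := continuous_invLine hσ0
  have hcc : Continuous fun s => (starRingEnd ℂ) (invLine σ s) := Complex.continuous_conj.comp hc
  -- all mixed moments exist, and vanish by partial fractions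
  have hint : ∀ m n : ℕ, 0 < m + n →
      Integrable fun s => invLine σ s ^ m * (starRingEnd ℂ) (invLine σ s) ^ n * g s := by
    intro m n hmn
    refine MemLp.integrable_mul (p := 2) (q := 2) ((memLp_invLine hσ).mono
      ((hc.pow m).mul (hcc.pow n)).aestronglyMeasurable (ae_of_all _ fun s => ?_)) hg
    rw [norm_mul, norm_pow, norm_pow, RCLike.norm_conj, ← pow_add]
    exact pow_le_of_le_one (norm_nonneg _) (norm_invLine_le_one hσ s) hmn.ne'
  have hmom : ∀ N m n : ℕ, m + n = N + 1 →
      ∫ s, invLine σ s ^ m * (starRingEnd ℂ) (invLine σ s) ^ n * g s = 0 := by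
    intro N
    induction N with
    | zero =>
      intro m n hmn
      rcases m with _ | m
      · obtain rfl : n = 1 := by omega
        simpa using h2 0
      · obtain rfl : m = 0 := by omega
        obtain rfl : n = 0 := by omega
        simpa using h1 0
    | succ N ih =>
      intro m n hmn
      rcases m with _ | m
      · obtain rfl : n = N + 1 + 1 := by omega
        simpa using h2 (N + 1)
      · rcases n with _ | n
        · obtain rfl : m = N + 1 := by omega
          simpa using h1 (N + 1)
        · have e : ∀ s, invLine σ s ^ (m + 1) * (starRingEnd ℂ) (invLine σ s) ^ (n + 1) * g s =
              ((2 * σ : ℝ) : ℂ)⁻¹ * (invLine σ s ^ (m + 1) * (starRingEnd ℂ) (invLine σ s) ^ n * g s) +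
              ((2 * σ : ℝ) : ℂ)⁻¹ *
                (invLine σ s ^ m * (starRingEnd ℂ) (invLine σ s) ^ (n + 1) * g s) := by
            intro s
            have := invLine_mul_conj hσ0 s
            linear_combination (invLine σ s ^ m * (starRingEnd ℂ) (invLine σ s) ^ n * g s) * this
          simp only [e]
          rw [integral_add ((hint _ _ (by omega)).const_mul _) ((hint _ _ (by omega)).const_mul _),
            integral_const_mul, integral_const_mul, ih _ _ (by omega), ih _ _ (by omega)]
          simp
  let X : BoundedContinuousFunction ℝ ℂ :=
    BoundedContinuousFunction.ofNormedAddCommGroup (invLine σ) hc 1 (norm_invLine_le_one hσ)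
  have hX : ∀ s, X s = invLine σ s := fun s => rfl
  have hsX : ∀ s, (star X) s = (starRingEnd ℂ) (invLine σ s) := fun s => rfl
  have hzero : (fun s => invLine σ s * g s) =ᵐ[volume] 0 := by
    refine ae_eq_zero_of_separatesPoints (A := StarAlgebra.adjoin ℂ {X}) ?_
      (by simpa using hint 1 0 (by norm_num)) fun a ha => ?_
    · intro s t hst
      refine ⟨invLine σ, ⟨BoundedContinuousFunction.toContinuousMapStarₐ ℂ X,
        ⟨X, StarAlgebra.self_mem_adjoin_singleton ℂ X, rfl⟩, rfl⟩, fun he => hst ?_⟩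
      have := congrArg Complex.im (inv_injective he)
      simp at this
      exact this
    · have hspan : a ∈ Submodule.span ℂ
          ((Submonoid.closure {X, star X} : Submonoid (BoundedContinuousFunction ℝ ℂ)) :
            Set (BoundedContinuousFunction ℝ ℂ)) := by
        rw [← Algebra.adjoin_eq_span]
        have : a ∈ (StarAlgebra.adjoin ℂ {X}).toSubalgebra := ha
        rw [StarAlgebra.adjoin_toSubalgebra] at this
        rwa [Set.star_singleton, Set.singleton_union] at this
      have hi : ∀ b : BoundedContinuousFunction ℝ ℂ, Integrable fun s => b s * (invLine σ s * g s) :=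
        fun b => Integrable.bdd_mul (c := ‖b‖) (by simpa using hint 1 0 (by norm_num))
          b.continuous.aestronglyMeasurable (ae_of_all _ fun x => b.norm_coe_le_norm x)
      clear ha
      induction hspan using Submodule.span_induction with
      | mem b hb =>
        obtain ⟨m, n, rfl⟩ := (Submonoid.mem_closure_pair _ _ _).1 hb
        have := hmom (m + n) (m + 1) n (by omega)
        rw [← this]
        refine integral_congr_ae (ae_of_all _ fun s => ?_)
        simp only [BoundedContinuousFunction.mul_apply, BoundedContinuousFunction.pow_apply, hX, hsX]
        ring
      | zero => simp
      | add b c _ _ hb hc' =>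
        have e : ∀ s, (b + c) s * (invLine σ s * g s) =
            b s * (invLine σ s * g s) + c s * (invLine σ s * g s) := fun s => by
          rw [BoundedContinuousFunction.add_apply]
          ring
        simp only [e]
        rw [integral_add (hi b) (hi c), hb, hc', add_zero]
      | smul r b _ hb =>
        simp only [BoundedContinuousFunction.smul_apply, smul_eq_mul, mul_assoc]
        rw [integral_const_mul, hb, mul_zero]
  filter_upwards [hzero] with s hs
  have : invLine σ s ≠ 0 := inv_ne_zero (line_ne_zero hσ0 s)
  simpa [this] using hs

/-- Fibrewise form of the vanishing of all integrals against functions of `ξ'`. -/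
theorem ae_integral_join_eq_zero {H : Euc (d + 1) → ℂ}
    (hi : ∀ f : Euc d → ℂ, MemLp f 2 volume → Integrable fun ξ => f (tang ξ) * H ξ)
    (h : ∀ f : 𝓢(Euc d, ℂ), ∫ ξ, f (tang ξ) * H ξ = 0) :
    ∀ᵐ η : Euc d, ∫ s : ℝ, H (join η s) = 0 := by
  refine ae_eq_of_schwartz (f := fun η => ∫ s : ℝ, H (join η s)) (g := fun _ => 0) ?_
    (locallyIntegrable_const 0) fun φ => ?_
  · rw [locallyIntegrable_iff]
    intro K hK
    have h1 : MemLp (K.indicator fun _ => (1 : ℂ)) 2 (volume : Measure (Euc d)) :=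
      memLp_indicator_const 2 hK.measurableSet 1 (Or.inr hK.measure_lt_top.ne)
    have h2 := (integrable_join_iff.2 (hi _ h1)).integral_prod_left
    rw [← integrable_indicator_iff hK.measurableSet]
    refine h2.congr (ae_of_all _ fun η => ?_)
    simp only [tang_join]
    rw [integral_const_mul]
    by_cases hη : η ∈ K <;> simp [hη]
  · have h1 := h φ
    rw [integral_join (hi _ (φ.memLp 2))] at h1
    simp only [tang_join, integral_const_mul] at h1
    simp [h1]

theorem ae_memLp_join {G : Euc (d + 1) → ℂ} (hG : MemLp G 2 volume) :
    ∀ᵐ η : Euc d, MemLp (fun s : ℝ => G (join η s)) 2 volume := by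
  have hm : AEStronglyMeasurable (fun p : Euc d × ℝ => G (join p.1 p.2)) (volume.prod volume) :=
    hG.1.comp_measurePreserving measurePreserving_join
  have h1 := (memLp_two_iff hG.1).1 hG
  rw [lintegral_eq_join, lintegral_prod _ (hm.enorm.pow_const 2)] at h1
  have h2 := ae_lt_top' ((hm.enorm.pow_const 2).lintegral_prod_right') h1.ne
  filter_upwards [h2, hm.prodMk_left] with η h3 h4
  exact (memLp_two_iff h4).2 h3

theorem ae_eq_zero_of_join {G : Euc (d + 1) → ℂ} (hG : MemLp G 2 volume)
    (h : ∀ᵐ η : Euc d, (fun s : ℝ => G (join η s)) =ᵐ[volume] 0) : G =ᵐ[volume] 0 := by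
  have h1 : ∫⁻ x, ‖G x‖ₑ ^ 2 = 0 := by
    rw [lintegral_join (hG.1.enorm.pow_const 2)]
    refine (lintegral_congr_ae ?_).trans lintegral_zero
    filter_upwards [h] with η hη
    refine (lintegral_congr_ae ?_).trans lintegral_zero
    filter_upwards [hη] with s hs
    simp [hs]
  rw [lintegral_eq_zero_iff' (hG.1.enorm.pow_const 2)] at h1
  filter_upwards [h1] with x hx
  simpa using hx

theorem integrable_mul_xiSymbol {b : ℝ} (hb : 0 ≤ b) {f : Euc d → ℂ} (hf : MemLp f 2 volume)
    {G : Euc (d + 1) → ℂ} (hG : MemLp G 2 volume) :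
    Integrable fun ξ => f (tang ξ) * (xiSymbol (-(b + 1)) ξ * G ξ) := by
  have := (memLp_mul_xiSymbol hb hf).integrable_mul hG
  refine this.congr (ae_of_all _ fun ξ => ?_)
  simp only [Pi.mul_apply]
  ring

theorem integrable_mul_conj_xiSymbol {b : ℝ} (hb : 0 ≤ b) {f : Euc d → ℂ} (hf : MemLp f 2 volume)
    {G : Euc (d + 1) → ℂ} (hG : MemLp G 2 volume) :
    Integrable fun ξ => f (tang ξ) * ((starRingEnd ℂ) (xiSymbol (-(b + 1)) ξ) * G ξ) := by
  have := (memLp_mul_conj_xiSymbol hb hf).integrable_mul hG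
  refine this.congr (ae_of_all _ fun ξ => ?_)
  simp only [Pi.mul_apply]
  ring

theorem xiSymbol_join_neg_nat (k : ℕ) (η : Euc d) (s : ℝ) :
    xiSymbol (-((k : ℝ) + 1)) (join η s) = invLine (sig η) s ^ (k + 1) := by
  have := xiSymbol_neg_nat (k + 1) (join η s)
  push_cast at this
  rw [this, xiBase, invLine, tang_join, nrm_join]

/-- The functions `f(ξ') (⟨ξ'⟩ ± i ξ_n)^{-k-1}` are complete in `L²(ℝ^n)`. -/
theorem ae_eq_zero_of_forall_xiSymbol {G : Euc (d + 1) → ℂ} (hG : MemLp G 2 volume)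
    (h1 : ∀ (k : ℕ) (f : 𝓢(Euc d, ℂ)),
      ∫ ξ, f (tang ξ) * (xiSymbol (-((k : ℝ) + 1)) ξ * G ξ) = 0)
    (h2 : ∀ (k : ℕ) (f : 𝓢(Euc d, ℂ)),
      ∫ ξ, f (tang ξ) * ((starRingEnd ℂ) (xiSymbol (-((k : ℝ) + 1)) ξ) * G ξ) = 0) :
    G =ᵐ[volume] 0 := by
  refine ae_eq_zero_of_join hG ?_
  have e1 : ∀ᵐ η : Euc d, ∀ k : ℕ, ∫ s : ℝ, invLine (sig η) s ^ (k + 1) * G (join η s) = 0 := by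
    rw [ae_all_iff]
    intro k
    filter_upwards [ae_integral_join_eq_zero
      (fun f hf => integrable_mul_xiSymbol (Nat.cast_nonneg k) hf hG) (h1 k)] with η hη
    simpa only [xiSymbol_join_neg_nat] using hη
  have e2 : ∀ᵐ η : Euc d, ∀ k : ℕ,
      ∫ s : ℝ, (starRingEnd ℂ) (invLine (sig η) s) ^ (k + 1) * G (join η s) = 0 := by
    rw [ae_all_iff]
    intro k
    filter_upwards [ae_integral_join_eq_zero
      (fun f hf => integrable_mul_conj_xiSymbol (Nat.cast_nonneg k) hf hG) (h2 k)] with η hη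
    simpa only [xiSymbol_join_neg_nat, map_pow] using hη
  filter_upwards [e1, e2, ae_memLp_join hG] with η g1 g2 g3
  exact ae_eq_zero_of_invLine (one_le_sig η) g3 g1 g2

/-! ### Order reduction preserves support in the upper half-space -/

/-- A Paley–Wiener orthogonality: the conjugate symbol is the Fourier transform of a function supported
in the lower half-space. -/
theorem integral_mul_xiSymbol_eq_zero {b : ℝ} (hb : 0 ≤ b) {f : Euc d → ℂ} (hf : MemLp f 2 volume)
    {U : L2 (d + 1)} (hU : IsUpper U) :
    ∫ ξ, f (tang ξ) * (xiSymbol (-(b + 1)) ξ * (𝓕 U : L2 (d + 1)) ξ) = 0 := by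
  have hm := memLp_mul_conj_xiSymbol hb hf.star
  have h := integral_conj_fourier_mul_eq_zero hU (isLower_of_fourier hb (fourier_ofHat hm))
  rw [← h]
  refine integral_congr_ae ?_
  filter_upwards [fourier_ofHat hm] with ξ hξ
  rw [hξ]
  simp
  ring

theorem integral_mul_conj_xiSymbol_eq_zero {b : ℝ} (hb : 0 ≤ b) {f : Euc d → ℂ}
    (hf : MemLp f 2 volume) {U : L2 (d + 1)} (hU : IsLower U) :
    ∫ ξ, f (tang ξ) * ((starRingEnd ℂ) (xiSymbol (-(b + 1)) ξ) * (𝓕 U : L2 (d + 1)) ξ) = 0 := by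
  have hm := memLp_mul_xiSymbol hb hf.star
  have h := integral_conj_fourier_mul_eq_zero (isUpper_of_fourier hb (fourier_ofHat hm)) hU
  rw [← map_eq_zero (starRingEnd ℂ), ← integral_conj, ← h]
  refine integral_congr_ae ?_
  filter_upwards [fourier_ofHat hm] with ξ hξ
  rw [hξ]
  simp
  ring

/-- Vanishing of the bilinear pairings with all `f(ξ') (⟨ξ'⟩ + i ξ_n)^{-k-1}` characterizes support in
the upper half-space. -/
theorem isUpper_of_forall_integral {V : L2 (d + 1)}
    (h : ∀ (k : ℕ) (f : 𝓢(Euc d, ℂ)),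
      ∫ ξ, f (tang ξ) * (xiSymbol (-((k : ℝ) + 1)) ξ * (𝓕 V : L2 (d + 1)) ξ) = 0) :
    IsUpper V := by
  have hL := isLower_sub_cut V
  have h0 : ((𝓕 (V - cut V) : L2 (d + 1)) : Euc (d + 1) → ℂ) =ᵐ[volume] 0 := by
    refine ae_eq_zero_of_forall_xiSymbol (Lp.memLp _) (fun k f => ?_) fun k f =>
      integral_mul_conj_xiSymbol_eq_zero (Nat.cast_nonneg k) (f.memLp 2) hL
    have hk : (0 : ℝ) ≤ k := Nat.cast_nonneg k
    have e : (fun ξ => f (tang ξ) * (xiSymbol (-((k : ℝ) + 1)) ξ * (𝓕 (V - cut V) : L2 (d + 1)) ξ))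
        =ᵐ[volume] fun ξ => f (tang ξ) * (xiSymbol (-((k : ℝ) + 1)) ξ * (𝓕 V : L2 (d + 1)) ξ) -
          f (tang ξ) * (xiSymbol (-((k : ℝ) + 1)) ξ * (𝓕 (cut V) : L2 (d + 1)) ξ) := by
      filter_upwards [fourier_sub_ae V (cut V)] with ξ hξ
      rw [hξ]
      ring
    rw [integral_congr_ae e, integral_sub (integrable_mul_xiSymbol hk (f.memLp 2) (Lp.memLp _))
      (integrable_mul_xiSymbol hk (f.memLp 2) (Lp.memLp _)), h k f,
      integral_mul_xiSymbol_eq_zero hk (f.memLp 2) (isUpper_cut V), sub_zero]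
  have h1 : V - cut V = 0 := by
    refine eq_of_fourier_ae_eq (h0.trans ?_)
    have : (𝓕 (0 : L2 (d + 1)) : L2 (d + 1)) = 0 :=
      map_zero (Lp.fourierTransformₗᵢ (Euc (d + 1)) ℂ)
    rw [this]
    exact (Lp.coeFn_zero _ _ _).symm
  rw [sub_eq_zero.1 h1]
  exact isUpper_cut V

/-- `Ξ_+^{-b}` preserves support in the upper half-space, for `b ≥ 0`. -/
theorem isUpper_of_fourier_eq_xiSymbol_neg {b : ℝ} (hb : 0 ≤ b) {U V : L2 (d + 1)} (hU : IsUpper U)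
    (hV : ((𝓕 V : L2 (d + 1)) : Euc (d + 1) → ℂ) =ᵐ[volume]
      fun ξ => xiSymbol (-b) ξ * (𝓕 U : L2 (d + 1)) ξ) : IsUpper V := by
  refine isUpper_of_forall_integral fun k f => ?_
  have hk : (0 : ℝ) ≤ k := Nat.cast_nonneg k
  rw [← integral_mul_xiSymbol_eq_zero (add_nonneg hk hb) (f.memLp 2) hU]
  refine integral_congr_ae ?_
  filter_upwards [hV] with ξ h
  rw [h, show -((k : ℝ) + b + 1) = -((k : ℝ) + 1) + -b by ring, xiSymbol_add]
  ring

/-! ### The trace on the Fourier side -/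

/-- Integration over the last variable: on the Fourier side this is the restriction to `x_n = 0`. -/
def fiberInt (G : Euc (d + 1) → ℂ) (η : Euc d) : ℂ := ∫ s : ℝ, G (join η s)

/-- `∫ (1 + s²)^{-r} ds`, for `r > 1/2`. -/
def fiberConst (r : ℝ) : ℝ≥0∞ := ∫⁻ s : ℝ, ENNReal.ofReal ((1 + s ^ 2) ^ (-r))

theorem fiberConst_lt_top {r : ℝ} (hr : 1 / 2 < r) : fiberConst r < ∞ := by
  have h := integrable_rpow_neg_one_add_norm_sq (E := ℝ) (μ := volume) (r := 2 * r)
    (by simp; linarith)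
  have h2 := h.lintegral_lt_top
  refine lt_of_le_of_lt (le_of_eq ?_) h2
  unfold fiberConst
  refine lintegral_congr fun s => ?_
  rw [Real.norm_eq_abs, sq_abs]
  congr 2
  ring

theorem wt_sq {k : ℕ} (s : ℝ) (ξ : Euc k) : wt s ξ ^ 2 = (1 + ‖ξ‖ ^ 2) ^ s := by
  rw [wt, ← Real.rpow_natCast, ← Real.rpow_mul (by positivity)]
  congr 1
  push_cast
  ring

/-- The substitution `s = (1 + |η|²)^{1/2} s'` gains the half order lost by the trace. -/
theorem lintegral_wt_join {r : ℝ} (η : Euc d) :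
    ∫⁻ s : ℝ, ENNReal.ofReal (wt (-r) (join η s)) ^ 2 =
      ENNReal.ofReal (wt (1 / 2 - r) η) ^ 2 * fiberConst r := by
  set m := 1 + ‖η‖ ^ 2 with hm
  have hm0 : 0 < m := by positivity
  have hσ : 0 < Real.sqrt m := Real.sqrt_pos.2 hm0
  have h := lintegral_comp_mul_inv (fun s => ENNReal.ofReal ((1 + s ^ 2) ^ (-r))) hσ
  have e : ∀ s : ℝ, ENNReal.ofReal (wt (-r) (join η s)) ^ 2 =
      ENNReal.ofReal (m ^ (-r)) * ENNReal.ofReal ((1 + (s * (Real.sqrt m)⁻¹) ^ 2) ^ (-r)) := by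
    intro s
    rw [← ENNReal.ofReal_pow (wt_pos _ _).le, wt_sq, ← ENNReal.ofReal_mul (by positivity),
      ← Real.mul_rpow hm0.le (by positivity), norm_sq_eq_tang_nrm, tang_join, nrm_join]
    congr 2
    rw [mul_pow, inv_pow, Real.sq_sqrt hm0.le, mul_add, mul_one]
    field_simp
    rw [hm]
    ring
  simp only [e]
  rw [lintegral_const_mul' _ _ ENNReal.ofReal_ne_top, h, ← mul_assoc, fiberConst,
    ← ENNReal.ofReal_mul (by positivity), ← ENNReal.ofReal_pow (wt_pos _ _).le, wt_sq,
    Real.sqrt_eq_rpow, ← Real.rpow_add hm0]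
  congr 3
  ring

/-- Cauchy–Schwarz on the fibres. -/
theorem enorm_fiberInt_le {r : ℝ} {G : Euc (d + 1) → ℂ} (hG : AEStronglyMeasurable G volume) :
    ∀ᵐ η : Euc d, (∫⁻ s : ℝ, ‖G (join η s)‖ₑ) ^ 2 ≤
      ENNReal.ofReal (wt (1 / 2 - r) η) ^ 2 * fiberConst r *
        ∫⁻ s : ℝ, (‖(wt r (join η s) : ℂ) * G (join η s)‖ₑ) ^ 2 := by
  have hm : AEStronglyMeasurable (fun p : Euc d × ℝ => G (join p.1 p.2)) (volume.prod volume) :=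
    hG.comp_measurePreserving measurePreserving_join
  filter_upwards [hm.prodMk_left] with η hη
  have hc : ∀ t, Continuous fun s : ℝ => wt t (join η s) := fun t =>
    (wt_continuous t).comp (continuous_join.comp (by fun_prop : Continuous fun s : ℝ => (η, s)))
  have h := ENNReal.lintegral_mul_le_Lp_mul_Lq volume (Real.HolderConjugate.two_two)
    (f := fun s : ℝ => ENNReal.ofReal (wt (-r) (join η s)))
    (g := fun s : ℝ => ‖(wt r (join η s) : ℂ) * G (join η s)‖ₑ)
    (hc _).measurable.ennreal_ofReal.aemeasurable
    (((Complex.continuous_ofReal.comp (hc r)).aestronglyMeasurable.mul hη).enorm)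
  have e : ∀ s : ℝ, ((fun s : ℝ => ENNReal.ofReal (wt (-r) (join η s))) *
      (fun s : ℝ => ‖(wt r (join η s) : ℂ) * G (join η s)‖ₑ)) s = ‖G (join η s)‖ₑ := by
    intro s
    rw [Pi.mul_apply, enorm_mul, enorm_wt, ← mul_assoc, ← ENNReal.ofReal_mul (wt_pos _ _).le,
      ← wt_add]
    simp [wt_zero]
  simp only [e] at h
  rw [← lintegral_wt_join]
  calc _ ≤ _ := pow_le_pow_left₀ zero_le h 2
    _ = _ := by
      rw [mul_pow, ← ENNReal.rpow_natCast, ← ENNReal.rpow_natCast, ← ENNReal.rpow_mul,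
        ← ENNReal.rpow_mul]
      norm_num

theorem aestronglyMeasurable_comp_join {G : Euc (d + 1) → ℂ} (hG : AEStronglyMeasurable G volume) :
    AEStronglyMeasurable (fun p : Euc d × ℝ => G (join p.1 p.2)) (volume.prod volume) :=
  hG.comp_measurePreserving measurePreserving_join

theorem aestronglyMeasurable_fiberInt {G : Euc (d + 1) → ℂ} (hG : AEStronglyMeasurable G volume) :
    AEStronglyMeasurable (fiberInt G) volume :=
  (aestronglyMeasurable_comp_join hG).integral_prod_right'

/-- The trace estimate `H^r → H^{r-1/2}` in terms of the Fourier transform. -/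
theorem lintegral_wt_mul_fiber_le {r : ℝ} {G : Euc (d + 1) → ℂ}
    (hG : AEStronglyMeasurable G volume) :
    ∫⁻ η : Euc d, (ENNReal.ofReal (wt (r - 1 / 2) η) * ∫⁻ s : ℝ, ‖G (join η s)‖ₑ) ^ 2 ≤
      fiberConst r * ∫⁻ ξ, ‖(wt r ξ : ℂ) * G ξ‖ₑ ^ 2 := by
  have hw : AEStronglyMeasurable (fun ξ => (wt r ξ : ℂ) * G ξ) volume :=
    (wt_temperate r).1.continuous.aestronglyMeasurable.mul hG
  have hm := (aestronglyMeasurable_comp_join hw).enorm.pow_const 2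
  rw [lintegral_join (hw.enorm.pow_const 2), ← lintegral_const_mul'' _ hm.lintegral_prod_right']
  refine lintegral_mono_ae ?_
  filter_upwards [enorm_fiberInt_le (r := r) hG] with η hη
  calc _ = ENNReal.ofReal (wt (r - 1 / 2) η) ^ 2 * (∫⁻ s : ℝ, ‖G (join η s)‖ₑ) ^ 2 := mul_pow _ _ _
    _ ≤ _ := mul_le_mul_right hη _
    _ = _ := by
      rw [← mul_assoc, ← mul_assoc, ← mul_pow, ← ENNReal.ofReal_mul (wt_pos _ _).le, ← wt_add]
      simp [wt_zero]

theorem eLpNorm_fiberInt_le {r : ℝ} {G : Euc (d + 1) → ℂ} (hG : AEStronglyMeasurable G volume) :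
    eLpNorm (fun η => (wt (r - 1 / 2) η : ℂ) * fiberInt G η) 2 volume ≤
      fiberConst r ^ (1 / 2 : ℝ) * eLpNorm (fun ξ => (wt r ξ : ℂ) * G ξ) 2 volume := by
  have h : eLpNorm (fun η => (wt (r - 1 / 2) η : ℂ) * fiberInt G η) 2 volume ^ 2 ≤
      (fiberConst r ^ (1 / 2 : ℝ) * eLpNorm (fun ξ => (wt r ξ : ℂ) * G ξ) 2 volume) ^ 2 := by
    rw [mul_pow, eLpNorm_two_sq, eLpNorm_two_sq, ← ENNReal.rpow_natCast (fiberConst r ^ _),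
      ← ENNReal.rpow_mul, show (1 / 2 : ℝ) * ((2 : ℕ) : ℝ) = 1 by norm_num, ENNReal.rpow_one]
    refine le_trans (lintegral_mono fun η => ?_) (lintegral_wt_mul_fiber_le hG)
    rw [enorm_mul, enorm_wt]
    gcongr
    exact enorm_integral_le_lintegral_enorm _
  exact (ENNReal.pow_le_pow_left_iff two_ne_zero).1 h

theorem memLp_fiberInt {r : ℝ} (hr : 1 / 2 < r) {G : Euc (d + 1) → ℂ}
    (hG : AEStronglyMeasurable G volume)
    (h : MemLp (fun ξ => (wt r ξ : ℂ) * G ξ) 2 volume) :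
    MemLp (fun η => (wt (r - 1 / 2) η : ℂ) * fiberInt G η) 2 volume := by
  refine ⟨(wt_temperate _).1.continuous.aestronglyMeasurable.mul
    (aestronglyMeasurable_fiberInt hG), (eLpNorm_fiberInt_le hG).trans_lt ?_⟩
  exact ENNReal.mul_lt_top (ENNReal.rpow_lt_top_of_nonneg (by norm_num) (fiberConst_lt_top hr).ne) h.2

theorem one_le_wt {k : ℕ} {r : ℝ} (hr : 0 ≤ r) (ξ : Euc k) : 1 ≤ wt r ξ :=
  (wt_zero ξ).symm.le.trans (wt_mono hr ξ)

theorem memLp_of_wt_mul {k : ℕ} {r : ℝ} (hr : 0 ≤ r) {f : Euc k → ℂ}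
    (h : MemLp (fun η => (wt r η : ℂ) * f η) 2 volume) : MemLp f 2 volume := by
  have hm : AEStronglyMeasurable f volume := by
    have h1 := (wt_temperate (k := k) (-r)).1.continuous.aestronglyMeasurable.mul (μ := volume) h.1
    refine h1.congr (ae_of_all _ fun ξ => ?_)
    simp only [Pi.mul_apply]
    rw [← mul_assoc, ← Complex.ofReal_mul, ← wt_add]
    simp [wt_zero]
  refine h.mono hm (ae_of_all _ fun ξ => ?_)
  rw [norm_mul, Complex.norm_real, Real.norm_of_nonneg (wt_pos _ _).le]
  exact le_mul_of_one_le_left (norm_nonneg _) (one_le_wt hr ξ)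

theorem integrable_comp_tang_mul {r : ℝ} (hr : 1 / 2 < r) {f : Euc d → ℂ} (hf : MemLp f 2 volume)
    {G : Euc (d + 1) → ℂ} (hG : AEStronglyMeasurable G volume)
    (h : MemLp (fun ξ => (wt r ξ : ℂ) * G ξ) 2 volume) :
    Integrable fun ξ => f (tang ξ) * G ξ := by
  refine ⟨(aestronglyMeasurable_comp_tang hf.1).mul hG, ?_⟩
  rw [hasFiniteIntegral_iff_enorm,
    lintegral_join (f := fun ξ => ‖f (tang ξ) * G ξ‖ₑ)
      ((aestronglyMeasurable_comp_tang hf.1).mul hG).enorm]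
  have hGj := (aestronglyMeasurable_comp_join hG).enorm
  have e : ∀ᵐ η : Euc d, ∫⁻ s : ℝ, ‖f (tang (join η s)) * G (join η s)‖ₑ =
      (fun η => ‖f η‖ₑ) η * (fun η => ∫⁻ s : ℝ, ‖G (join η s)‖ₑ) η := by
    filter_upwards with η
    simp only [tang_join, enorm_mul]
    exact lintegral_const_mul' _ _ enorm_ne_top
  rw [lintegral_congr_ae e]
  refine lt_of_le_of_lt (ENNReal.lintegral_mul_le_Lp_mul_Lq volume (Real.HolderConjugate.two_two)
    hf.1.enorm hGj.lintegral_prod_right') (ENNReal.mul_lt_top ?_ ?_)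
  · refine ENNReal.rpow_lt_top_of_nonneg (by norm_num) ?_
    have := (memLp_two_iff hf.1).1 hf
    simpa using this.ne
  · refine ENNReal.rpow_lt_top_of_nonneg (by norm_num) ?_
    have h2 : ∫⁻ η : Euc d, (∫⁻ s : ℝ, ‖G (join η s)‖ₑ) ^ 2 < ∞ := by
      refine lt_of_le_of_lt (lintegral_mono fun η => ?_)
        ((lintegral_wt_mul_fiber_le (r := r) hG).trans_lt
          (ENNReal.mul_lt_top (fiberConst_lt_top hr) ((memLp_two_iff h.1).1 h)))
      refine pow_le_pow_left₀ zero_le (le_mul_of_one_le_left zero_le ?_) 2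
      rw [← ENNReal.ofReal_one]
      exact ENNReal.ofReal_le_ofReal (one_le_wt (by linarith) η)
    simpa using h2.ne

theorem integral_comp_tang_mul {r : ℝ} (hr : 1 / 2 < r) {f : Euc d → ℂ} (hf : MemLp f 2 volume)
    {G : Euc (d + 1) → ℂ} (hG : AEStronglyMeasurable G volume)
    (h : MemLp (fun ξ => (wt r ξ : ℂ) * G ξ) 2 volume) :
    ∫ ξ, f (tang ξ) * G ξ = ∫ η, f η * fiberInt G η := by
  rw [integral_join (integrable_comp_tang_mul hr hf hG h)]
  refine integral_congr_ae (ae_of_all _ fun η => ?_)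
  simp only [tang_join, fiberInt]
  rw [integral_const_mul]

/-! ### Functions supported on one side of the boundary have trace zero -/

/-- Functions supported on one side of the boundary are orthogonal to profiles supported on the other. -/
theorem integral_mul_conj_profile_eq_zero {q : ℝ → ℂ} (hq : Integrable q)
    (hq2 : MemLp (𝓕 q) 2 volume) {Z : L2 (d + 1)}
    (h : (IsUpper Z ∧ ∀ x, 0 < x → q x = 0) ∨ (IsLower Z ∧ ∀ x < 0, q x = 0)) (f : 𝓢(Euc d, ℂ)) :
    ∫ ξ, (starRingEnd ℂ) (𝓕 q (nrm ξ * (sig (tang ξ))⁻¹)) *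
      (f (tang ξ) * (𝓕 Z : L2 (d + 1)) ξ) = 0 := by
  have hσf : MemLp (fun η => (sig η : ℂ) * (starRingEnd ℂ) (f η)) 2 volume := by
    have h1 : (fun η : Euc d => ((sig η ^ (1 : ℝ) : ℝ) : ℂ)).HasTemperateGrowth :=
      sig_temperate_rpow 1
    have h2 := ((SchwartzMap.smulLeftCLM ℂ (fun η : Euc d => ((sig η ^ (1 : ℝ) : ℝ) : ℂ))) f).memLp
      (μ := volume) 2
    refine (memLp_congr_ae (ae_of_all _ fun η => ?_)).1 h2.star
    rw [Pi.star_apply, SchwartzMap.smulLeftCLM_apply_apply h1]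
    simp
  have hm := memLp_profile hq hq2 hσf
  have key : ∫ ξ, (starRingEnd ℂ) ((𝓕 (ofHat hm) : L2 (d + 1)) ξ) * (𝓕 Z : L2 (d + 1)) ξ = 0 := by
    rcases h with ⟨hZ, h0⟩ | ⟨hZ, h0⟩
    · exact integral_conj_fourier_mul_eq_zero hZ (isLower_of_profile hq h0 (fourier_ofHat hm))
    · have := integral_conj_fourier_mul_eq_zero
        (isUpper_of_profile hq h0 (fourier_ofHat hm)) hZ
      rw [← map_eq_zero (starRingEnd ℂ), ← integral_conj, ← this]
      refine integral_congr_ae (ae_of_all _ fun ξ => ?_)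
      simp
      ring
  rw [← key]
  refine integral_congr_ae ?_
  filter_upwards [fourier_ofHat hm] with ξ hξ
  have hσ : (sig (tang ξ) : ℂ) ≠ 0 := by exact_mod_cast (sig_pos (tang ξ)).ne'
  rw [hξ, profile]
  simp
  field_simp

theorem fourier_dilate (q : ℝ → ℂ) {l : ℝ} (hl : 0 < l) (s : ℝ) :
    𝓕 (fun x => (l : ℂ) * q (l * x)) s = 𝓕 q (s * l⁻¹) := by
  have h : 𝓕 (fun x => (l : ℂ) * q (l * x)) s = (l : ℂ) * 𝓕 (fun x => q (l * x)) s := by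
    rw [Real.fourier_eq, Real.fourier_eq, ← integral_const_mul]
    refine integral_congr_ae (ae_of_all _ fun x => ?_)
    simp only [Circle.smul_def, smul_eq_mul]
    ring
  have : (l : ℂ) ≠ 0 := by exact_mod_cast hl.ne'
  rw [h, fourier_scale _ hl]
  push_cast
  field_simp

theorem memLp_comp_mul_inv {g : ℝ → ℂ} (hg : Continuous g) (h : MemLp g 2 volume) {l : ℝ}
    (hl : 0 < l) : MemLp (fun s => g (s * l⁻¹)) 2 volume := by
  have hm : AEStronglyMeasurable (fun s => g (s * l⁻¹)) volume :=
    (hg.comp (continuous_mul_const _)).aestronglyMeasurable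
  rw [memLp_two_iff hm,
    lintegral_comp_mul_inv (fun s => ‖g s‖ₑ ^ 2) hl]
  exact ENNReal.mul_lt_top ENNReal.ofReal_lt_top ((memLp_two_iff h.1).1 h)

/-- A function of `H^r`, `r > 1/2`, that vanishes on one side of the boundary has trace zero. Tested
against the dilated profiles `l q(l ·)`, whose Fourier transforms tend to `𝓕 q 0` as `l → ∞`. -/
theorem fiberInt_fourier_ae_eq_zero {r : ℝ} (hr : 1 / 2 < r) {Z : L2 (d + 1)} (hZ : hNorm r Z < ∞)
    (h : IsUpper Z ∨ IsLower Z) : fiberInt (𝓕 Z : L2 (d + 1)) =ᵐ[volume] 0 := by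
  have hZm := memLp_of_hNorm hZ
  have hG : AEStronglyMeasurable ((𝓕 Z : L2 (d + 1)) : Euc (d + 1) → ℂ) volume :=
    Lp.aestronglyMeasurable _
  -- a profile on the side opposite to `Z`, normalized by `𝓕 q 0 = 1`
  obtain ⟨q, hq, hq2, hq1, hcase⟩ : ∃ q : ℝ → ℂ, Integrable q ∧ MemLp (𝓕 q) 2 volume ∧ 𝓕 q 0 = 1 ∧
      ((IsUpper Z ∧ ∀ x, 0 < x → q x = 0) ∨ (IsLower Z ∧ ∀ x < 0, q x = 0)) := by
    have h1 : 𝓕 (gam 0) 0 = 1 := by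
      rw [fourier_gam (by norm_num)]
      simp [linePow]
    rcases h with h | h
    · refine ⟨fun x => gam 0 (-x), (integrable_gam (by norm_num)).comp_neg, ?_, ?_,
        Or.inl ⟨h, fun x hx => if_neg (by linarith)⟩⟩
      · have e : 𝓕 (fun x => gam 0 (-x)) = fun s => 𝓕 (gam 0) (-s) := funext (fourier_reflect _)
        rw [e]
        exact (memLp_fourier_gam le_rfl).comp_measurePreserving (Measure.measurePreserving_neg volume)
      · rw [fourier_reflect, neg_zero, h1]
    · exact ⟨gam 0, integrable_gam (by norm_num), memLp_fourier_gam le_rfl, h1,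
        Or.inr ⟨h, fun x hx => if_neg (by linarith)⟩⟩
  have hqc := continuous_fourier_of_integrable hq
  have hfi := memLp_of_wt_mul (by linarith) (memLp_fiberInt hr hG hZm)
  refine (ae_eq_of_schwartz (hfi.locallyIntegrable (by norm_num)) (locallyIntegrable_const 0)
    fun f => ?_)
  rw [← integral_comp_tang_mul hr (f.memLp 2) hG hZm]
  simp only [Pi.zero_apply, mul_zero, integral_zero]
  have hint := integrable_comp_tang_mul hr (f.memLp 2) hG hZm
  have hz : ∀ n : ℕ, ∫ ξ, (starRingEnd ℂ) (𝓕 q (nrm ξ * (sig (tang ξ))⁻¹ * ((n : ℝ) + 1)⁻¹)) *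
      (f (tang ξ) * (𝓕 Z : L2 (d + 1)) ξ) = 0 := by
    intro n
    have hn : (0 : ℝ) < n + 1 := by positivity
    have e : 𝓕 (fun x => (((n : ℝ) + 1 : ℝ) : ℂ) * q (((n : ℝ) + 1) * x)) =
        fun s => 𝓕 q (s * ((n : ℝ) + 1)⁻¹) := funext (fourier_dilate q hn)
    have := integral_mul_conj_profile_eq_zero
      (q := fun x => (((n : ℝ) + 1 : ℝ) : ℂ) * q (((n : ℝ) + 1) * x))
      ((hq.comp_mul_left' hn.ne').const_mul _) (by rw [e]; exact memLp_comp_mul_inv hqc hq2 hn)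
      (hcase.imp (fun h => ⟨h.1, fun x hx => by rw [h.2 _ (mul_pos hn hx), mul_zero]⟩)
        (fun h => ⟨h.1, fun x hx => by rw [h.2 _ (mul_neg_of_pos_of_neg hn hx), mul_zero]⟩)) f
    rwa [e] at this
  have hlim := tendsto_integral_of_dominated_convergence (μ := volume)
    (F := fun (n : ℕ) (ξ : Euc (d + 1)) =>
      (starRingEnd ℂ) (𝓕 q (nrm ξ * (sig (tang ξ))⁻¹ * ((n : ℝ) + 1)⁻¹)) *
      (f (tang ξ) * (𝓕 Z : L2 (d + 1)) ξ)) (f := fun ξ => f (tang ξ) * (𝓕 Z : L2 (d + 1)) ξ)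
    (fun ξ => (∫ x, ‖q x‖) * ‖f (tang ξ) * (𝓕 Z : L2 (d + 1)) ξ‖) (fun n => ?_)
    (hint.norm.const_mul _) (fun n => ae_of_all _ fun ξ => ?_) (ae_of_all _ fun ξ => ?_)
  · simp only [hz] at hlim
    exact (tendsto_nhds_unique hlim tendsto_const_nhds)
  · refine AEStronglyMeasurable.mul ?_ hint.1
    refine (Measurable.aestronglyMeasurable ?_)
    exact Complex.continuous_conj.measurable.comp (hqc.measurable.comp (by fun_prop))
  · rw [norm_mul, RCLike.norm_conj]
    gcongr
    exact VectorFourier.norm_fourierIntegral_le_integral_norm _ _ _ _ _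
  · have h1 : Filter.Tendsto (fun n : ℕ => nrm ξ * (sig (tang ξ))⁻¹ * ((n : ℝ) + 1)⁻¹) Filter.atTop
        (nhds 0) := by
      have := (tendsto_one_div_add_atTop_nhds_zero_nat (𝕜 := ℝ)).const_mul (nrm ξ * (sig (tang ξ))⁻¹)
      simpa using this
    have h2 := (Complex.continuous_conj.tendsto _).comp ((hqc.tendsto 0).comp h1)
    rw [hq1] at h2
    have h3 := h2.mul_const (f (tang ξ) * (𝓕 Z : L2 (d + 1)) ξ)
    simpa using h3

/-- `Ξ_+^a` maps `H^a` functions supported in the upper half-space to such `L²` functions,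
for `a < 1`. The pairing with `f(ξ') (⟨ξ'⟩ + iξ_n)^{-k-1}` reduces to that for the order `k + 1 - a`,
which is at least `1` unless `k = 0`. -/
theorem isUpper_of_fourier_eq_xiSymbol {a : ℝ} (ha1 : a < 1) {V W : L2 (d + 1)}
    (hV : IsUpper V)
    (hW : ((𝓕 W : L2 (d + 1)) : Euc (d + 1) → ℂ) =ᵐ[volume]
      fun ξ => xiSymbol a ξ * (𝓕 V : L2 (d + 1)) ξ) : IsUpper W := by
  refine isUpper_of_forall_integral fun k f => ?_
  rcases k with _ | k
  · -- `Ξ_+^{a-1} V` lies in `H^1` and is supported in the upper half-space: its trace vanishes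
    have hm : MemLp (fun ξ => xiSymbol (-(1 - a)) ξ * (𝓕 V : L2 (d + 1)) ξ) 2 volume := by
      refine (Lp.memLp (𝓕 V : L2 (d + 1))).mono ((continuous_xiSymbol _).aestronglyMeasurable.mul
        (Lp.aestronglyMeasurable _)) (ae_of_all _ fun ξ => ?_)
      rw [norm_mul]
      exact mul_le_of_le_one_left (norm_nonneg _) (norm_xiSymbol_nonpos_le_one (by linarith) ξ)
    have hZ := fourier_ofHat hm
    have hZu : IsUpper (ofHat hm) := isUpper_of_fourier_eq_xiSymbol_neg (by linarith) hV hZ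
    have hZ1 : hNorm 1 (ofHat hm) < ∞ := by
      refine lt_of_le_of_lt ?_ (Lp.memLp (𝓕 W : L2 (d + 1))).2
      refine eLpNorm_mono_ae ?_
      filter_upwards [hZ, hW] with ξ h1 h2
      rw [h1, h2, norm_mul, Complex.norm_real, Real.norm_of_nonneg (wt_pos _ _).le]
      have := wt_le_norm_xiSymbol (t := 1) zero_le_one ξ
      calc wt 1 ξ * ‖xiSymbol (-(1 - a)) ξ * (𝓕 V : L2 (d + 1)) ξ‖
          ≤ ‖xiSymbol 1 ξ‖ * ‖xiSymbol (-(1 - a)) ξ * (𝓕 V : L2 (d + 1)) ξ‖ := by gcongr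
        _ = _ := by
          rw [← norm_mul, ← mul_assoc, ← xiSymbol_add]
          congr 3
          ring
    have h0 := fiberInt_fourier_ae_eq_zero (by norm_num) hZ1 (Or.inl hZu)
    have h1 := integral_comp_tang_mul (by norm_num) (f.memLp 2) (Lp.aestronglyMeasurable _)
      (memLp_of_hNorm hZ1)
    rw [integral_eq_zero_of_ae (f := fun η => f η * fiberInt _ η)
      (by filter_upwards [h0] with η hη; rw [hη]; simp)] at h1
    rw [← h1]
    refine integral_congr_ae ?_
    filter_upwards [hZ, hW] with ξ g1 g2
    rw [g1, g2, show -(1 - a) = -(((0 : ℕ) : ℝ) + 1) + a by push_cast; ring, xiSymbol_add]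
    ring
  · have hk : (0 : ℝ) ≤ k := Nat.cast_nonneg k
    rw [← integral_mul_xiSymbol_eq_zero (b := k + 1 - a) (by linarith) (f.memLp 2) hV]
    refine integral_congr_ae ?_
    filter_upwards [hW] with ξ h
    rw [h, show -((k : ℝ) + 1 - a + 1) = -(((k + 1 : ℕ) : ℝ) + 1) + a by push_cast; ring,
      xiSymbol_add]
    ring

/-! ### Truncation of functions with vanishing trace -/

/-- Multiplication of a Schwartz function by a power of `⟨ξ'⟩`. -/
def sigMul (t : ℝ) (f : 𝓢(Euc d, ℂ)) : 𝓢(Euc d, ℂ) :=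
  SchwartzMap.smulLeftCLM ℂ (fun η : Euc d => ((sig η ^ t : ℝ) : ℂ)) f

theorem sigMul_apply (t : ℝ) (f : 𝓢(Euc d, ℂ)) (η : Euc d) :
    sigMul t f η = ((sig η ^ t : ℝ) : ℂ) * f η := by
  rw [sigMul, SchwartzMap.smulLeftCLM_apply_apply (sig_temperate_rpow t), smul_eq_mul]

theorem memLp_bdd_mul {k : ℕ} {m : Euc k → ℂ} (hm : Continuous m) {K : ℝ} (hK : ∀ ξ, ‖m ξ‖ ≤ K)
    {g : Euc k → ℂ} (hg : MemLp g 2 volume) : MemLp (fun ξ => m ξ * g ξ) 2 volume := by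
  refine hg.of_le_mul (c := K) (hm.aestronglyMeasurable.mul hg.1) (ae_of_all _ fun ξ => ?_)
  rw [norm_mul]
  exact mul_le_mul_of_nonneg_right (hK ξ) (norm_nonneg _)

theorem norm_ofHat_sub_le {k : ℕ} {g g' : Euc k → ℂ} (hg : MemLp g 2 volume)
    (hg' : MemLp g' 2 volume) {A A' : L2 k} {K : ℝ}
    (h : ∀ᵐ ξ, ‖g ξ - g' ξ‖ ≤ K * ‖(𝓕 A : L2 k) ξ - (𝓕 A' : L2 k) ξ‖) :
    ‖ofHat hg - ofHat hg'‖ ≤ K * ‖A - A'‖ := by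
  rw [← Lp.norm_fourier_eq (ofHat hg - ofHat hg'), ← Lp.norm_fourier_eq (A - A')]
  refine Lp.norm_le_mul_norm_of_ae_le_mul ?_
  filter_upwards [h, fourier_sub_ae (ofHat hg) (ofHat hg'), fourier_sub_ae A A', fourier_ofHat hg,
    fourier_ofHat hg'] with ξ h1 h2 h3 h4 h5
  rw [h2, h3, h4, h5]
  exact h1

theorem norm_cut_le (U : L2 (d + 1)) : ‖cut U‖ ≤ ‖U‖ := by
  have := enorm_cut_le U
  rwa [enorm_le_iff_norm_le] at this

/-- A Wiener–Hopf equation: for a unimodular symbol `m` of positive real part, every `G` is the sum of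
`m(D) A`, with `A` supported in the upper half-space, and of a function supported in the lower one.
`A` is the fixed point of `A ↦ cut ((1 - c m(D)) A + c G)`, a contraction since
`|1 - c m|² ≤ 1 - c²`. -/
theorem exists_isUpper_isLower_sub {m : Euc (d + 1) → ℂ} (hm : Continuous m)
    (h1 : ∀ ξ, ‖m ξ‖ = 1) {c : ℝ} (hc : 0 < c) (hre : ∀ ξ, c ≤ (m ξ).re) (G : L2 (d + 1)) :
    ∃ A B : L2 (d + 1), IsUpper A ∧ IsLower B ∧
      ((𝓕 B : L2 (d + 1)) : Euc (d + 1) → ℂ) =ᵐ[volume]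
        fun ξ => (𝓕 G : L2 (d + 1)) ξ - m ξ * (𝓕 A : L2 (d + 1)) ξ := by
  have hc1 : c ≤ 1 := (hre 0).trans ((Complex.re_le_norm _).trans (h1 0).le)
  have hm1 : Continuous fun ξ => 1 - (c : ℂ) * m ξ := by fun_prop
  have hle : ∀ ξ, ‖1 - (c : ℂ) * m ξ‖ ≤ Real.sqrt (1 - c ^ 2) := by
    intro ξ
    refine Real.le_sqrt_of_sq_le ?_
    have e1 : (m ξ).re ^ 2 + (m ξ).im ^ 2 = 1 := by
      have := Complex.sq_norm (m ξ)
      rw [h1, Complex.normSq_apply] at this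
      linarith
    rw [Complex.sq_norm, Complex.normSq_apply]
    simp
    nlinarith [hre ξ]
  have hmem : ∀ A : L2 (d + 1), MemLp (fun ξ => (1 - (c : ℂ) * m ξ) * (𝓕 A : L2 (d + 1)) ξ) 2 volume :=
    fun A => memLp_bdd_mul hm1 hle (Lp.memLp _)
  -- the fixed point equation says that `G - m(D) A` is cut off to zero
  set Φ : L2 (d + 1) → L2 (d + 1) := fun A => cut (ofHat (hmem A) + (c : ℂ) • G) with hΦ
  have hlip : ∀ A A', ‖Φ A - Φ A'‖ ≤ Real.sqrt (1 - c ^ 2) * ‖A - A'‖ := by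
    intro A A'
    rw [hΦ]
    simp only
    rw [← cut_sub, add_sub_add_right_eq_sub]
    refine (norm_cut_le _).trans (norm_ofHat_sub_le _ _ (ae_of_all _ fun ξ => ?_))
    rw [← mul_sub, norm_mul]
    exact mul_le_mul_of_nonneg_right (hle ξ) (norm_nonneg _)
  have hK : Real.sqrt (1 - c ^ 2) < 1 := by
    rw [Real.sqrt_lt' one_pos]
    nlinarith
  have hcon : ContractingWith (Real.toNNReal (Real.sqrt (1 - c ^ 2))) Φ := by
    refine ⟨?_, LipschitzWith.of_dist_le_mul fun A A' => ?_⟩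
    · rwa [Real.toNNReal_lt_one]
    · rw [dist_eq_norm, dist_eq_norm, Real.coe_toNNReal _ (Real.sqrt_nonneg _)]
      exact hlip A A'
  set A := hcon.fixedPoint
  have hA : cut (ofHat (hmem A) + (c : ℂ) • G) = A := hcon.fixedPoint_isFixedPt
  have hAu : IsUpper A := hA ▸ isUpper_cut _
  have hmA : MemLp (fun ξ => m ξ * (𝓕 A : L2 (d + 1)) ξ) 2 volume :=
    memLp_bdd_mul hm (fun ξ => (h1 ξ).le) (Lp.memLp _)
  have e : ofHat (hmem A) + (c : ℂ) • G = A + (c : ℂ) • (G - ofHat hmA) := by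
    refine eq_of_fourier_ae_eq ?_
    filter_upwards [fourier_add_ae (ofHat (hmem A)) ((c : ℂ) • G), fourier_smul_ae (c : ℂ) G,
      fourier_ofHat (hmem A), fourier_add_ae A ((c : ℂ) • (G - ofHat hmA)),
      fourier_smul_ae (c : ℂ) (G - ofHat hmA), fourier_sub_ae G (ofHat hmA), fourier_ofHat hmA]
      with ξ g1 g2 g3 g4 g5 g6 g7
    rw [g1, g2, g3, g4, g5, g6, g7]
    ring
  rw [e, cut_add, cut_eq_self hAu, cut_smul, add_eq_left, smul_eq_zero] at hA
  have hcut : cut (G - ofHat hmA) = 0 := hA.resolve_left (by exact_mod_cast hc.ne')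
  refine ⟨A, G - ofHat hmA, hAu, ?_, ?_⟩
  · have := isLower_sub_cut (G - ofHat hmA)
    rwa [hcut, sub_zero] at this
  · filter_upwards [fourier_sub_ae G (ofHat hmA), fourier_ofHat hmA] with ξ g1 g2
    rw [g1, g2]

theorem integral_conj_mul_cut (V : L2 (d + 1)) (h : ∫ x, (starRingEnd ℂ) (V x) * cut V x = 0) :
    IsLower V := by
  have e : (fun x => (starRingEnd ℂ) (V x) * cut V x) =ᵐ[volume]
      fun x => (starRingEnd ℂ) (cut V x) * cut V x := by
    filter_upwards [cut_ae V] with x hx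
    rw [hx]
    by_cases hx' : x ∈ openHalf d <;> simp [hx']
  have h0 : (inner ℂ (cut V) (cut V) : ℂ) = 0 := by
    rw [L2.inner_def, ← h, integral_congr_ae e]
    simp only [RCLike.inner_apply']
  have := isLower_sub_cut V
  rwa [inner_self_eq_zero.1 h0, sub_zero] at this

/-- The operator with symbol `(⟨ξ'⟩ - i ξ_n)^{-b}` preserves support in the lower half-space, for
`b ≥ 0`. -/
theorem isLower_of_fourier_eq_conj_xiSymbol_neg {b : ℝ} (hb : 0 ≤ b) {B V : L2 (d + 1)}
    (hB : IsLower B) (hV : ((𝓕 V : L2 (d + 1)) : Euc (d + 1) → ℂ) =ᵐ[volume]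
      fun ξ => (starRingEnd ℂ) (xiSymbol (-b) ξ) * (𝓕 B : L2 (d + 1)) ξ) : IsLower V := by
  have hm : MemLp (fun ξ => xiSymbol (-b) ξ * (𝓕 (cut V) : L2 (d + 1)) ξ) 2 volume :=
    memLp_bdd_mul (continuous_xiSymbol _) (norm_xiSymbol_nonpos_le_one (by linarith)) (Lp.memLp _)
  refine integral_conj_mul_cut V ?_
  rw [← integral_conj_fourier_mul, ← integral_conj_fourier_mul_eq_zero
    (isUpper_of_fourier_eq_xiSymbol_neg hb (isUpper_cut V) (fourier_ofHat hm)) hB]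
  refine integral_congr_ae ?_
  filter_upwards [hV, fourier_ofHat hm] with ξ h1 h2
  rw [h1, h2]
  simp
  ring

/-- The unimodular symbol `((⟨ξ'⟩ + i ξ_n) / (⟨ξ'⟩ - i ξ_n))^b`. -/
def phase (b : ℝ) (ξ : Euc (d + 1)) : ℂ := xiSymbol b ξ * (starRingEnd ℂ) (xiSymbol (-b) ξ)

theorem continuous_phase (b : ℝ) : Continuous (phase b : Euc (d + 1) → ℂ) :=
  (continuous_xiSymbol b).mul (Complex.continuous_conj.comp (continuous_xiSymbol (-b)))

theorem norm_phase (b : ℝ) (ξ : Euc (d + 1)) : ‖phase b ξ‖ = 1 := by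
  rw [phase, norm_mul, RCLike.norm_conj, ← norm_mul, mul_comm, xiSymbol_neg_mul, norm_one]

theorem phase_eq_exp (b : ℝ) (ξ : Euc (d + 1)) :
    phase b ξ = Complex.exp ((2 * b * (xiBase ξ).arg : ℝ) * Complex.I) := by
  have hz := xiBase_ne_zero ξ
  rw [phase, xiSymbol_eq_cpow, xiSymbol_eq_cpow, Complex.cpow_def_of_ne_zero hz,
    Complex.cpow_def_of_ne_zero hz, ← Complex.exp_conj, ← Complex.exp_add]
  congr 1
  rw [map_mul, Complex.conj_ofReal]
  apply Complex.ext
  · simp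
  · simp [Complex.log_im]
    ring

/-- The argument of the symbol is `2b` times an angle of at most `π/2`. -/
theorem cos_le_re_phase {b : ℝ} (hb0 : 0 ≤ b) (hb1 : b ≤ 1) (ξ : Euc (d + 1)) :
    Real.cos (Real.pi * b) ≤ (phase b ξ).re := by
  rw [phase_eq_exp, Complex.exp_ofReal_mul_I_re, ← Real.cos_abs (2 * b * _)]
  have harg : |(xiBase ξ).arg| ≤ Real.pi / 2 := by
    refine Complex.abs_arg_le_pi_div_two_iff.2 ?_
    rw [xiBase_re]
    exact (sig_pos _).le
  have hpi := Real.pi_pos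
  refine Real.cos_le_cos_of_nonneg_of_le_pi (abs_nonneg _) (by nlinarith) ?_
  rw [abs_mul, abs_of_nonneg (by linarith : 0 ≤ 2 * b)]
  nlinarith

/-- `(⟨ξ'⟩ + iξ_n) / (⟨ξ'⟩ - iξ_n) = 2⟨ξ'⟩ (⟨ξ'⟩ - iξ_n)⁻¹ - 1`. -/
theorem phase_one_eq (ξ : Euc (d + 1)) :
    phase 1 ξ = ((2 * sig (tang ξ) : ℝ) : ℂ) * (starRingEnd ℂ) (xiSymbol (-1) ξ) - 1 := by
  have h := inv_xiBase_mul_conj ξ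
  have h1 : xiSymbol (-1) ξ = (xiBase ξ)⁻¹ := by simpa using xiSymbol_neg_nat 1 ξ
  have h2 : xiSymbol 1 ξ = xiBase ξ := by simp [xiSymbol_eq_cpow]
  have hz := xiBase_ne_zero ξ
  have hs : ((2 * sig (tang ξ) : ℝ) : ℂ) ≠ 0 := by
    exact_mod_cast (mul_pos two_pos (sig_pos (tang ξ))).ne'
  rw [phase, h1, h2]
  have e : ((2 * sig (tang ξ) : ℝ) : ℂ) * ((xiBase ξ)⁻¹ * (starRingEnd ℂ) (xiBase ξ)⁻¹) =
      (xiBase ξ)⁻¹ + (starRingEnd ℂ) (xiBase ξ)⁻¹ := by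
    rw [h, mul_inv_cancel_left₀ hs]
  have e2 : xiBase ξ * (((2 * sig (tang ξ) : ℝ) : ℂ) * ((xiBase ξ)⁻¹ * (starRingEnd ℂ) (xiBase ξ)⁻¹)) =
      ((2 * sig (tang ξ) : ℝ) : ℂ) * (starRingEnd ℂ) (xiBase ξ)⁻¹ := by
    rw [mul_left_comm, mul_inv_cancel_left₀ hz]
  rw [e, mul_add, mul_inv_cancel₀ hz] at e2
  linear_combination e2

theorem hNorm_lt_top_of_fourier_eq_mul {r : ℝ} {m : Euc (d + 1) → ℂ} {U V : L2 (d + 1)}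
    (hm : ∀ ξ, ‖m ξ‖ ≤ wt (-r) ξ) (hV : ((𝓕 V : L2 (d + 1)) : Euc (d + 1) → ℂ) =ᵐ[volume]
      fun ξ => m ξ * (𝓕 U : L2 (d + 1)) ξ) : hNorm r V < ∞ := by
  refine lt_of_le_of_lt (eLpNorm_mono_ae ?_) (Lp.memLp (𝓕 U : L2 (d + 1))).2
  filter_upwards [hV] with ξ h
  rw [h, norm_mul, norm_mul, Complex.norm_real, Real.norm_of_nonneg (wt_pos _ _).le, ← mul_assoc]
  refine mul_le_of_le_one_left (norm_nonneg _) ?_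
  calc wt r ξ * ‖m ξ‖ ≤ wt r ξ * wt (-r) ξ := by
        have := wt_pos r ξ
        gcongr
        exact hm ξ
    _ = 1 := by rw [← wt_add, add_neg_cancel, wt_zero]

/-- Truncation to the upper half-space preserves `H^a`, `1/2 < a < 1`, on functions `Z` with vanishing
trace.

With `λ = ⟨ξ'⟩ + iξ_n`, the Wiener–Hopf equation for `conj(λ)^a Ẑ` and the symbol
`(λ / conj λ)^{1-a}`, whose argument is less than `π(1 - a) < π/2`, decomposes
`Ẑ = (λ / conj λ) D̂ + L̂` with `D`, `L` in `H^a` supported in the upper and in the lower half-space.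
As `Z`, `D` and `L` all have trace zero, so has the first summand, and this forces it to be supported
in the upper half-space: `λ / conj λ = 2⟨ξ'⟩ / conj λ - 1`, and the part of `D̂ / conj λ` in the lower
half-space is determined by the traces. So the first summand is the truncation of `Z`. -/
theorem hNorm_cut_lt_top {a : ℝ} (ha : 1 / 2 < a) (ha1 : a < 1) {Z : L2 (d + 1)}
    (hZ : hNorm a Z < ∞) (h0 : fiberInt (𝓕 Z : L2 (d + 1)) =ᵐ[volume] 0) :
    hNorm a (cut Z) < ∞ := by
  have ha0 : 0 < a := by linarith
  have hG : MemLp (fun ξ => (starRingEnd ℂ) (xiSymbol a ξ) * (𝓕 Z : L2 (d + 1)) ξ) 2 volume := by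
    refine (memLp_of_hNorm hZ).of_le_mul (c := xiConst a)
      ((Complex.continuous_conj.comp (continuous_xiSymbol a)).aestronglyMeasurable.mul
        (Lp.aestronglyMeasurable _)) (ae_of_all _ fun ξ => ?_)
    rw [norm_mul, norm_mul, RCLike.norm_conj, Complex.norm_real,
      Real.norm_of_nonneg (wt_pos _ _).le, ← mul_assoc]
    gcongr
    exact norm_xiSymbol_le ha0.le ξ
  have hcos : 0 < Real.cos (Real.pi * (1 - a)) := by
    have := Real.pi_pos
    refine Real.cos_pos_of_mem_Ioo ⟨by nlinarith, by nlinarith⟩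
  -- `ofHat hG` has the Fourier transform `conj(λ)^a Ẑ`
  obtain ⟨A, B, hA, hB, hBf⟩ := exists_isUpper_isLower_sub (continuous_phase (1 - a))
    (norm_phase (1 - a)) hcos (cos_le_re_phase (by linarith) (by linarith)) (ofHat hG)
  have hDm : MemLp (fun ξ => xiSymbol (-a) ξ * (𝓕 A : L2 (d + 1)) ξ) 2 volume :=
    memLp_bdd_mul (continuous_xiSymbol _) (norm_xiSymbol_nonpos_le_one (by linarith)) (Lp.memLp _)
  have hLm : MemLp (fun ξ => (starRingEnd ℂ) (xiSymbol (-a) ξ) * (𝓕 B : L2 (d + 1)) ξ) 2 volume :=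
    memLp_bdd_mul (Complex.continuous_conj.comp (continuous_xiSymbol _))
      (fun ξ => (RCLike.norm_conj _).trans_le (norm_xiSymbol_nonpos_le_one (by linarith) ξ))
      (Lp.memLp _)
  set D := ofHat hDm with hD
  set ZL := ofHat hLm with hZL
  have hDf := fourier_ofHat hDm
  have hLf := fourier_ofHat hLm
  have hDu : IsUpper D := isUpper_of_fourier_eq_xiSymbol_neg ha0.le hA hDf
  have hLl : IsLower ZL := isLower_of_fourier_eq_conj_xiSymbol_neg ha0.le hB hLf
  have hDa : hNorm a D < ∞ := hNorm_lt_top_of_fourier_eq_mul (norm_xiSymbol_neg_le ha0.le) hDf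
  have hLa : hNorm a ZL < ∞ := hNorm_lt_top_of_fourier_eq_mul
    (fun ξ => (RCLike.norm_conj _).trans_le (norm_xiSymbol_neg_le ha0.le ξ)) hLf
  have hUm : MemLp (fun ξ => phase 1 ξ * (𝓕 D : L2 (d + 1)) ξ) 2 volume :=
    memLp_bdd_mul (continuous_phase 1) (fun ξ => (norm_phase 1 ξ).le) (Lp.memLp _)
  set ZU := ofHat hUm with hZU
  have hUf := fourier_ofHat hUm
  have hsum : Z = ZU + ZL := by
    refine eq_of_fourier_ae_eq ?_
    filter_upwards [fourier_add_ae ZU ZL, hUf, hLf, hDf, hBf, fourier_ofHat hG]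
      with ξ g1 g2 g3 g4 g5 g6
    rw [g1, g2, g3, g4, g5, g6]
    have e1 : (starRingEnd ℂ) (xiSymbol (-a) ξ) * (starRingEnd ℂ) (xiSymbol a ξ) = 1 := by
      rw [← map_mul, xiSymbol_neg_mul, map_one]
    have e2 : (starRingEnd ℂ) (xiSymbol (-a) ξ) * phase (1 - a) ξ =
        phase 1 ξ * xiSymbol (-a) ξ := by
      rw [phase, phase, show (1 - a : ℝ) = 1 + -a by ring, xiSymbol_add,
        show (-(1 + -a) : ℝ) = -1 + a by ring, xiSymbol_add, map_mul]
      linear_combination (xiSymbol 1 ξ * xiSymbol (-a) ξ * (starRingEnd ℂ) (xiSymbol (-1) ξ)) * e1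
    linear_combination (-(𝓕 Z : L2 (d + 1)) ξ) * e1 + (𝓕 A : L2 (d + 1)) ξ * e2
  have hUa : hNorm a ZU < ∞ := by
    refine lt_of_le_of_lt (eLpNorm_mono_ae ?_) hDa
    filter_upwards [hUf] with ξ h
    rw [h, norm_mul, norm_mul, norm_mul, norm_phase, one_mul]
  -- the traces of all three functions vanish
  have htest : ∀ {V : L2 (d + 1)}, hNorm a V < ∞ → fiberInt (𝓕 V : L2 (d + 1)) =ᵐ[volume] 0 →
      ∀ f : 𝓢(Euc d, ℂ), ∫ ξ, f (tang ξ) * (𝓕 V : L2 (d + 1)) ξ = 0 := by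
    intro V hV hV0 f
    rw [integral_comp_tang_mul ha (f.memLp 2) (Lp.aestronglyMeasurable _) (memLp_of_hNorm hV)]
    refine integral_eq_zero_of_ae ?_
    filter_upwards [hV0] with η hη
    rw [hη]
    simp
  have hint : ∀ {V : L2 (d + 1)}, hNorm a V < ∞ → ∀ f : 𝓢(Euc d, ℂ),
      Integrable fun ξ => f (tang ξ) * (𝓕 V : L2 (d + 1)) ξ := fun hV f =>
    integrable_comp_tang_mul ha (f.memLp 2) (Lp.aestronglyMeasurable _) (memLp_of_hNorm hV)
  have hD0 := htest hDa (fiberInt_fourier_ae_eq_zero ha hDa (Or.inl hDu))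
  have hL0 := htest hLa (fiberInt_fourier_ae_eq_zero ha hLa (Or.inr hLl))
  have hU0 : ∀ f : 𝓢(Euc d, ℂ), ∫ ξ, f (tang ξ) * (𝓕 ZU : L2 (d + 1)) ξ = 0 := by
    intro f
    have h1 := htest hZ h0 f
    have e : (fun ξ => f (tang ξ) * (𝓕 Z : L2 (d + 1)) ξ) =ᵐ[volume]
        fun ξ => f (tang ξ) * (𝓕 ZU : L2 (d + 1)) ξ + f (tang ξ) * (𝓕 ZL : L2 (d + 1)) ξ := by
      have := fourier_add_ae ZU ZL
      rw [← hsum] at this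
      filter_upwards [this] with ξ hξ
      rw [hξ, mul_add]
    rw [integral_congr_ae e, integral_add (hint hUa f) (hint hLa f), hL0 f, add_zero] at h1
    exact h1
  -- partial fractions: `λ^{-1} conj(λ)^{-1} = (λ^{-1} + conj(λ)^{-1}) / (2⟨ξ'⟩)`
  have hP : ∀ (k : ℕ) (f : 𝓢(Euc d, ℂ)), ∫ ξ, f (tang ξ) * (xiSymbol (-(k : ℝ)) ξ *
      ((starRingEnd ℂ) (xiSymbol (-1) ξ) * (𝓕 D : L2 (d + 1)) ξ)) = 0 := by
    intro k
    induction k with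
    | zero =>
      intro f
      have e : (fun ξ => f (tang ξ) * (xiSymbol (-((0 : ℕ) : ℝ)) ξ *
          ((starRingEnd ℂ) (xiSymbol (-1) ξ) * (𝓕 D : L2 (d + 1)) ξ))) =ᵐ[volume]
          fun ξ => (1 / 2 : ℂ) * (sigMul (-1) f (tang ξ) * (𝓕 ZU : L2 (d + 1)) ξ) +
            (1 / 2 : ℂ) * (sigMul (-1) f (tang ξ) * (𝓕 D : L2 (d + 1)) ξ) := by
        filter_upwards [hUf] with ξ h
        have hs : (sig (tang ξ) : ℂ) ≠ 0 := by exact_mod_cast (sig_pos (tang ξ)).ne'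
        rw [h, phase_one_eq, sigMul_apply, Real.rpow_neg_one]
        simp only [Nat.cast_zero, neg_zero, xiSymbol_zero]
        push_cast
        field_simp
        ring
      rw [integral_congr_ae e, integral_add ((hint hUa _).const_mul _) ((hint hDa _).const_mul _),
        integral_const_mul, integral_const_mul, hU0, hD0]
      simp
    | succ k ih =>
      intro f
      have hk : (0 : ℝ) ≤ k := Nat.cast_nonneg k
      have e : ∀ ξ, f (tang ξ) * (xiSymbol (-((k + 1 : ℕ) : ℝ)) ξ *
          ((starRingEnd ℂ) (xiSymbol (-1) ξ) * (𝓕 D : L2 (d + 1)) ξ)) =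
          (1 / 2 : ℂ) * (sigMul (-1) f (tang ξ) *
            (xiSymbol (-((k : ℝ) + 1)) ξ * (𝓕 D : L2 (d + 1)) ξ)) +
          (1 / 2 : ℂ) * (sigMul (-1) f (tang ξ) * (xiSymbol (-(k : ℝ)) ξ *
            ((starRingEnd ℂ) (xiSymbol (-1) ξ) * (𝓕 D : L2 (d + 1)) ξ))) := by
        intro ξ
        have h := inv_xiBase_mul_conj ξ
        have h1 : xiSymbol (-1) ξ = (xiBase ξ)⁻¹ := by simpa using xiSymbol_neg_nat 1 ξ
        have hs : (sig (tang ξ) : ℂ) ≠ 0 := by exact_mod_cast (sig_pos (tang ξ)).ne'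
        rw [← h1] at h
        rw [sigMul_apply, Real.rpow_neg_one, show (-((k + 1 : ℕ) : ℝ)) = -(k : ℝ) + -1 by push_cast; ring,
          show (-((k : ℝ) + 1)) = -(k : ℝ) + -1 by ring, xiSymbol_add]
        push_cast at h ⊢
        rw [mul_inv] at h
        linear_combination (f (tang ξ) * xiSymbol (-(k : ℝ)) ξ * (𝓕 D : L2 (d + 1)) ξ) * h
      simp only [e]
      have i1 := integrable_mul_xiSymbol hk ((sigMul (-1) f).memLp 2) (Lp.memLp (𝓕 D : L2 (d + 1)))
      have i2 := integrable_mul_conj_xiSymbol le_rfl ((sigMul (-1) f).memLp 2)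
        (memLp_bdd_mul (continuous_xiSymbol (-(k : ℝ)))
          (norm_xiSymbol_nonpos_le_one (by linarith)) (Lp.memLp (𝓕 D : L2 (d + 1))))
      have i3 : Integrable fun ξ => sigMul (-1) f (tang ξ) * (xiSymbol (-(k : ℝ)) ξ *
            ((starRingEnd ℂ) (xiSymbol (-1) ξ) * (𝓕 D : L2 (d + 1)) ξ)) := by
        refine i2.congr (ae_of_all _ fun ξ => ?_)
        simp only [zero_add]
        ring
      rw [integral_add (i1.const_mul _) (i3.const_mul _), integral_const_mul, integral_const_mul, ih,
        integral_mul_xiSymbol_eq_zero hk ((sigMul (-1) f).memLp 2) hDu]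
      simp
  have hUu : IsUpper ZU := by
    refine isUpper_of_forall_integral fun k f => ?_
    rw [← hP k f]
    refine integral_congr_ae ?_
    filter_upwards [hUf] with ξ h
    rw [h, phase, show (-((k : ℝ) + 1)) = -(k : ℝ) + -1 by ring, xiSymbol_add]
    linear_combination (f (tang ξ) * xiSymbol (-(k : ℝ)) ξ *
      (starRingEnd ℂ) (xiSymbol (-1) ξ) * (𝓕 D : L2 (d + 1)) ξ) * xiSymbol_neg_mul 1 ξ
  have hcut : ZU = cut Z := eq_cut_of_isUpper_of_isLower_sub hUu (by
    rw [hsum, sub_add_cancel_left, ← neg_one_smul ℂ]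
    exact hLl.smul _)
  rwa [← hcut]

/-! ### The extension operator -/

/-- The tensor product of Schwartz functions of `x'` and of `x_n`. -/
def tensor (f : 𝓢(Euc d, ℂ)) (g : 𝓢(ℝ, ℂ)) : 𝓢(Euc (d + 1), ℂ) where
  toFun x := f (tang x) * g (nrm x)
  smooth' := ((f.smooth ⊤).comp (tangCLM d).contDiff).mul ((g.smooth ⊤).comp (nrmCLM d).contDiff)
  decay' k n := by
    have hT : ‖tangCLM d‖ ≤ 1 := ContinuousLinearMap.opNorm_le_bound _ zero_le_one fun x => by
      simpa using norm_tang_le x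
    have hN : ‖nrmCLM d‖ ≤ 1 := ContinuousLinearMap.opNorm_le_bound _ zero_le_one fun x => by
      simpa using abs_nrm_le x
    have comp_le : ∀ {V : Type} [NormedAddCommGroup V] [NormedSpace ℝ V] (p : 𝓢(V, ℂ))
        (T : Euc (d + 1) →L[ℝ] V), ‖T‖ ≤ 1 → ∀ (i : ℕ) (x : Euc (d + 1)),
        ‖iteratedFDeriv ℝ i (fun x => p (T x)) x‖ ≤ ‖iteratedFDeriv ℝ i p (T x)‖ := by
      intro V _ _ p T hT i x
      have := T.iteratedFDeriv_comp_right (p.smooth i) x le_rfl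
      rw [Function.comp_def] at this
      rw [this]
      refine (ContinuousMultilinearMap.norm_compContinuousLinearMap_le _ _).trans ?_
      refine mul_le_of_le_one_right (norm_nonneg _) ?_
      exact Finset.prod_le_one (fun _ _ => norm_nonneg _) fun _ _ => hT
    have bd : ∀ {V : Type} [NormedAddCommGroup V] [NormedSpace ℝ V] (p : 𝓢(V, ℂ)) (i : ℕ),
        ∃ C, ∀ y, (1 + ‖y‖) ^ k * ‖iteratedFDeriv ℝ i p y‖ ≤ C := fun p i =>
      ⟨_, fun y => SchwartzMap.one_add_le_sup_seminorm_apply (𝕜 := ℂ) (m := (k, i)) le_rfl le_rfl p y⟩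
    choose A hA using fun i => bd f i
    choose B hB using fun i => bd g i
    refine ⟨∑ i ∈ Finset.range (n + 1), (n.choose i : ℝ) * (A i * B (n - i)), fun x => ?_⟩
    have h1 := norm_iteratedFDeriv_mul_le (𝕜 := ℝ) (N := n)
      (f := fun x : Euc (d + 1) => f (tangCLM d x)) (g := fun x : Euc (d + 1) => g (nrmCLM d x))
      ((f.smooth n).comp (tangCLM d).contDiff) ((g.smooth n).comp (nrmCLM d).contDiff) x le_rfl
    have hx : ‖x‖ ^ k ≤ (1 + ‖tang x‖) ^ k * (1 + ‖nrm x‖) ^ k := by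
      rw [← mul_pow]
      refine pow_le_pow_left₀ (norm_nonneg _) ((norm_le_tang_nrm x).trans ?_) k
      rw [Real.norm_eq_abs]
      nlinarith [norm_nonneg (tang x), abs_nonneg (nrm x),
        mul_nonneg (norm_nonneg (tang x)) (abs_nonneg (nrm x))]
    refine (mul_le_mul hx h1 (norm_nonneg _) (by positivity)).trans ?_
    rw [Finset.mul_sum]
    refine Finset.sum_le_sum fun i _ => ?_
    have hAi := hA i (tang x)
    have hBi := hB (n - i) (nrm x)
    have c1 := comp_le f (tangCLM d) hT i x
    have c2 := comp_le g (nrmCLM d) hN (n - i) x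
    simp only [tangCLM_apply, nrmCLM_apply] at c1 c2 ⊢
    calc (1 + ‖tang x‖) ^ k * (1 + ‖nrm x‖) ^ k * (n.choose i *
          ‖iteratedFDeriv ℝ i (fun x => f (tang x)) x‖ *
          ‖iteratedFDeriv ℝ (n - i) (fun x => g (nrm x)) x‖)
        ≤ (1 + ‖tang x‖) ^ k * (1 + ‖nrm x‖) ^ k * (n.choose i *
          ‖iteratedFDeriv ℝ i f (tang x)‖ * ‖iteratedFDeriv ℝ (n - i) g (nrm x)‖) := by gcongr
      _ = n.choose i * (((1 + ‖tang x‖) ^ k * ‖iteratedFDeriv ℝ i f (tang x)‖) *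
          ((1 + ‖nrm x‖) ^ k * ‖iteratedFDeriv ℝ (n - i) g (nrm x)‖)) := by ring
      _ ≤ n.choose i * (A i * B (n - i)) := by
        have : 0 ≤ A i := le_trans (by positivity) hAi
        gcongr

theorem tensor_apply (f : 𝓢(Euc d, ℂ)) (g : 𝓢(ℝ, ℂ)) (x : Euc (d + 1)) :
    tensor f g x = f (tang x) * g (nrm x) := rfl

/-- The dilation `(ξ', ξ_n) ↦ (ξ', ξ_n / ⟨ξ'⟩)`. -/
def normalDilation (ξ : Euc (d + 1)) : Euc (d + 1) := join (tang ξ) (nrm ξ * (sig (tang ξ))⁻¹)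

theorem sig_tang_temperate :
    (fun ξ : Euc (d + 1) => (sig (tang ξ))⁻¹).HasTemperateGrowth := by
  have h : ∀ ξ : Euc (d + 1), (sig (tang ξ))⁻¹ = (1 + ‖(2 * Real.pi) • tangCLM d ξ‖ ^ 2) ^ (-(1 : ℝ) / 2) := by
    intro ξ
    rw [sig_eq, Real.sqrt_eq_rpow, ← Real.rpow_neg (by positivity)]
    norm_num
  simp only [h]
  have : (fun η : Euc d => (1 + ‖η‖ ^ 2) ^ (-(1 : ℝ) / 2)).HasTemperateGrowth := by fun_prop
  exact this.comp (f := fun ξ : Euc (d + 1) => (2 * Real.pi) • tangCLM d ξ)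
    ((2 * Real.pi) • tangCLM d).hasTemperateGrowth

theorem join_eq_add (y : Euc d) (s : ℝ) : join y s = join y 0 + s • join 0 1 := by
  ext i
  refine Fin.lastCases ?_ (fun i => ?_) i <;> simp [join]

theorem normalDilation_temperate : (normalDilation : Euc (d + 1) → Euc (d + 1)).HasTemperateGrowth := by
  have hL : ∃ T : Euc d →L[ℝ] Euc (d + 1), ∀ y, T y = join y 0 := by
    refine ⟨LinearMap.toContinuousLinearMap
      { toFun := fun y => join y 0, map_add' := fun x y => ?_, map_smul' := fun c x => ?_ },
      fun y => rfl⟩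
    · ext i
      refine Fin.lastCases ?_ (fun i => ?_) i <;> simp [join]
    · ext i
      refine Fin.lastCases ?_ (fun i => ?_) i <;> simp [join]
  obtain ⟨T, hT⟩ := hL
  have e : (normalDilation : Euc (d + 1) → Euc (d + 1)) =
      fun ξ => (T ∘L tangCLM d) ξ + (nrmCLM d ξ * (sig (tang ξ))⁻¹) • join 0 1 := by
    funext ξ
    rw [normalDilation, join_eq_add]
    simp [hT]
  rw [e]
  have h1 := (T ∘L tangCLM d).hasTemperateGrowth
  have h2 := (nrmCLM d).hasTemperateGrowth
  have h3 := sig_tang_temperate (d := d)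
  have h4 : (fun _ : Euc (d + 1) => (join 0 1 : Euc (d + 1))).HasTemperateGrowth := .const _
  exact h1.add ((h2.mul h3).smul h4)

theorem sig_le (η : Euc d) : sig η ≤ 2 * Real.pi * (1 + ‖η‖) := by
  have := sig_sq η
  have hpi := Real.pi_gt_three
  refine le_of_sq_le_sq ?_ (by positivity)
  rw [this]
  nlinarith [norm_nonneg η, sq_nonneg Real.pi, mul_nonneg (sq_nonneg Real.pi) (norm_nonneg η)]

theorem norm_le_normalDilation (ξ : Euc (d + 1)) :
    ‖ξ‖ ≤ (1 + 2 * Real.pi) * (1 + ‖normalDilation ξ‖) ^ 2 := by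
  have h1 : ‖tang ξ‖ ≤ ‖normalDilation ξ‖ := by
    have := norm_tang_le (normalDilation ξ)
    simpa [normalDilation] using this
  have h2 : |nrm ξ| ≤ sig (tang ξ) * ‖normalDilation ξ‖ := by
    have := abs_nrm_le (normalDilation ξ)
    have hs := sig_pos (tang ξ)
    rw [normalDilation, nrm_join, abs_mul, abs_inv, abs_of_pos hs, ← div_eq_mul_inv, div_le_iff₀ hs]
      at this
    rw [mul_comm]
    exact this
  have h3 := sig_le (tang ξ)
  have h4 := norm_le_tang_nrm ξ
  have hpi := Real.pi_pos
  set D := ‖normalDilation ξ‖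
  have hD : 0 ≤ D := norm_nonneg _
  calc ‖ξ‖ ≤ D + 2 * Real.pi * (1 + D) * D := by
        refine h4.trans (add_le_add h1 (h2.trans ?_))
        gcongr
        exact h3.trans (by gcongr)
    _ ≤ _ := by nlinarith [mul_nonneg hpi.le hD]

/-- A Schwartz function on the line that equals `e^{-x}` for `x ≥ 0`. -/
theorem exists_schwartz_exp : ∃ h : 𝓢(ℝ, ℂ), ∀ x, 0 ≤ x → h x = Real.exp (-x) := by
  set f : ℝ → ℂ := fun x => ((Real.smoothTransition (x + 1) : ℝ) : ℂ) * Complex.exp (-1 * (x : ℂ)) with hf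
  have he : ContDiff ℝ (⊤ : ℕ∞) fun x : ℝ => Complex.exp (-1 * (x : ℂ)) := by
    exact (contDiff_const.mul Complex.ofRealCLM.contDiff).cexp
  have hsm : ContDiff ℝ (⊤ : ℕ∞) f := by
    refine ContDiff.mul ?_ he
    exact Complex.ofRealCLM.contDiff.comp (Real.smoothTransition.contDiff.comp (contDiff_id.add contDiff_const))
  have hexp : ∀ (n : ℕ) (x : ℝ), iteratedDeriv n (fun x : ℝ => Complex.exp (-1 * (x : ℂ))) x =
      (-1) ^ n * Complex.exp (-1 * (x : ℂ)) := by
    intro n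
    induction n with
    | zero => simp
    | succ n ih =>
      intro x
      rw [iteratedDeriv_succ, funext ih]
      have h1 : HasDerivAt (fun x : ℝ => Complex.exp (-1 * (x : ℂ))) (Complex.exp (-1 * (x : ℂ)) * (-1 * 1)) x :=
        ((Complex.ofRealCLM.hasDerivAt (x := x)).const_mul (-1 : ℂ)).cexp
      rw [(h1.const_mul _).deriv]
      ring
  refine ⟨⟨f, hsm, fun k n => ?_⟩, fun x hx => ?_⟩
  · have hc : Continuous fun x : ℝ => |x| ^ k * ‖iteratedDeriv n f x‖ :=
      (continuous_abs.pow k).mul (hsm.continuous_iteratedDeriv n (by exact_mod_cast le_top)).norm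
    obtain ⟨C, hC⟩ := (isCompact_Icc (a := (-1 : ℝ)) (b := 0)).bddAbove_image hc.continuousOn
    refine ⟨max C k.factorial, fun x => ?_⟩
    rw [norm_iteratedFDeriv_eq_norm_iteratedDeriv, Real.norm_eq_abs]
    rcases lt_or_ge x (-1) with h | h
    · have h0 : f =ᶠ[nhds x] fun _ => 0 := by
        filter_upwards [gt_mem_nhds h] with y hy
        simp [hf, Real.smoothTransition.zero_of_nonpos (by linarith : y + 1 ≤ 0)]
      rw [h0.iteratedDeriv_eq]
      simp
    · rcases le_or_gt x 0 with h' | h'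
      · exact (hC ⟨x, ⟨h, h'⟩, rfl⟩).trans (le_max_left _ _)
      · have h0 : f =ᶠ[nhds x] fun x => Complex.exp (-1 * (x : ℂ)) := by
          filter_upwards [lt_mem_nhds h'] with y hy
          simp [hf, Real.smoothTransition.one_of_one_le (by linarith : 1 ≤ y + 1)]
        rw [h0.iteratedDeriv_eq, hexp, abs_of_pos h', norm_mul, norm_pow, norm_neg, norm_one, one_pow,
          one_mul, Complex.norm_exp]
        refine le_trans ?_ (le_max_right _ _)
        have := Real.pow_div_factorial_le_exp x h'.le k
        rw [div_le_iff₀ (by positivity)] at this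
        simp only [neg_one_mul, Complex.neg_re, Complex.ofReal_re]
        rw [Real.exp_neg, ← div_eq_mul_inv, div_le_iff₀ (Real.exp_pos _), mul_comm]
        exact this
  · change f x = _
    simp [hf, Real.smoothTransition.one_of_one_le (by linarith : 1 ≤ x + 1)]

/-- A fixed Schwartz function on the line that equals `e^{-x}` for `x ≥ 0`. -/
def expExt : 𝓢(ℝ, ℂ) := exists_schwartz_exp.choose

theorem expExt_of_nonneg {x : ℝ} (hx : 0 ≤ x) : expExt x = Real.exp (-x) :=
  exists_schwartz_exp.choose_spec x hx

theorem sig_rpow_le {t : ℝ} (ht : 0 ≤ t) (η : Euc d) : sig η ^ t ≤ xiConst t * wt t η := by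
  have h : sig η ^ t = (sig η ^ 2) ^ (t / 2) := by
    rw [← Real.rpow_natCast, ← Real.rpow_mul (sig_pos η).le]
    congr 1
    push_cast
    ring
  rw [h, xiConst, wt, ← Real.mul_rpow (by positivity) (by positivity), sig_sq]
  refine Real.rpow_le_rpow (by positivity) ?_ (by linarith)
  nlinarith [one_le_four_pi_sq]

theorem wt_join_le {r : ℝ} (hr : 0 ≤ r) (η : Euc d) (s : ℝ) :
    wt r (join η s) ≤ sig η ^ r * (1 + (s * (sig η)⁻¹) ^ 2) ^ (r / 2) := by
  have hσ := sig_pos η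
  have h : sig η ^ r = (sig η ^ 2) ^ (r / 2) := by
    rw [← Real.rpow_natCast, ← Real.rpow_mul hσ.le]
    congr 1
    push_cast
    ring
  rw [h, wt, ← Real.mul_rpow (by positivity) (by positivity)]
  refine Real.rpow_le_rpow (by positivity) ?_ (by linarith)
  have e : sig η ^ 2 * (1 + (s * (sig η)⁻¹) ^ 2) = sig η ^ 2 + s ^ 2 := by
    field_simp
  rw [e, sig_sq, norm_sq_eq_tang_nrm, tang_join, nrm_join]
  nlinarith [one_le_four_pi_sq, sq_nonneg ‖η‖]

/-- Profiles of a Schwartz function map `H^{r-1/2}(ℝ^{n-1})` to `H^r(ℝ^n)`. -/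
theorem memLp_wt_mul_profile {r : ℝ} (hr : 1 / 2 ≤ r) (q : 𝓢(ℝ, ℂ)) {f : Euc d → ℂ}
    (hf : MemLp (fun η => (wt (r - 1 / 2) η : ℂ) * f η) 2 volume) :
    MemLp (fun ξ => (wt r ξ : ℂ) * profile q f ξ) 2 volume := by
  have hf2 := memLp_of_wt_mul (by linarith) hf
  have hqc : Continuous (𝓕 (q : ℝ → ℂ)) := continuous_fourier_of_integrable q.integrable
  have hm : AEStronglyMeasurable (fun ξ => (wt r ξ : ℂ) * profile q f ξ) volume :=
    (wt_temperate r).1.continuous.aestronglyMeasurable.mul (aestronglyMeasurable_profile hqc hf2.1)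
  set g : ℝ → ℝ≥0∞ := fun s => (ENNReal.ofReal ((1 + s ^ 2) ^ (r / 2)) * ‖𝓕 (q : ℝ → ℂ) s‖ₑ) ^ 2 with hg
  have hgfin : ∫⁻ s, g s < ∞ := by
    have ht : (fun s : ℝ => (((1 + s ^ 2) ^ (r / 2) : ℝ) : ℂ)).HasTemperateGrowth := by
      have : (fun s : ℝ => (((1 + ‖s‖ ^ 2) ^ (r / 2) : ℝ) : ℂ)).HasTemperateGrowth := by fun_prop
      simpa only [Real.norm_eq_abs, sq_abs] using this
    have h1 := (SchwartzMap.smulLeftCLM ℂ (fun s : ℝ => (((1 + s ^ 2) ^ (r / 2) : ℝ) : ℂ))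
      (𝓕 q : 𝓢(ℝ, ℂ))).memLp (μ := volume) 2
    refine lt_of_le_of_lt (le_of_eq ?_) ((memLp_two_iff h1.1).1 h1)
    refine lintegral_congr fun s => ?_
    rw [SchwartzMap.smulLeftCLM_apply_apply ht, hg, smul_eq_mul, enorm_mul, SchwartzMap.fourier_coe]
    rw [← ofReal_norm, Complex.norm_real, Real.norm_of_nonneg (by positivity)]
  have hle : ∀ η : Euc d, ∫⁻ s : ℝ, ‖(wt r (join η s) : ℂ) * profile q f (join η s)‖ₑ ^ 2 ≤
      (ENNReal.ofReal (xiConst (r - 1 / 2)) ^ 2 * ∫⁻ s, g s) *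
        ‖(wt (r - 1 / 2) η : ℂ) * f η‖ₑ ^ 2 := by
    intro η
    have hσ := sig_pos η
    have h1 : ∀ s, ‖(wt r (join η s) : ℂ) * profile q f (join η s)‖ₑ ^ 2 ≤
        (ENNReal.ofReal (sig η ^ (r - 1)) * ‖f η‖ₑ) ^ 2 * g (s * (sig η)⁻¹) := by
      intro s
      rw [hg]
      simp only
      rw [← mul_pow]
      refine pow_le_pow_left₀ zero_le ?_ 2
      rw [profile, tang_join, nrm_join, enorm_mul, enorm_mul, enorm_mul, enorm_wt]
      have e1 : ‖(((sig η)⁻¹ : ℝ) : ℂ)‖ₑ = ENNReal.ofReal (sig η)⁻¹ := by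
        rw [← ofReal_norm, Complex.norm_real, Real.norm_of_nonneg (by positivity)]
      have e2 : ENNReal.ofReal (sig η ^ (r - 1)) = ENNReal.ofReal (sig η ^ r) * ENNReal.ofReal (sig η)⁻¹ := by
        rw [← ENNReal.ofReal_mul (by positivity), Real.rpow_sub hσ, Real.rpow_one, div_eq_mul_inv]
      have e3 := ENNReal.ofReal_le_ofReal (wt_join_le (by linarith : 0 ≤ r) η s)
      rw [ENNReal.ofReal_mul (by positivity)] at e3
      rw [e1, e2]
      calc _ ≤ ENNReal.ofReal (sig η ^ r) * ENNReal.ofReal ((1 + (s * (sig η)⁻¹) ^ 2) ^ (r / 2)) *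
            (‖f η‖ₑ * ENNReal.ofReal (sig η)⁻¹ * ‖𝓕 (q : ℝ → ℂ) (s * (sig η)⁻¹)‖ₑ) := by gcongr
        _ = _ := by ring
    refine (lintegral_mono h1).trans ?_
    rw [lintegral_const_mul' _ _ (by finiteness), lintegral_comp_mul_inv g hσ]
    have e4 : ENNReal.ofReal (sig η ^ (r - 1)) ^ 2 * ENNReal.ofReal (sig η) =
        ENNReal.ofReal (sig η ^ (r - 1 / 2)) ^ 2 := by
      rw [← ENNReal.ofReal_pow (by positivity), ← ENNReal.ofReal_mul (by positivity),
        ← ENNReal.ofReal_pow (by positivity), ← Real.rpow_natCast, ← Real.rpow_natCast,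
        ← Real.rpow_mul hσ.le, ← Real.rpow_mul hσ.le]
      nth_rewrite 2 [← Real.rpow_one (sig η)]
      rw [← Real.rpow_add hσ]
      congr 2
      push_cast
      ring
    have e5 := ENNReal.ofReal_le_ofReal (sig_rpow_le (t := r - 1 / 2) (by linarith) η)
    rw [ENNReal.ofReal_mul (by unfold xiConst; positivity)] at e5
    calc _ = ENNReal.ofReal (sig η ^ (r - 1 / 2)) ^ 2 * ‖f η‖ₑ ^ 2 * ∫⁻ s, g s := by
          rw [← e4, mul_pow]
          ring
      _ ≤ (ENNReal.ofReal (xiConst (r - 1 / 2)) * ENNReal.ofReal (wt (r - 1 / 2) η)) ^ 2 *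
          ‖f η‖ₑ ^ 2 * ∫⁻ s, g s := by gcongr
      _ = _ := by
        rw [enorm_mul, enorm_wt]
        ring
  rw [memLp_two_iff hm, lintegral_join (hm.enorm.pow_const 2)]
  refine (lintegral_mono hle).trans_lt ?_
  have hfin : ENNReal.ofReal (xiConst (r - 1 / 2)) ^ 2 * ∫⁻ s, g s < ∞ :=
    ENNReal.mul_lt_top (by finiteness) hgfin
  rw [lintegral_const_mul' _ _ hfin.ne]
  exact ENNReal.mul_lt_top hfin ((memLp_two_iff hf.1).1 hf)

theorem memLp_fourier_schwartz (q : 𝓢(ℝ, ℂ)) : MemLp (𝓕 (q : ℝ → ℂ)) 2 volume := by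
  have := (𝓕 q : 𝓢(ℝ, ℂ)).memLp (μ := volume) 2
  rwa [SchwartzMap.fourier_coe] at this

/-- The extension operator: `E ψ = 𝓕⁻¹_{ξ' → x'} h(⟨ξ'⟩ x_n) ψ̂(ξ')` with a Schwartz function `h` that
equals `e^{-x}` for `x ≥ 0`. It extends `K₀ψ` to the lower half-space. -/
def extend (ψ : L2 d) : L2 (d + 1) :=
  ofHat (memLp_profile expExt.integrable (memLp_fourier_schwartz expExt) (Lp.memLp (𝓕 ψ : L2 d)))

theorem fourier_extend (ψ : L2 d) : ((𝓕 (extend ψ) : L2 (d + 1)) : Euc (d + 1) → ℂ) =ᵐ[volume]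
    profile expExt (𝓕 ψ : L2 d) := fourier_ofHat _

theorem hNorm_extend_lt_top {r : ℝ} (hr : 1 / 2 ≤ r) {ψ : L2 d} (hψ : hNorm (r - 1 / 2) ψ < ∞) :
    hNorm r (extend ψ) < ∞ := by
  refine lt_of_le_of_lt (le_of_eq (eLpNorm_congr_ae ?_))
    (memLp_wt_mul_profile hr expExt (memLp_of_hNorm hψ)).2
  filter_upwards [fourier_extend ψ] with ξ h
  rw [h]

theorem fourier_sub_apply {p q : ℝ → ℂ} (hp : Integrable p) (hq : Integrable q) (s : ℝ) :
    𝓕 (fun x => p x - q x) s = 𝓕 p s - 𝓕 q s := by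
  rw [Real.fourier_eq, Real.fourier_eq, Real.fourier_eq, ← integral_sub
    ((Real.fourierIntegral_convergent_iff s).2 hp) ((Real.fourierIntegral_convergent_iff s).2 hq)]
  simp only [smul_sub]

/-- `E ψ` and `K₀ψ` agree in the upper half-space, as `e^{-x}` and its extension agree for `x > 0`. -/
theorem cut_extend (ψ : L2 d) : cut (extend ψ) = powPoisson le_rfl ψ := by
  refine (eq_cut_of_isUpper_of_isLower_sub (isUpper_powPoisson le_rfl ψ) ?_).symm
  have hg := integrable_gam (b := 0) (by norm_num)
  refine isLower_of_profile (q := fun x => gam 0 x - expExt x) (f := (𝓕 ψ : L2 d))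
    (hg.sub expExt.integrable) (fun x hx => ?_) ?_
  · rw [gam, if_pos hx, expExt_of_nonneg hx.le]
    simp
  · filter_upwards [fourier_sub_ae (powPoisson le_rfl ψ) (extend ψ), fourier_powPoisson le_rfl ψ,
      fourier_extend ψ] with ξ h1 h2 h3
    rw [h1, h2, h3]
    have h4 := profile_gam (b := 0) (by norm_num) (𝓕 ψ : L2 d) ξ
    simp only [profile] at h4 ⊢
    rw [fourier_sub_apply hg expExt.integrable]
    simp only [neg_zero, Real.rpow_zero, Complex.ofReal_one, one_mul] at h4
    rw [mul_sub, h4]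
    ring

theorem fiberInt_profile (q : 𝓢(ℝ, ℂ)) (f : Euc d → ℂ) (η : Euc d) :
    fiberInt (profile q f) η = q 0 * f η := by
  have hσ := sig_pos η
  have h1 : ∫ s : ℝ, 𝓕 (q : ℝ → ℂ) (s * (sig η)⁻¹) = (sig η : ℂ) * q 0 := by
    rw [Measure.integral_comp_mul_right (fun s => 𝓕 (q : ℝ → ℂ) s), inv_inv, abs_of_pos hσ,
      Complex.real_smul]
    congr 1
    have h : (𝓕⁻ (𝓕 q : 𝓢(ℝ, ℂ)) : 𝓢(ℝ, ℂ)) 0 = q 0 := by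
      rw [FourierTransform.fourierInv_fourier_eq]
    rw [← h, SchwartzMap.fourierInv_coe, Real.fourierInv_eq]
    simp [SchwartzMap.fourier_coe]
  have : (sig η : ℂ) ≠ 0 := by exact_mod_cast hσ.ne'
  simp only [fiberInt, profile, tang_join, nrm_join]
  rw [integral_const_mul, h1]
  push_cast
  field_simp

theorem fiberInt_congr {G G' : Euc (d + 1) → ℂ} (h : G =ᵐ[volume] G') :
    fiberInt G =ᵐ[volume] fiberInt G' := by
  have h1 : ∀ᵐ p : Euc d × ℝ ∂(volume.prod volume), G (join p.1 p.2) = G' (join p.1 p.2) :=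
    measurePreserving_join.quasiMeasurePreserving.ae h
  filter_upwards [Measure.ae_ae_of_ae_prod h1] with η hη
  exact integral_congr_ae hη

theorem fiberInt_fourier_extend (ψ : L2 d) :
    fiberInt (𝓕 (extend ψ) : L2 (d + 1)) =ᵐ[volume] (𝓕 ψ : L2 d) := by
  filter_upwards [fiberInt_congr (fourier_extend ψ)] with η h
  rw [h, fiberInt_profile, expExt_of_nonneg le_rfl]
  simp

/-! ### The extension operator on Schwartz functions -/

/-- Restriction to the boundary on the Fourier side. -/
theorem fiberInt_fourier_schwartz (Φ : 𝓢(Euc (d + 1), ℂ)) (η : Euc d) :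
    fiberInt (𝓕 Φ : 𝓢(Euc (d + 1), ℂ)) η = (𝓕 (sliceTang 0 Φ) : 𝓢(Euc d, ℂ)) η := by
  have h := congrFun (fourier_sliceNrm_fourierInv Φ (-η)) 0
  rw [Real.fourier_eq] at h
  simp only [inner_zero_right, neg_zero, AddChar.map_zero_eq_one, one_smul, pft] at h
  have e1 : fiberInt (𝓕 Φ : 𝓢(Euc (d + 1), ℂ)) η =
      ∫ s : ℝ, (𝓕⁻ Φ : 𝓢(Euc (d + 1), ℂ)) (join (-η) s) := by
    rw [fiberInt, ← integral_neg_eq_self]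
    refine integral_congr_ae (ae_of_all _ fun s => ?_)
    have : join η (-s) = -join (-η) s := by
      ext i
      refine Fin.lastCases ?_ (fun i => ?_) i <;> simp [join]
    simp only
    rw [this, SchwartzMap.fourier_coe, SchwartzMap.fourierInv_coe, Real.fourierInv_eq_fourier_neg]
  rw [e1, h, SchwartzMap.fourier_coe, Real.fourier_eq']
  refine integral_congr_ae (ae_of_all _ fun x => ?_)
  simp [sliceTang, inner_neg_right]

/-- The extension operator on Schwartz functions. -/
def extendSchwartz (f : 𝓢(Euc d, ℂ)) : 𝓢(Euc (d + 1), ℂ) :=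
  𝓕⁻ (SchwartzMap.compCLM ℂ normalDilation_temperate ⟨2, _, norm_le_normalDilation⟩
    (tensor (sigMul (-1) (𝓕 f)) (𝓕 expExt)))

theorem fourier_extendSchwartz (f : 𝓢(Euc d, ℂ)) (ξ : Euc (d + 1)) :
    (𝓕 (extendSchwartz f) : 𝓢(Euc (d + 1), ℂ)) ξ = profile expExt (𝓕 f : 𝓢(Euc d, ℂ)) ξ := by
  rw [extendSchwartz, FourierTransform.fourier_fourierInv_eq, SchwartzMap.compCLM_apply]
  simp only [Function.comp_apply, tensor_apply, normalDilation, tang_join, nrm_join, sigMul_apply,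
    profile, Real.rpow_neg_one, SchwartzMap.fourier_coe]
  ring

theorem fourier_toLp_ae {k : ℕ} (f : 𝓢(Euc k, ℂ)) :
    ((𝓕 (f.toLp 2 : L2 k) : L2 k) : Euc k → ℂ) =ᵐ[volume] (𝓕 f : 𝓢(Euc k, ℂ)) := by
  rw [SchwartzMap.toLp_fourier_eq]
  exact SchwartzMap.coeFn_toLp (𝓕 f : 𝓢(Euc k, ℂ)) 2 volume

theorem profile_congr {q : ℝ → ℂ} {f g : Euc d → ℂ} (h : f =ᵐ[volume] g) :
    profile q f =ᵐ[volume] profile q g := by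
  filter_upwards [comp_tang_ae_eq h] with ξ hξ
  simp only [profile, hξ]

theorem toLp_extendSchwartz (f : 𝓢(Euc d, ℂ)) :
    ((extendSchwartz f).toLp 2 : L2 (d + 1)) = extend (f.toLp 2) := by
  refine eq_of_fourier_ae_eq ?_
  filter_upwards [fourier_toLp_ae (extendSchwartz f), fourier_extend (f.toLp 2),
    profile_congr (q := expExt) (fourier_toLp_ae f)] with ξ h1 h2 h3
  rw [h1, h2, h3, fourier_extendSchwartz]

theorem extendSchwartz_bdry (f : 𝓢(Euc d, ℂ)) (y : Euc d) : extendSchwartz f (bdry y) = f y := by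
  have h : (𝓕 (sliceTang 0 (extendSchwartz f)) : 𝓢(Euc d, ℂ)) = 𝓕 f := by
    ext η
    rw [← fiberInt_fourier_schwartz, funext (fourier_extendSchwartz f), fiberInt_profile,
      expExt_of_nonneg le_rfl]
    simp
  have h2 : sliceTang 0 (extendSchwartz f) = f := by
    have := congrArg (fun p : 𝓢(Euc d, ℂ) => (𝓕⁻ p : 𝓢(Euc d, ℂ))) h
    simpa using this
  have := congrArg (fun p : 𝓢(Euc d, ℂ) => p y) h2
  exact this

theorem extendSchwartz_ae (f : 𝓢(Euc d, ℂ)) :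
    ∀ᵐ x : Euc (d + 1), 0 < nrm x → extendSchwartz f x = poisson (f.toLp 2) x := by
  have h1 := cut_ae ((extendSchwartz f).toLp 2)
  rw [toLp_extendSchwartz, cut_extend, ← toLp_extendSchwartz] at h1
  filter_upwards [h1, powPoisson_ae le_rfl (f.toLp 2), SchwartzMap.coeFn_toLp (extendSchwartz f) 2]
    with x g1 g2 g3 hx
  rw [g2, Set.indicator_of_mem (show x ∈ openHalf d from hx), g3, nrmPowMul, if_pos hx] at g1
  simpa using g1.symm

/-! ### Taylor expansion at the boundary -/

/-- The unit normal. -/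
def normalVec (d : ℕ) : Euc (d + 1) := join 0 1

/-- The normal derivative on Schwartz functions. -/
def normalDeriv (d : ℕ) : 𝓢(Euc (d + 1), ℂ) →L[ℂ] 𝓢(Euc (d + 1), ℂ) :=
  LineDeriv.lineDerivOpCLM ℂ 𝓢(Euc (d + 1), ℂ) (normalVec d)

theorem nrm_temperate : (fun x : Euc (d + 1) => (nrm x : ℂ)).HasTemperateGrowth :=
  (Complex.ofRealCLM ∘L nrmCLM d).hasTemperateGrowth

/-- Multiplication by `x_n` on Schwartz functions. -/
def nrmMul (d : ℕ) : 𝓢(Euc (d + 1), ℂ) →L[ℂ] 𝓢(Euc (d + 1), ℂ) :=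
  SchwartzMap.smulLeftCLM ℂ (fun x : Euc (d + 1) => (nrm x : ℂ))

theorem nrmMul_apply (G : 𝓢(Euc (d + 1), ℂ)) (x : Euc (d + 1)) : nrmMul d G x = nrm x * G x := by
  rw [nrmMul, SchwartzMap.smulLeftCLM_apply_apply nrm_temperate, smul_eq_mul]

theorem nrmMul_iterate_apply (N : ℕ) (G : 𝓢(Euc (d + 1), ℂ)) (x : Euc (d + 1)) :
    (nrmMul d)^[N] G x = (nrm x : ℂ) ^ N * G x := by
  induction N with
  | zero => simp
  | succ N ih =>
    rw [Function.iterate_succ_apply', nrmMul_apply, ih]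
    ring

@[simp] theorem nrm_bdry (y : Euc d) : nrm (bdry y) = 0 := by rw [bdry_eq_join, nrm_join]

@[simp] theorem nrm_normalVec : nrm (normalVec d) = 1 := by rw [normalVec, nrm_join]

open LineDeriv in
theorem normalDeriv_nrmMul (G : 𝓢(Euc (d + 1), ℂ)) :
    normalDeriv d (nrmMul d G) = nrmMul d (normalDeriv d G) + G := by
  ext x
  have h1 : HasFDerivAt (fun x : Euc (d + 1) => (nrm x : ℂ)) (Complex.ofRealCLM ∘L nrmCLM d) x :=
    (Complex.ofRealCLM ∘L nrmCLM d).hasFDerivAt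
  have h2 := h1.mul (G.hasFDerivAt x)
  have e : (⇑(nrmMul d G) : Euc (d + 1) → ℂ) = (fun x : Euc (d + 1) => (nrm x : ℂ)) * ⇑G := by
    funext x
    rw [nrmMul_apply, Pi.mul_apply]
  simp only [normalDeriv, lineDerivOpCLM_apply, add_apply, nrmMul_apply]
  rw [SchwartzMap.lineDerivOp_apply_eq_fderiv, SchwartzMap.lineDerivOp_apply_eq_fderiv, e, h2.fderiv]
  simp

theorem normalDeriv_iterate_nrmMul (j : ℕ) (G : 𝓢(Euc (d + 1), ℂ)) :
    (normalDeriv d)^[j + 1] (nrmMul d G) =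
      nrmMul d ((normalDeriv d)^[j + 1] G) + ((j : ℂ) + 1) • (normalDeriv d)^[j] G := by
  induction j with
  | zero => simp [normalDeriv_nrmMul]
  | succ j ih =>
    rw [Function.iterate_succ_apply', ih, map_add, map_smul, normalDeriv_nrmMul,
      ← Function.iterate_succ_apply' (normalDeriv d), ← Function.iterate_succ_apply' (normalDeriv d)]
    push_cast
    module

theorem normalDeriv_iterate_nrmMul_bdry (N : ℕ) (G : 𝓢(Euc (d + 1), ℂ)) (y : Euc d) :
    (∀ j < N, (normalDeriv d)^[j] ((nrmMul d)^[N] G) (bdry y) = 0) ∧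
      (normalDeriv d)^[N] ((nrmMul d)^[N] G) (bdry y) = N.factorial * G (bdry y) := by
  induction N with
  | zero => simp
  | succ N ih =>
    have hs : ∀ j : ℕ, (normalDeriv d)^[j + 1] ((nrmMul d)^[N + 1] G) (bdry y) =
        ((j : ℂ) + 1) * (normalDeriv d)^[j] ((nrmMul d)^[N] G) (bdry y) := by
      intro j
      rw [Function.iterate_succ_apply' (nrmMul d), normalDeriv_iterate_nrmMul, add_apply,
        nrmMul_apply, nrm_bdry, smul_apply]
      simp
    refine ⟨fun j hj => ?_, ?_⟩
    · rcases j with _ | j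
      · rw [Function.iterate_succ_apply' (nrmMul d)]
        simp [nrmMul_apply]
      · rw [hs, ih.1 j (by omega), mul_zero]
    · rw [hs, ih.2, Nat.factorial_succ]
      push_cast
      ring

/-- `R` vanishes to order `N` at the boundary. -/
def VanishesToOrder (N : ℕ) (R : 𝓢(Euc (d + 1), ℂ)) : Prop :=
  ∀ j < N, ∀ y, (normalDeriv d)^[j] R (bdry y) = 0

/-- The next Taylor term: `f = ∂_n^N R(·, 0) / N!`. -/
theorem VanishesToOrder.exists_sub {N : ℕ} {R : 𝓢(Euc (d + 1), ℂ)} (hR : VanishesToOrder N R) :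
    ∃ f : 𝓢(Euc d, ℂ), VanishesToOrder (N + 1) (R - (nrmMul d)^[N] (extendSchwartz f)) := by
  refine ⟨(N.factorial : ℂ)⁻¹ • sliceTang 0 ((normalDeriv d)^[N] R), fun j hj y => ?_⟩
  have hsub := iterate_map_sub (normalDeriv d) j
  rw [hsub, sub_apply]
  rcases Nat.lt_succ_iff_lt_or_eq.1 hj with h | rfl
  · rw [hR j h y, (normalDeriv_iterate_nrmMul_bdry N _ y).1 j h, sub_zero]
  · rw [(normalDeriv_iterate_nrmMul_bdry j _ y).2, extendSchwartz_bdry, smul_apply,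
      sliceTang_apply, ← bdry_eq_join, smul_eq_mul, mul_inv_cancel_left₀, sub_self]
    exact_mod_cast j.factorial_ne_zero

/-- Taylor expansion of a Schwartz function at the boundary, with Schwartz remainder. -/
theorem exists_taylor (φ : 𝓢(Euc (d + 1), ℂ)) (N : ℕ) :
    ∃ (f : ℕ → 𝓢(Euc d, ℂ)) (R : 𝓢(Euc (d + 1), ℂ)), VanishesToOrder N R ∧
      φ = ∑ k ∈ Finset.range N, (nrmMul d)^[k] (extendSchwartz (f k)) + R := by
  induction N with
  | zero => exact ⟨0, φ, fun j hj => absurd hj (Nat.not_lt_zero j), by simp⟩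
  | succ N ih =>
    obtain ⟨f, R, hR, hφ⟩ := ih
    obtain ⟨g, hg⟩ := hR.exists_sub
    refine ⟨Function.update f N g, _, hg, ?_⟩
    rw [Finset.sum_range_succ, Function.update_self, Finset.sum_congr rfl (g := fun k =>
      (nrmMul d)^[k] (extendSchwartz (f k))) fun k hk => by
        rw [Function.update_of_ne (Finset.mem_range.1 hk).ne]]
    nth_rewrite 1 [hφ]
    abel

open LineDeriv in
theorem lineDerivOp_comm (m v : Euc (d + 1)) (G : 𝓢(Euc (d + 1), ℂ)) :
    (∂_{m} (∂_{v} G : 𝓢(Euc (d + 1), ℂ)) : 𝓢(Euc (d + 1), ℂ)) =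
      ∂_{v} (∂_{m} G : 𝓢(Euc (d + 1), ℂ)) := by
  have hd : ∀ (a b : Euc (d + 1)) x,
      (∂_{a} (∂_{b} G : 𝓢(Euc (d + 1), ℂ)) : 𝓢(Euc (d + 1), ℂ)) x =
        fderiv ℝ (fderiv ℝ G) x a b := by
    intro a b x
    rw [SchwartzMap.lineDerivOp_apply_eq_fderiv]
    have e : (⇑(∂_{b} G : 𝓢(Euc (d + 1), ℂ)) : Euc (d + 1) → ℂ) = fun y => fderiv ℝ G y b :=
      funext fun y => SchwartzMap.lineDerivOp_apply_eq_fderiv _ _ _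
    have hdiff : DifferentiableAt ℝ (fderiv ℝ G) x :=
      (((G.smooth 2).fderiv_right (m := 1) (by norm_num)).differentiable one_ne_zero) x
    rw [e, (hdiff.hasFDerivAt.clm_apply (hasFDerivAt_const b x)).fderiv]
    simp
  ext x
  rw [hd, hd]
  exact ((G.smooth 2).contDiffAt.isSymmSndFDerivAt (by simp)).eq m v

open LineDeriv in
theorem normalDeriv_iterate_lineDerivOp (m : Euc (d + 1)) (j : ℕ) (G : 𝓢(Euc (d + 1), ℂ)) :
    (normalDeriv d)^[j] (∂_{m} G) = ∂_{m} ((normalDeriv d)^[j] G) := by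
  induction j with
  | zero => rfl
  | succ j ih =>
    rw [Function.iterate_succ_apply', Function.iterate_succ_apply', ih]
    exact lineDerivOp_comm _ _ _

theorem VanishesToOrder.normalDeriv {N : ℕ} {R : 𝓢(Euc (d + 1), ℂ)} (hR : VanishesToOrder N R) :
    VanishesToOrder (N - 1) (normalDeriv d R) := fun j hj y => by
  rw [← Function.iterate_succ_apply]
  exact hR (j + 1) (by omega) y

open LineDeriv in
/-- Tangential derivatives do not lower the order of vanishing. -/
theorem VanishesToOrder.lineDerivOp {N : ℕ} {R : 𝓢(Euc (d + 1), ℂ)} (hR : VanishesToOrder N R)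
    {m : Euc (d + 1)} (hm : nrm m = 0) : VanishesToOrder N (∂_{m} R) := fun j hj y => by
  rw [normalDeriv_iterate_lineDerivOp, SchwartzMap.lineDerivOp_apply, lineDeriv]
  have e : (fun t : ℝ => ((HalfSpace.normalDeriv d)^[j] R) (bdry y + t • m)) = fun _ => 0 := by
    funext t
    have : bdry y + t • m = bdry (y + t • tang m) := by
      ext i
      refine Fin.lastCases ?_ (fun i => ?_) i
      · have : m (Fin.last d) = 0 := hm
        simp [bdry, this]
      · simp [bdry, tang]
    rw [this, hR j hj]
  rw [e, deriv_const]

open LineDeriv in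
/-- A Schwartz function that vanishes to order `N` at the boundary is `O(x_n^N)`, rapidly decreasing
at infinity. -/
theorem VanishesToOrder.exists_bound (K : ℕ) {N : ℕ} : ∀ {R : 𝓢(Euc (d + 1), ℂ)},
    VanishesToOrder N R → ∃ C, 0 ≤ C ∧
      ∀ x, 0 ≤ nrm x → ‖R x‖ ≤ C * nrm x ^ N * (1 + ‖x‖) ^ (-(K : ℝ)) := by
  induction N with
  | zero =>
    intro R _
    obtain ⟨C, hC, h⟩ := exists_schwartz_bound R K
    exact ⟨C, hC, fun x _ => by simpa using h x⟩
  | succ N ih =>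
    intro R hR
    obtain ⟨C, hC, h⟩ := exists_schwartz_bound R K
    obtain ⟨C', hC', h'⟩ := ih hR.normalDeriv
    refine ⟨C + C' * 2 ^ (K : ℝ), by positivity, fun x hx => ?_⟩
    have hpos : 0 < (1 + ‖x‖) ^ (-(K : ℝ)) := by positivity
    rcases le_or_gt 1 (nrm x) with h1 | h1
    · calc ‖R x‖ ≤ C * 1 * (1 + ‖x‖) ^ (-(K : ℝ)) := by rw [mul_one]; exact h x
        _ ≤ (C + C' * 2 ^ (K : ℝ)) * nrm x ^ (N + 1) * (1 + ‖x‖) ^ (-(K : ℝ)) := by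
          gcongr
          · exact le_add_of_nonneg_right (by positivity)
          · exact one_le_pow₀ h1
    · set y := tang x
      set s := nrm x
      have hxj : x = join y s := (join_tang_nrm x).symm
      have hder : ∀ t : ℝ, HasDerivAt (fun t => R (join y t)) (HalfSpace.normalDeriv d R (join y t)) t := by
        intro t
        have hj : HasDerivAt (fun t : ℝ => join y t) (normalVec d) t := by
          have : (fun t : ℝ => join y t) = fun t => join y 0 + t • normalVec d :=
            funext fun t => join_eq_add y t
          rw [this]
          simpa using ((hasDerivAt_id t).smul_const (normalVec d)).const_add (join y 0)
        have := (R.hasFDerivAt (join y t)).comp_hasDerivAt t hj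
        rwa [← SchwartzMap.lineDerivOp_apply_eq_fderiv] at this
      have hb := norm_image_sub_le_of_norm_deriv_le_segment' (a := 0) (b := s)
        (f := fun t => R (join y t)) (C := C' * s ^ N * (2 ^ (K : ℝ) * (1 + ‖x‖) ^ (-(K : ℝ))))
        (fun t _ => (hder t).hasDerivWithinAt) (fun t ht => ?_) s ⟨hx, le_rfl⟩
      · have h0 : R (join y 0) = 0 := hR 0 (by omega) y
        rw [h0, sub_zero, sub_zero, ← hxj] at hb
        refine hb.trans ?_
        calc C' * s ^ N * (2 ^ (K : ℝ) * (1 + ‖x‖) ^ (-(K : ℝ))) * s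
            = (0 + C' * 2 ^ (K : ℝ)) * s ^ (N + 1) * (1 + ‖x‖) ^ (-(K : ℝ)) := by ring
          _ ≤ _ := by gcongr
      · have ht0 : 0 ≤ t := ht.1
        have g1 := h' (join y t) (by simpa using ht0)
        rw [nrm_join] at g1
        refine g1.trans ?_
        have g2 : (1 + ‖x‖) ≤ 2 * (1 + ‖join y t‖) := by
          have a1 := norm_le_tang_nrm x
          have a2 := norm_tang_le (join y t)
          rw [tang_join] at a2
          have a3 : |nrm x| ≤ 1 := abs_le.2 ⟨by linarith, h1.le⟩
          linarith [norm_nonneg (join y t)]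
        have g3 : (1 + ‖join y t‖) ^ (-(K : ℝ)) ≤ 2 ^ (K : ℝ) * (1 + ‖x‖) ^ (-(K : ℝ)) := by
          have := Real.rpow_le_rpow_of_nonpos (by positivity) g2 (neg_nonpos.2 (Nat.cast_nonneg K))
          rw [Real.mul_rpow (by norm_num) (by positivity), Real.rpow_neg (by norm_num : (0:ℝ) ≤ 2)] at this
          have h2 : (0 : ℝ) < 2 ^ (K : ℝ) := by positivity
          calc (1 + ‖join y t‖) ^ (-(K : ℝ)) =
                2 ^ (K : ℝ) * ((2 ^ (K : ℝ))⁻¹ * (1 + ‖join y t‖) ^ (-(K : ℝ))) := by field_simp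
            _ ≤ _ := by gcongr
        have g4 : t ^ N ≤ s ^ N := pow_le_pow_left₀ ht0 ht.2.le N
        gcongr

/-! ### Sobolev regularity of `x_n^b R` for `R` vanishing to high order -/

theorem memLp_of_decay {k : ℕ} {f : Euc k → ℂ} (hf : AEStronglyMeasurable f volume) {C : ℝ} {K : ℕ}
    (hK : k < K) (h : ∀ x, ‖f x‖ ≤ C * (1 + ‖x‖) ^ (-(K : ℝ))) : MemLp f 2 volume := by
  have hg : MemLp (fun x : Euc k => (1 + ‖x‖) ^ (-(K : ℝ))) 2 volume := by
    have hc : Continuous fun x : Euc k => (1 + ‖x‖) ^ (-(K : ℝ)) :=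
      (continuous_const.add continuous_norm).rpow_const fun x => Or.inl
        (by positivity : (0 : ℝ) < 1 + ‖x‖).ne'
    rw [memLp_two_iff_integrable_sq hc.aestronglyMeasurable]
    have := integrable_one_add_norm (E := Euc k) (μ := volume) (r := (K : ℝ) + K)
      (by
        rw [finrank_euclideanSpace_fin]
        have : (k : ℝ) < K := by exact_mod_cast hK
        linarith [(Nat.cast_nonneg K : (0 : ℝ) ≤ K)])
    refine this.congr (ae_of_all _ fun x => ?_)
    simp only
    rw [neg_add, Real.rpow_add (by positivity), sq]
  refine hg.of_le_mul (c := C) hf (ae_of_all _ fun x => (h x).trans (le_of_eq ?_))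
  rw [Real.norm_of_nonneg (by positivity)]

theorem measurable_nrmPowMul (b : ℝ) {f : Euc (d + 1) → ℂ} (hf : Measurable f) :
    Measurable (nrmPowMul b f) := by
  unfold nrmPowMul
  refine Measurable.ite (measurableSet_lt measurable_const measurable_nrm) ?_ measurable_const
  exact (Complex.measurable_ofReal.comp (measurable_nrm.pow_const b)).mul hf

theorem VanishesToOrder.norm_nrmPowMul_le {N : ℕ} {R : 𝓢(Euc (d + 1), ℂ)}
    (hR : VanishesToOrder N R) (b : ℝ) (K : ℕ) : ∃ C, 0 ≤ C ∧ ∀ x, 0 < nrm x →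
      ‖nrmPowMul b R x‖ ≤ C * nrm x ^ (b + N) * (1 + ‖x‖) ^ (-(K : ℝ)) := by
  obtain ⟨C, hC, h⟩ := hR.exists_bound K
  refine ⟨C, hC, fun x hx => ?_⟩
  rw [nrmPowMul, if_pos hx, norm_mul, Complex.norm_real, Real.norm_of_nonneg (by positivity),
    Real.rpow_add hx, Real.rpow_natCast]
  calc nrm x ^ b * ‖R x‖ ≤ nrm x ^ b * (C * nrm x ^ N * (1 + ‖x‖) ^ (-(K : ℝ))) := by
        gcongr
        exact h x hx.le
    _ = _ := by ring

theorem VanishesToOrder.memLp_nrmPowMul {N : ℕ} {R : 𝓢(Euc (d + 1), ℂ)}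
    (hR : VanishesToOrder N R) {b : ℝ} (hb : 0 ≤ b + N) : MemLp (nrmPowMul b R) 2 volume := by
  obtain ⟨p, hp⟩ := exists_nat_ge (b + N)
  obtain ⟨C, hC, h⟩ := hR.norm_nrmPowMul_le b (p + (d + 2))
  refine memLp_of_decay (C := C) (K := d + 2)
    (measurable_nrmPowMul b R.continuous.measurable).aestronglyMeasurable (by omega) fun x => ?_
  rcases lt_or_ge 0 (nrm x) with hx | hx
  · refine (h x hx).trans ?_
    have h1 : (1 : ℝ) ≤ 1 + ‖x‖ := by linarith [norm_nonneg x]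
    have h2 : nrm x ^ (b + N) ≤ (1 + ‖x‖) ^ (p : ℝ) :=
      calc nrm x ^ (b + N) ≤ (1 + ‖x‖) ^ (b + N) :=
            Real.rpow_le_rpow hx.le (by linarith [abs_nrm_le x, le_abs_self (nrm x)]) hb
        _ ≤ _ := Real.rpow_le_rpow_of_exponent_le h1 hp
    calc C * nrm x ^ (b + N) * (1 + ‖x‖) ^ (-((p + (d + 2) : ℕ) : ℝ))
        ≤ C * (1 + ‖x‖) ^ (p : ℝ) * (1 + ‖x‖) ^ (-((p + (d + 2) : ℕ) : ℝ)) := by gcongr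
      _ = C * (1 + ‖x‖) ^ (-((d + 2 : ℕ) : ℝ)) := by
        rw [mul_assoc, ← Real.rpow_add (by positivity)]
        congr 2
        push_cast
        ring
  · rw [nrmPowMul, if_neg (not_lt.2 hx), norm_zero]
    positivity

theorem nrm_add_smul (x m : Euc (d + 1)) (t : ℝ) : nrm (x + t • m) = nrm x + t * nrm m := by
  simp [nrm]

open LineDeriv in
/-- The product rule for `x_n^b R`, valid everywhere since `x_n^b R = O(|x_n|^{b + N})` with
`b + N > 1`. -/
theorem VanishesToOrder.hasLineDerivAt {N : ℕ} {R : 𝓢(Euc (d + 1), ℂ)}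
    (hR : VanishesToOrder N R) {b : ℝ} (hb : 1 < b + N) (m x : Euc (d + 1)) :
    HasLineDerivAt ℝ (nrmPowMul b R)
      (nrmPowMul b (∂_{m} R : 𝓢(Euc (d + 1), ℂ)) x + nrm m * b * nrmPowMul (b - 1) R x) x m := by
  unfold HasLineDerivAt
  have hcont : Continuous fun t : ℝ => nrm (x + t • m) := by
    simp only [nrm_add_smul]; fun_prop
  have hl : HasDerivAt (fun t : ℝ => x + t • m) m 0 := by
    simpa using ((hasDerivAt_id (0 : ℝ)).smul_const m).const_add x
  have hn : HasDerivAt (fun t : ℝ => nrm (x + t • m)) (nrm m) 0 :=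
    (nrmCLM d).hasFDerivAt.comp_hasDerivAt 0 hl
  rcases lt_trichotomy (nrm x) 0 with hx | hx | hx
  · have e : ∀ᶠ t : ℝ in nhds 0, nrmPowMul b R (x + t • m) = 0 := by
      have : ∀ᶠ t : ℝ in nhds 0, nrm (x + t • m) < 0 :=
        hcont.continuousAt.eventually_lt continuousAt_const (by simpa using hx)
      filter_upwards [this] with t ht
      rw [nrmPowMul, if_neg ht.not_gt]
    simp only [nrmPowMul, if_neg hx.not_gt, mul_zero, add_zero]
    exact (hasDerivAt_const (0 : ℝ) (0 : ℂ)).congr_of_eventuallyEq e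
  · simp only [nrmPowMul, if_neg hx.not_gt, mul_zero, add_zero]
    obtain ⟨C, hC, h⟩ := hR.norm_nrmPowMul_le b 0
    set p := b + N with hp
    have hbd : ∀ t : ℝ, ‖nrmPowMul b R (x + t • m)‖ ≤ C * |nrm m| ^ p * |t| ^ (p - 1) * |t| := by
      intro t
      rcases lt_or_ge 0 (nrm (x + t • m)) with ht | ht
      · refine (h _ ht).trans (le_of_eq ?_)
        have h1 : nrm (x + t • m) = |nrm m| * |t| := by
          rw [← abs_of_pos ht, nrm_add_smul, hx, zero_add, abs_mul, mul_comm]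
        have h2 : 0 < |t| := by
          rw [h1] at ht
          exact pos_of_mul_pos_right ht (abs_nonneg _)
        rw [h1, Nat.cast_zero, neg_zero, Real.rpow_zero, Real.mul_rpow (abs_nonneg _) (abs_nonneg _),
          Real.rpow_sub_one h2.ne']
        field_simp
      · rw [nrmPowMul, if_neg (not_lt.2 ht), norm_zero]
        positivity
    rw [hasDerivAt_iff_isLittleO_nhds_zero, Asymptotics.isLittleO_iff]
    intro c hc
    have hlim : Filter.Tendsto (fun t : ℝ => C * |nrm m| ^ p * |t| ^ (p - 1)) (nhds 0) (nhds 0) := by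
      have : Continuous fun t : ℝ => C * |nrm m| ^ p * |t| ^ (p - 1) :=
        continuous_const.mul (continuous_abs.rpow_const fun _ => Or.inr (by linarith))
      have h0 := this.tendsto 0
      rwa [abs_zero, Real.zero_rpow (by linarith), mul_zero] at h0
    filter_upwards [hlim.eventually (gt_mem_nhds hc)] with t ht
    have h0 : nrmPowMul b R (x + (0 : ℝ) • m) = 0 := by
      rw [zero_smul, add_zero, nrmPowMul, if_neg hx.not_gt]
    have h1 := hbd (0 + t)
    have e1 : (if 0 < nrm (x + (0 + t) • m) then
        ((nrm (x + (0 + t) • m) ^ b : ℝ) : ℂ) * R (x + (0 + t) • m) else 0) =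
        nrmPowMul b R (x + (0 + t) • m) := rfl
    have e2 : (if 0 < nrm (x + (0 : ℝ) • m) then
        ((nrm (x + (0 : ℝ) • m) ^ b : ℝ) : ℂ) * R (x + (0 : ℝ) • m) else 0) = 0 := h0
    rw [e1, e2, smul_zero, sub_zero, sub_zero]
    refine h1.trans ?_
    rw [zero_add, Real.norm_eq_abs]
    gcongr
  · have e : (fun t : ℝ => nrmPowMul b R (x + t • m)) =ᶠ[nhds 0]
        fun t => (nrm (x + t • m) ^ b : ℝ) * R (x + t • m) := by
      have : ∀ᶠ t : ℝ in nhds 0, 0 < nrm (x + t • m) :=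
        continuousAt_const.eventually_lt hcont.continuousAt (by simpa using hx)
      filter_upwards [this] with t ht
      rw [nrmPowMul, if_pos ht]
    refine HasDerivAt.congr_of_eventuallyEq ?_ e
    have hx0 : nrm (x + (0 : ℝ) • m) = nrm x := by simp
    have h1 := (hn.rpow_const (p := b) (Or.inl (by rw [hx0]; exact hx.ne'))).ofReal_comp
    have h2 : HasDerivAt (fun t : ℝ => R (x + t • m)) ((∂_{m} R : 𝓢(Euc (d + 1), ℂ)) x) 0 := by
      have := (R.hasFDerivAt (x + (0 : ℝ) • m)).comp_hasDerivAt 0 hl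
      rw [← SchwartzMap.lineDerivOp_apply_eq_fderiv, zero_smul, add_zero] at this
      exact this
    have h3 := h1.mul h2
    rw [hx0, zero_smul, add_zero] at h3
    have h4 : nrmPowMul b (∂_{m} R : 𝓢(Euc (d + 1), ℂ)) x + nrm m * b * nrmPowMul (b - 1) R x =
        ↑(nrm m * b * nrm x ^ (b - 1)) * R x +
          ↑(nrm x ^ b) * (∂_{m} R : 𝓢(Euc (d + 1), ℂ)) x := by
      rw [nrmPowMul, nrmPowMul, if_pos hx, if_pos hx]
      push_cast
      ring
    rw [h4]
    exact h3

open LineDeriv in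
/-- If the square integrable function `U` has everywhere the line derivative `V`, also square
integrable, then `V̂ = 2πi⟨ξ, m⟩ Û`. -/
theorem fourier_of_hasLineDerivAt {k : ℕ} {f g : Euc k → ℂ} {m : Euc k}
    (hfg : ∀ x, HasLineDerivAt ℝ f (g x) x m) {U V : L2 k} (hU : (U : Euc k → ℂ) =ᵐ[volume] f)
    (hV : (V : Euc k → ℂ) =ᵐ[volume] g) :
    ((𝓕 V : L2 k) : Euc k → ℂ) =ᵐ[volume]
      fun ξ => 2 * Real.pi * Complex.I * inner ℝ ξ m * (𝓕 U : L2 k) ξ := by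
  have hf2 : MemLp f 2 volume := (memLp_congr_ae hU).1 (Lp.memLp U)
  have hg2 : MemLp g 2 volume := (memLp_congr_ae hV).1 (Lp.memLp V)
  have hd : (∂_{m} (U : 𝓢'(Euc k, ℂ)) : 𝓢'(Euc k, ℂ)) = V := by
    ext φ
    rw [TemperedDistribution.lineDerivOp_apply_apply, coe_apply, coe_apply]
    have h1 : ∫ x, (-∂_{m} φ : 𝓢(Euc k, ℂ)) x * U x = -∫ x, f x * (∂_{m} φ : 𝓢(Euc k, ℂ)) x := by
      rw [← integral_neg]
      refine integral_congr_ae ?_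
      filter_upwards [hU] with x hx
      rw [hx]
      change -(∂_{m} φ : 𝓢(Euc k, ℂ)) x * f x = _
      ring
    have h2 : ∫ x, φ x * V x = ∫ x, g x * φ x := by
      refine integral_congr_ae ?_
      filter_upwards [hV] with x hx
      rw [hx, mul_comm]
    have key := integral_bilinear_hasLineDerivAt_right_eq_neg_left_of_integrable (μ := volume)
      (f := f) (f' := g) (g := φ) (g' := (∂_{m} φ : 𝓢(Euc k, ℂ))) (v := m)
      (B := ContinuousLinearMap.mul ℝ ℂ) (hg2.integrable_mul (φ.memLp 2))
      (hf2.integrable_mul ((∂_{m} φ : 𝓢(Euc k, ℂ)).memLp 2)) (hf2.integrable_mul (φ.memLp 2))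
      (fun x _ => hfg x) (fun x _ => by
        rw [SchwartzMap.lineDerivOp_apply_eq_fderiv]
        exact (φ.hasFDerivAt x).hasLineDerivAt m)
    simp only [ContinuousLinearMap.mul_apply'] at key
    rw [h1, h2, key, neg_neg]
  have h3 := TemperedDistribution.fourier_lineDerivOp_eq (U : 𝓢'(Euc k, ℂ)) m
  rw [hd, Lp.fourier_toTemperedDistribution_eq, Lp.fourier_toTemperedDistribution_eq] at h3
  have h4 : TemperedDistribution.smulLeftCLM ℂ (fun ξ : Euc k => ((inner ℝ ξ m : ℝ) : ℂ))
      (((2 * Real.pi * Complex.I) • (𝓕 U : L2 k) : L2 k) : 𝓢'(Euc k, ℂ)) = (𝓕 V : L2 k) := by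
    rw [coe_smul, map_smul, h3]
  rw [smulLeftCLM_coe_eq_iff (by fun_prop)] at h4
  filter_upwards [h4, Lp.coeFn_smul (2 * Real.pi * Complex.I : ℂ) (𝓕 U : L2 k)] with ξ h5 h6
  rw [h5, h6]
  simp only [Pi.smul_apply, smul_eq_mul]
  ring

theorem wt_one_le {k : ℕ} (ξ : Euc k) : wt 1 ξ ≤ 1 + ∑ i, |ξ i| := by
  have h0 : 0 ≤ ∑ i, |ξ i| := Finset.sum_nonneg fun i _ => abs_nonneg _
  have h1 : ‖ξ‖ ≤ ∑ i, |ξ i| := by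
    rw [EuclideanSpace.norm_eq]
    refine Real.sqrt_le_iff.2 ⟨h0, ?_⟩
    simpa using Finset.sum_sq_le_sq_sum_of_nonneg (s := Finset.univ) (f := fun i => |ξ i|)
      fun i _ => abs_nonneg _
  rw [wt, ← Real.sqrt_eq_rpow]
  refine Real.sqrt_le_iff.2 ⟨by positivity, ?_⟩
  nlinarith [norm_nonneg ξ]

/-- `H^{s+1}` regularity from `H^s` regularity of the function and its partial derivatives. -/
theorem hNorm_add_one_lt_top {k : ℕ} {s : ℝ} {U : L2 k} {V : Fin k → L2 k}
    (hU : hNorm s U < ∞) (hV : ∀ i, hNorm s (V i) < ∞)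
    (hUV : ∀ i, ((𝓕 (V i) : L2 k) : Euc k → ℂ) =ᵐ[volume]
      fun ξ => 2 * Real.pi * Complex.I * ξ i * (𝓕 U : L2 k) ξ) : hNorm (s + 1) U < ∞ := by
  have h1 : MemLp (fun ξ => ‖(wt s ξ : ℂ) * (𝓕 U : L2 k) ξ‖ +
      ∑ i, ‖(wt s ξ : ℂ) * (𝓕 (V i) : L2 k) ξ‖) 2 volume :=
    (memLp_of_hNorm hU).norm.add (memLp_finsetSum _ fun i _ => (memLp_of_hNorm (hV i)).norm)
  refine (h1.mono (aestronglyMeasurable_wt_fourier _ U) ?_).2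
  filter_upwards [ae_all_iff.2 hUV] with ξ hξ
  rw [Real.norm_of_nonneg (by positivity), norm_mul, Complex.norm_real,
    Real.norm_of_nonneg (wt_pos _ _).le, wt_add]
  have h2 : ∀ i, wt s ξ * |ξ i| * ‖(𝓕 U : L2 k) ξ‖ ≤ ‖(wt s ξ : ℂ) * (𝓕 (V i) : L2 k) ξ‖ := by
    intro i
    rw [hξ i]
    simp only [norm_mul, Complex.norm_real, Complex.norm_I, Real.norm_of_nonneg (wt_pos s ξ).le,
      Real.norm_eq_abs, abs_of_pos Real.pi_pos, Complex.norm_ofNat, mul_one]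
    have h3 : 1 ≤ 2 * Real.pi := by linarith [Real.pi_gt_three]
    have h4 : 0 ≤ wt s ξ * |ξ i| * ‖(𝓕 U : L2 k) ξ‖ :=
      mul_nonneg (mul_nonneg (wt_pos s ξ).le (abs_nonneg _)) (norm_nonneg _)
    nlinarith
  rw [norm_mul, Complex.norm_real, Real.norm_of_nonneg (wt_pos _ _).le]
  calc wt s ξ * wt 1 ξ * ‖(𝓕 U : L2 k) ξ‖
      ≤ wt s ξ * (1 + ∑ i, |ξ i|) * ‖(𝓕 U : L2 k) ξ‖ := by
        have := (wt_pos s ξ).le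
        gcongr
        exact wt_one_le ξ
    _ = wt s ξ * ‖(𝓕 U : L2 k) ξ‖ + ∑ i, wt s ξ * |ξ i| * ‖(𝓕 U : L2 k) ξ‖ := by
        rw [mul_add, add_mul, mul_one, Finset.mul_sum, Finset.sum_mul]
    _ ≤ _ := by
        gcongr with i
        exact h2 i

theorem VanishesToOrder.mono {M N : ℕ} (h : M ≤ N) {R : 𝓢(Euc (d + 1), ℂ)}
    (hR : VanishesToOrder N R) : VanishesToOrder M R := fun j hj => hR j (hj.trans_le h)

open LineDeriv in
theorem VanishesToOrder.lineDerivOp_single {N : ℕ} {R : 𝓢(Euc (d + 1), ℂ)}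
    (hR : VanishesToOrder N R) (i : Fin (d + 1)) :
    VanishesToOrder (N - 1) (∂_{EuclideanSpace.single i (1 : ℝ)} R) := by
  refine Fin.lastCases ?_ (fun i => ?_) i
  · have : EuclideanSpace.single (Fin.last d) (1 : ℝ) = normalVec d := by
      ext j
      refine Fin.lastCases ?_ (fun j => ?_) j <;> simp [normalVec, join, Fin.castSucc_ne_last]
    rw [this]
    exact hR.normalDeriv
  · refine (hR.lineDerivOp ?_).mono (Nat.sub_le _ _)
    simp [nrm, (Fin.castSucc_ne_last i).symm]

/-- By induction on `M`: the derivatives of `x_n^b R` are again of this form, with `b + N` lowered by at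
most one. It is an `H^M` function on the whole space although it is cut off at `x_n = 0`. -/
theorem VanishesToOrder.exists_hNorm_lt_top (M : ℕ) : ∀ {N : ℕ} {R : 𝓢(Euc (d + 1), ℂ)} {b : ℝ},
    VanishesToOrder N R → M + 1 < b + N →
      ∃ W : L2 (d + 1), (W : Euc (d + 1) → ℂ) =ᵐ[volume] nrmPowMul b R ∧ hNorm M W < ∞ := by
  induction M with
  | zero =>
    intro N R b hR hb
    have h := hR.memLp_nrmPowMul (b := b) (by push_cast at hb; linarith)
    refine ⟨h.toLp _, h.coeFn_toLp, ?_⟩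
    rw [Nat.cast_zero, hNorm_zero_order]
    exact enorm_lt_top
  | succ M ih =>
    intro N R b hR hb
    push_cast at hb
    obtain ⟨W, hW, hWM⟩ := ih hR (b := b) (by linarith)
    have hN : (N : ℝ) - 1 ≤ ((N - 1 : ℕ) : ℝ) := by
      have : (N : ℝ) ≤ ((N - 1 : ℕ) : ℝ) + 1 := by
        exact_mod_cast (by omega : N ≤ N - 1 + 1)
      linarith
    have hV : ∀ i : Fin (d + 1), ∃ V : L2 (d + 1), hNorm M V < ∞ ∧
        ((𝓕 V : L2 (d + 1)) : Euc (d + 1) → ℂ) =ᵐ[volume]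
          fun ξ => 2 * Real.pi * Complex.I * ξ i * (𝓕 W : L2 (d + 1)) ξ := by
      intro i
      obtain ⟨V₁, h1, h1M⟩ := ih (hR.lineDerivOp_single i) (b := b) (by linarith)
      obtain ⟨V₂, h2, h2M⟩ := ih hR (b := b - 1) (by linarith)
      refine ⟨V₁ + ((nrm (EuclideanSpace.single i (1 : ℝ)) * b : ℝ) : ℂ) • V₂, ?_, ?_⟩
      · refine (hNorm_add_le _ _ _).trans_lt (ENNReal.add_lt_top.2 ⟨h1M, ?_⟩)
        rw [hNorm_smul]
        exact ENNReal.mul_lt_top enorm_lt_top h2M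
      · have := fourier_of_hasLineDerivAt
          (hR.hasLineDerivAt (b := b) (by linarith) (EuclideanSpace.single i (1 : ℝ)))
          (U := W) (V := V₁ + ((nrm (EuclideanSpace.single i (1 : ℝ)) * b : ℝ) : ℂ) • V₂) hW ?_
        · simpa [EuclideanSpace.inner_single_right] using this
        · filter_upwards [Lp.coeFn_add V₁ (((nrm (EuclideanSpace.single i (1 : ℝ)) * b : ℝ) : ℂ) • V₂),
            Lp.coeFn_smul ((nrm (EuclideanSpace.single i (1 : ℝ)) * b : ℝ) : ℂ) V₂, h1, h2]
            with x e1 e2 e3 e4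
          rw [e1, Pi.add_apply, e2, Pi.smul_apply, e3, e4, smul_eq_mul]
          push_cast
          rfl
    choose V hVM hVW using hV
    refine ⟨W, hW, ?_⟩
    push_cast
    exact hNorm_add_one_lt_top hWM hVM hVW

/-! ### Lifting `x_n^a φ` through `Ξ_+^{-a} e⁺ r⁺` -/

theorem ae_integrable_fiber {r : ℝ} (hr : 1 / 2 < r) {F : L2 (d + 1)} (hF : hNorm r F < ∞) :
    ∀ᵐ η : Euc d, Integrable fun s : ℝ => (𝓕 F : L2 (d + 1)) (join η s) := by
  have hc : Continuous fun η : Euc d => (((1 + ‖η‖) ^ (-((d + 1 : ℕ) : ℝ)) : ℝ) : ℂ) :=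
    Complex.continuous_ofReal.comp ((continuous_const.add continuous_norm).rpow_const fun x => Or.inl
      (by positivity : (0 : ℝ) < 1 + ‖x‖).ne')
  have hg : MemLp (fun η : Euc d => (((1 + ‖η‖) ^ (-((d + 1 : ℕ) : ℝ)) : ℝ) : ℂ)) 2 volume := by
    refine memLp_of_decay (C := 1) (K := d + 1) hc.aestronglyMeasurable (by omega) fun x => ?_
    rw [Complex.norm_real, Real.norm_of_nonneg (by positivity), one_mul]
  have h := integrable_comp_tang_mul hr hg (Lp.aestronglyMeasurable (𝓕 F : L2 (d + 1)))
    (memLp_of_hNorm hF)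
  rw [← integrable_join_iff] at h
  filter_upwards [h.prod_right_ae] with η hη
  simp only [tang_join] at hη
  have h0 : (((1 + ‖η‖) ^ (-((d + 1 : ℕ) : ℝ)) : ℝ) : ℂ) ≠ 0 := by
    exact_mod_cast (by positivity : (0 : ℝ) < (1 + ‖η‖) ^ (-((d + 1 : ℕ) : ℝ))).ne'
  exact (integrable_const_mul_iff (isUnit_iff_ne_zero.2 h0) _).1 hη

theorem fiberInt_fourier_add {r : ℝ} (hr : 1 / 2 < r) {F G : L2 (d + 1)} (hF : hNorm r F < ∞)
    (hG : hNorm r G < ∞) : fiberInt (𝓕 (F + G) : L2 (d + 1)) =ᵐ[volume]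
      fun η => fiberInt (𝓕 F : L2 (d + 1)) η + fiberInt (𝓕 G : L2 (d + 1)) η := by
  filter_upwards [fiberInt_congr (fourier_add_ae F G), ae_integrable_fiber hr hF,
    ae_integrable_fiber hr hG] with η h h1 h2
  rw [h]
  exact integral_add h1 h2

theorem fiberInt_fourier_smul (c : ℂ) (F : L2 (d + 1)) :
    fiberInt (𝓕 (c • F) : L2 (d + 1)) =ᵐ[volume] fun η => c * fiberInt (𝓕 F : L2 (d + 1)) η := by
  filter_upwards [fiberInt_congr (fourier_smul_ae c F)] with η h
  rw [h]
  exact integral_const_mul _ _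

theorem fiberInt_fourier_sub {r : ℝ} (hr : 1 / 2 < r) {F G : L2 (d + 1)} (hF : hNorm r F < ∞)
    (hG : hNorm r G < ∞) : fiberInt (𝓕 (F - G) : L2 (d + 1)) =ᵐ[volume]
      fun η => fiberInt (𝓕 F : L2 (d + 1)) η - fiberInt (𝓕 G : L2 (d + 1)) η := by
  filter_upwards [fiberInt_congr (fourier_sub_ae F G), ae_integrable_fiber hr hF,
    ae_integrable_fiber hr hG] with η h h1 h2
  rw [h]
  exact integral_sub h1 h2

theorem hNorm_toLp_lt_top {k : ℕ} (s : ℝ) (φ : 𝓢(Euc k, ℂ)) : hNorm s (φ.toLp 2 : L2 k) < ∞ := by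
  have h := (SchwartzMap.smulLeftCLM ℂ (fun ξ : Euc k => ((wt s ξ : ℝ) : ℂ))
    (𝓕 φ : 𝓢(Euc k, ℂ))).memLp (μ := volume) 2
  refine lt_of_le_of_lt (le_of_eq (eLpNorm_congr_ae ?_)) h.2
  filter_upwards [fourier_toLp_ae φ] with ξ hξ
  rw [hξ, SchwartzMap.smulLeftCLM_apply_apply (wt_temperate s), smul_eq_mul]

/-- `Ξ_+^{-a} U = x_n^a φ`. -/
def IsPow (a : ℝ) (U : L2 (d + 1)) (φ : 𝓢(Euc (d + 1), ℂ)) : Prop :=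
  ∃ W : L2 (d + 1), ((𝓕 W : L2 (d + 1)) : Euc (d + 1) → ℂ) =ᵐ[volume]
      (fun ξ => xiSymbol (-a) ξ * (𝓕 U : L2 (d + 1)) ξ) ∧
    (W : Euc (d + 1) → ℂ) =ᵐ[volume] nrmPowMul a φ

theorem IsPow.add {a : ℝ} {U V : L2 (d + 1)} {φ θ : 𝓢(Euc (d + 1), ℂ)} (hU : IsPow a U φ)
    (hV : IsPow a V θ) : IsPow a (U + V) (φ + θ) := by
  obtain ⟨W, h1, h2⟩ := hU
  obtain ⟨X, h3, h4⟩ := hV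
  refine ⟨W + X, ?_, ?_⟩
  · filter_upwards [fourier_add_ae W X, fourier_add_ae U V, h1, h3] with ξ e1 e2 e3 e4
    rw [e1, e2, e3, e4, mul_add]
  · filter_upwards [Lp.coeFn_add W X, h2, h4] with x e1 e2 e3
    rw [e1, Pi.add_apply, e2, e3]
    simp only [nrmPowMul, add_apply]
    split_ifs
    · rw [mul_add]
    · rw [add_zero]

theorem IsPow.smul {a : ℝ} {U : L2 (d + 1)} {φ : 𝓢(Euc (d + 1), ℂ)} (c : ℂ) (hU : IsPow a U φ) :
    IsPow a (c • U) (c • φ) := by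
  obtain ⟨W, h1, h2⟩ := hU
  refine ⟨c • W, ?_, ?_⟩
  · filter_upwards [fourier_smul_ae c W, fourier_smul_ae c U, h1] with ξ e1 e2 e3
    rw [e1, e2, e3]
    ring
  · filter_upwards [Lp.coeFn_smul c W, h2] with x e1 e2
    rw [e1, Pi.smul_apply, e2]
    simp only [nrmPowMul, smul_apply, smul_eq_mul]
    split_ifs
    · ring
    · rw [mul_zero]

theorem nrmPowMul_poisson_ae (a : ℝ) (k : ℕ) (f : 𝓢(Euc d, ℂ)) :
    nrmPowMul (a + k) (poisson (f.toLp 2)) =ᵐ[volume]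
      nrmPowMul a ((nrmMul d)^[k] (extendSchwartz f)) := by
  filter_upwards [extendSchwartz_ae f] with x hx
  simp only [nrmPowMul]
  split_ifs with h
  · rw [nrmMul_iterate_apply, hx h, Real.rpow_add h, Real.rpow_natCast]
    push_cast
    ring
  · rfl

theorem cut_toLp_iterate_nrmMul (k : ℕ) (f : 𝓢(Euc d, ℂ)) :
    cut (((nrmMul d)^[k] (extendSchwartz f)).toLp 2) =
      powPoisson (Nat.cast_nonneg k) (f.toLp 2) := by
  refine Lp.ext ?_
  have h := nrmPowMul_poisson_ae 0 k f
  rw [zero_add] at h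
  filter_upwards [cut_ae (((nrmMul d)^[k] (extendSchwartz f)).toLp 2), h,
    SchwartzMap.coeFn_toLp ((nrmMul d)^[k] (extendSchwartz f)) 2,
    powPoisson_ae (Nat.cast_nonneg k) (f.toLp 2)] with x h1 h2 h3 h4
  rw [h1, h4, h2]
  by_cases hx : 0 < nrm x
  · rw [Set.indicator_of_mem (show x ∈ openHalf d from hx), h3, nrmPowMul, if_pos hx]
    simp
  · rw [Set.indicator_of_notMem (show x ∉ openHalf d from hx), nrmPowMul, if_neg hx]

/-- The constant `Γ(a + b + 1) / Γ(b + 1)` that `Ξ_+^a` produces on `x_n^{a+b} K₀ψ`. -/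
def gammaQuot (a b : ℝ) : ℂ := (Real.Gamma (a + b + 1) / Real.Gamma (b + 1) : ℝ)

theorem gammaQuot_mul (a : ℝ) {b : ℝ} (hb : 0 ≤ b) :
    gammaQuot a b * Real.Gamma (b + 1) = Real.Gamma (a + b + 1) := by
  have hG : Real.Gamma (b + 1) ≠ 0 := (Real.Gamma_pos_of_pos (by positivity)).ne'
  rw [gammaQuot, ← Complex.ofReal_mul, div_mul_cancel₀ _ hG]

theorem gammaQuot_ne_zero {a b : ℝ} (ha : 0 < a) (hb : 0 ≤ b) : gammaQuot a b ≠ 0 := by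
  rw [gammaQuot, Complex.ofReal_ne_zero]
  exact (div_pos (Real.Gamma_pos_of_pos (by positivity)) (Real.Gamma_pos_of_pos (by positivity))).ne'

/-- `Ξ_+^{-a}` maps `Γ(a + b + 1) / Γ(b + 1) x_n^b K₀ψ` to `x_n^{a+b} K₀ψ`. -/
theorem fourier_powPoisson_add {a b : ℝ} (hb : 0 ≤ b) (hab : 0 ≤ a + b) (ψ : L2 d) :
    ((𝓕 (powPoisson hab ψ) : L2 (d + 1)) : Euc (d + 1) → ℂ) =ᵐ[volume]
      fun ξ => xiSymbol (-a) ξ * (𝓕 (gammaQuot a b • powPoisson hb ψ) : L2 (d + 1)) ξ := by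
  filter_upwards [fourier_powPoisson hab ψ, fourier_powPoisson hb ψ,
    fourier_smul_ae (gammaQuot a b) (powPoisson hb ψ)] with ξ h1 h2 h3
  rw [h1, h3, h2, show -(a + b + 1) = -a + -(b + 1) by ring, xiSymbol_add, ← gammaQuot_mul a hb]
  ring

theorem isPow_powPoisson {a : ℝ} (ha0 : 0 < a) (k : ℕ) (f : 𝓢(Euc d, ℂ)) {ψ : L2 d}
    (hψ : ψ = f.toLp 2) (hk : (0 : ℝ) ≤ k) :
    IsPow a (gammaQuot a k • powPoisson hk ψ) ((nrmMul d)^[k] (extendSchwartz f)) := by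
  have hab : 0 ≤ a + (k : ℝ) := add_nonneg ha0.le hk
  have h1 := nrmPowMul_poisson_ae a k f
  rw [← hψ] at h1
  exact ⟨_, fourier_powPoisson_add hk hab ψ, (powPoisson_ae hab ψ).trans h1⟩

/-- `F ∈ H^r` satisfies `Ξ_+^{-a} e⁺ r⁺ F = x_n^a φ`, and its trace is `Γ(a+1) φ(·, 0)`. -/
def IsLift (a r : ℝ) (F : L2 (d + 1)) (φ : 𝓢(Euc (d + 1), ℂ)) : Prop :=
  hNorm r F < ∞ ∧ IsPow a (cut F) φ ∧ fiberInt (𝓕 F : L2 (d + 1)) =ᵐ[volume]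
    fun η => (Real.Gamma (a + 1) : ℂ) * (𝓕 (sliceTang 0 φ) : 𝓢(Euc d, ℂ)) η

theorem IsLift.add {a r : ℝ} (hr : 1 / 2 < r) {F G : L2 (d + 1)} {φ θ : 𝓢(Euc (d + 1), ℂ)}
    (hF : IsLift a r F φ) (hG : IsLift a r G θ) : IsLift a r (F + G) (φ + θ) := by
  refine ⟨(hNorm_add_le _ _ _).trans_lt (ENNReal.add_lt_top.2 ⟨hF.1, hG.1⟩), ?_, ?_⟩
  · rw [cut_add]
    exact hF.2.1.add hG.2.1
  · filter_upwards [fiberInt_fourier_add hr hF.1 hG.1, hF.2.2, hG.2.2] with η h1 h2 h3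
    rw [h1, h2, h3, map_add, FourierAdd.fourier_add, add_apply, mul_add]

theorem exists_isLift_iterate_nrmMul {a : ℝ} (ha0 : 0 < a) (r : ℝ) (k : ℕ) (f : 𝓢(Euc d, ℂ)) :
    ∃ F : L2 (d + 1), IsLift a r F ((nrmMul d)^[k] (extendSchwartz f)) := by
  refine ⟨gammaQuot a k • (((nrmMul d)^[k] (extendSchwartz f)).toLp 2 : L2 (d + 1)), ?_, ?_, ?_⟩
  · rw [hNorm_smul]
    exact ENNReal.mul_lt_top enorm_lt_top (hNorm_toLp_lt_top _ _)
  · rw [cut_smul, cut_toLp_iterate_nrmMul]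
    exact isPow_powPoisson ha0 k f rfl _
  · filter_upwards [fiberInt_fourier_smul (gammaQuot a k)
      (((nrmMul d)^[k] (extendSchwartz f)).toLp 2 : L2 (d + 1)),
      fiberInt_congr (fourier_toLp_ae ((nrmMul d)^[k] (extendSchwartz f)))] with η h1 h2
    rw [h1, h2, fiberInt_fourier_schwartz]
    rcases k with _ | k
    · simp [gammaQuot]
    · have h0 : sliceTang 0 ((nrmMul d)^[k + 1] (extendSchwartz f)) = 0 := by
        ext y
        rw [sliceTang_apply, nrmMul_iterate_apply, nrm_join]
        simp
      rw [h0, FourierTransform.fourier_zero]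
      simp

theorem exists_fourier_eq_xiSymbol_mul {a r : ℝ} (ha : 0 ≤ a) (hr : 0 ≤ r) {W : L2 (d + 1)}
    (hW : hNorm (r + a) W < ∞) : ∃ F : L2 (d + 1), hNorm r F < ∞ ∧
      ((𝓕 F : L2 (d + 1)) : Euc (d + 1) → ℂ) =ᵐ[volume]
        fun ξ => xiSymbol a ξ * (𝓕 W : L2 (d + 1)) ξ := by
  have hg : MemLp (fun ξ => (wt r ξ : ℂ) * (xiSymbol a ξ * (𝓕 W : L2 (d + 1)) ξ)) 2 volume := by
    refine (memLp_of_hNorm hW).of_le_mul (c := xiConst a)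
      ((wt_temperate r).1.continuous.aestronglyMeasurable.mul
        ((continuous_xiSymbol a).aestronglyMeasurable.mul (Lp.aestronglyMeasurable _)))
      (ae_of_all _ fun ξ => ?_)
    simp only [norm_mul, Complex.norm_real, Real.norm_of_nonneg (wt_pos _ _).le]
    rw [wt_add]
    calc wt r ξ * (‖xiSymbol a ξ‖ * ‖(𝓕 W : L2 (d + 1)) ξ‖)
        ≤ wt r ξ * (xiConst a * wt a ξ * ‖(𝓕 W : L2 (d + 1)) ξ‖) := by
          have := (wt_pos r ξ).le
          gcongr
          exact norm_xiSymbol_le ha ξ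
      _ = _ := by ring
  have hg2 := memLp_of_wt_mul hr hg
  have hF := fourier_ofHat hg2
  refine ⟨ofHat hg2, lt_of_le_of_lt (le_of_eq (eLpNorm_congr_ae ?_)) hg.2, hF⟩
  filter_upwards [hF] with ξ h
  rw [h]

/-- Functions of `H^{r+a}` supported in the upper half-space are `Ξ_+^{-a} e⁺ r⁺ F` with `F ∈ H^r` of
trace zero. -/
theorem IsUpper.exists_lift {a r : ℝ} (ha0 : 0 ≤ a) (ha1 : a < 1) (hr : 1 / 2 < r) {W : L2 (d + 1)}
    (hup : IsUpper W) (hW : hNorm (r + a) W < ∞) : ∃ F : L2 (d + 1), hNorm r F < ∞ ∧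
      (((𝓕 W : L2 (d + 1)) : Euc (d + 1) → ℂ) =ᵐ[volume]
        fun ξ => xiSymbol (-a) ξ * (𝓕 (cut F) : L2 (d + 1)) ξ) ∧
      fiberInt (𝓕 F : L2 (d + 1)) =ᵐ[volume] 0 := by
  obtain ⟨F, hFr, hF⟩ := exists_fourier_eq_xiSymbol_mul ha0 (by linarith) hW
  have hFu : IsUpper F := isUpper_of_fourier_eq_xiSymbol ha1 hup hF
  refine ⟨F, hFr, ?_, fiberInt_fourier_ae_eq_zero hr hFr (Or.inl hFu)⟩
  rw [cut_eq_self hFu]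
  filter_upwards [hF] with ξ h
  rw [h, ← mul_assoc, xiSymbol_neg_mul, one_mul]

theorem exists_isLift_of_vanishesToOrder {a r : ℝ} (ha0 : 0 < a) (ha1 : a < 1) (hr : 1 / 2 < r)
    {M N : ℕ} {R : 𝓢(Euc (d + 1), ℂ)} (hR : VanishesToOrder N R) (hN : 1 ≤ N) (hM : r + a ≤ M)
    (hMN : M + 1 < a + N) : ∃ F : L2 (d + 1), IsLift a r F R := by
  obtain ⟨W, hW, hWM⟩ := hR.exists_hNorm_lt_top M hMN
  have hup : IsUpper W := by
    filter_upwards [hW] with x hx hx0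
    rw [hx, nrmPowMul, if_neg hx0.not_gt]
  obtain ⟨F, hF, hFW, htr⟩ := hup.exists_lift ha0.le ha1 hr ((hNorm_mono hM W).trans_lt hWM)
  refine ⟨F, hF, ⟨W, hFW, hW⟩, ?_⟩
  filter_upwards [htr] with η h
  have h0 : sliceTang 0 R = 0 := by
    ext y
    exact hR 0 (by omega) y
  rw [h, h0, FourierTransform.fourier_zero]
  simp

/-- Every `x_n^a φ` is `Ξ_+^{-a} e⁺ r⁺ F` with `F` of any prescribed regularity. The Taylor terms
`x_n^k f_k` of `φ` at the boundary can be replaced by `x_n^k E f_k`, for which `F` is explicit by the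
formula for the Fourier transform of `x_n^{a+k} K₀ f_k`; the remainder, multiplied by `x_n^a`, is as
regular as needed across the boundary. -/
theorem exists_isLift {a r : ℝ} (ha0 : 0 < a) (ha1 : a < 1) (hr : 1 / 2 < r)
    (φ : 𝓢(Euc (d + 1), ℂ)) : ∃ F : L2 (d + 1), IsLift a r F φ := by
  obtain ⟨M, hM⟩ := exists_nat_ge (r + a)
  obtain ⟨f, R, hR, hφ⟩ := exists_taylor φ (M + 1)
  have key : ∀ N : ℕ, ∃ F : L2 (d + 1), IsLift a r F
      (∑ k ∈ Finset.range N, (nrmMul d)^[k] (extendSchwartz (f k)) + R) := by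
    intro N
    induction N with
    | zero =>
      obtain ⟨F, hF⟩ := exists_isLift_of_vanishesToOrder ha0 ha1 hr (M := M) hR (by omega) hM
        (by push_cast; linarith)
      exact ⟨F, by simpa using hF⟩
    | succ N ih =>
      obtain ⟨F, hF⟩ := ih
      obtain ⟨G, hG⟩ := exists_isLift_iterate_nrmMul ha0 r N (f N)
      refine ⟨F + G, ?_⟩
      rw [Finset.sum_range_succ, add_right_comm]
      exact hF.add hr hG
  obtain ⟨F, hF⟩ := key (M + 1)
  exact ⟨F, hφ ▸ hF⟩

/-! ### The transmission space and its trace in terms of square integrable functions -/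

/-- `Ξ_+^{-a}` on `L²`, for `a ≥ 0`. -/
def invXi {a : ℝ} (ha : 0 ≤ a) (U : L2 (d + 1)) : L2 (d + 1) :=
  ofHat (memLp_bdd_mul (continuous_xiSymbol (-a)) (norm_xiSymbol_nonpos_le_one (neg_nonpos.2 ha))
    (Lp.memLp (𝓕 U : L2 (d + 1))))

theorem fourier_invXi {a : ℝ} (ha : 0 ≤ a) (U : L2 (d + 1)) :
    ((𝓕 (invXi ha U) : L2 (d + 1)) : Euc (d + 1) → ℂ) =ᵐ[volume]
      fun ξ => xiSymbol (-a) ξ * (𝓕 U : L2 (d + 1)) ξ := fourier_ofHat _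

theorem Xi_coe_eq_iff (t : ℝ) (U V : L2 (d + 1)) : Xi t (U : 𝓢'(Euc (d + 1), ℂ)) = V ↔
    ((𝓕 V : L2 (d + 1)) : Euc (d + 1) → ℂ) =ᵐ[volume]
      fun ξ => xiSymbol t ξ * (𝓕 U : L2 (d + 1)) ξ :=
  fourierMultiplier_coe_eq_iff (xiSymbol_temperate t) U V

theorem Xi_coe_injective {t : ℝ} (ht : 0 ≤ t) {U V : L2 (d + 1)}
    (h : Xi (-t) (U : 𝓢'(Euc (d + 1), ℂ)) = Xi (-t) (V : 𝓢'(Euc (d + 1), ℂ))) : U = V := by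
  rw [(Xi_coe_eq_iff (-t) V _).2 (fourier_invXi ht V), Xi_coe_eq_iff] at h
  refine eq_of_fourier_ae_eq ?_
  filter_upwards [h, fourier_invXi ht V] with ξ h1 h2
  rw [h2] at h1
  exact (mul_left_cancel₀ (xiSymbol_ne_zero _ _) h1).symm

theorem isCutoff_coe_iff {r : ℝ} (hr : 0 ≤ r) (F : L2 (d + 1)) (g : 𝓢'(Euc (d + 1), ℂ)) :
    IsCutoff r (F : 𝓢'(Euc (d + 1), ℂ)) g ↔ g = cut F := by
  rw [IsCutoff, min_eq_right hr]
  constructor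
  · rintro ⟨⟨hg, hs⟩, hv⟩
    obtain ⟨G, rfl, -⟩ := exists_coe_of_mem_sobolev le_rfl hg
    rw [dsupport_coe_subset_iff] at hs
    rw [← coe_sub, isVanishingOn_openHalf_iff] at hv
    rw [eq_cut_of_isUpper_of_isLower_sub hs hv]
  · rintro rfl
    refine ⟨⟨(coe_mem_sobolev_iff 0 _).2 ?_, (dsupport_coe_subset_iff _).2 (isUpper_cut F)⟩, ?_⟩
    · rw [hNorm_zero_order]
      exact enorm_lt_top
    · rw [← coe_sub, isVanishingOn_openHalf_iff]
      have := (isLower_sub_cut F).smul (-1)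
      simpa using this

theorem mem_transmission_iff {a t : ℝ} (ht : 0 ≤ t - a) (u : 𝓢'(Euc (d + 1), ℂ)) :
    u ∈ transmission d a t ↔ ∃ F : L2 (d + 1), hNorm (t - a) F < ∞ ∧ u = Xi (-a) (cut F) := by
  constructor
  · rintro ⟨F, g, hF, hg, rfl⟩
    obtain ⟨F, rfl, hF'⟩ := exists_coe_of_mem_sobolev ht hF
    rw [isCutoff_coe_iff ht] at hg
    exact ⟨F, hF', hg ▸ rfl⟩
  · rintro ⟨F, hF, rfl⟩
    exact ⟨F, cut F, (coe_mem_sobolev_iff _ _).2 hF, (isCutoff_coe_iff ht F _).2 rfl, rfl⟩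

theorem transmissionENorm_le {a t : ℝ} (ht : 0 ≤ t - a) (F : L2 (d + 1)) :
    transmissionENorm a t (Xi (-a) (cut F : 𝓢'(Euc (d + 1), ℂ))) ≤ hNorm (t - a) F := by
  rw [← sobolevENorm_coe]
  exact iInf₂_le_of_le (F : 𝓢'(Euc (d + 1), ℂ)) (cut F : 𝓢'(Euc (d + 1), ℂ))
    (iInf_le_of_le ⟨(isCutoff_coe_iff ht F _).2 rfl, rfl⟩ le_rfl)

theorem le_transmissionENorm {a t : ℝ} (ht : 0 ≤ t - a) {u : 𝓢'(Euc (d + 1), ℂ)} {c : ℝ≥0∞}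
    (h : ∀ F : L2 (d + 1), hNorm (t - a) F < ∞ → u = Xi (-a) (cut F) → c ≤ hNorm (t - a) F) :
    c ≤ transmissionENorm a t u := by
  refine le_iInf₂ fun F g => le_iInf ?_
  rintro ⟨hg, hu⟩
  rcases lt_or_ge (sobolevENorm (t - a) F) ∞ with hF | hF
  · obtain ⟨F, rfl, hF'⟩ := exists_coe_of_sobolevENorm ht hF
    rw [isCutoff_coe_iff ht] at hg
    rw [sobolevENorm_coe]
    exact h F hF' (hg ▸ hu)
  · exact le_top.trans hF

/-- `ψ` is the weighted boundary value `γ₀(u / x_n^a)` of `u = Ξ_+^{-a} e⁺ r⁺ F`: it equals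
`Γ(a+1)⁻¹ γ₀ F`, and `γ₀ F` has the Fourier transform `∫ F̂(ξ', ξ_n) dξ_n`. -/
def IsTraceOf (a r : ℝ) (u : 𝓢'(Euc (d + 1), ℂ)) (ψ : L2 d) : Prop :=
  ∃ F : L2 (d + 1), hNorm r F < ∞ ∧ u = Xi (-a) (cut F) ∧
    fiberInt (𝓕 F : L2 (d + 1)) =ᵐ[volume] fun η => (Real.Gamma (a + 1) : ℂ) * (𝓕 ψ : L2 d) η

/-- The trace does not depend on the extension `F` from the half-space: the difference of two
extensions vanishes in the upper half-space, hence has trace zero. -/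
theorem fiberInt_fourier_ae_eq_of_cut_eq {r : ℝ} (hr : 1 / 2 < r) {F G : L2 (d + 1)}
    (hF : hNorm r F < ∞) (hG : hNorm r G < ∞) (h : cut F = cut G) :
    fiberInt (𝓕 F : L2 (d + 1)) =ᵐ[volume] fiberInt (𝓕 G : L2 (d + 1)) := by
  have hl : IsLower (F - G) := by
    have := isLower_sub_cut (F - G)
    rwa [cut_sub, h, sub_self, sub_zero] at this
  filter_upwards [fiberInt_fourier_ae_eq_zero hr ((hNorm_sub_le _ _ _).trans_lt
    (ENNReal.add_lt_top.2 ⟨hF, hG⟩)) (Or.inr hl), fiberInt_fourier_sub hr hF hG] with η h1 h2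
  rw [h1] at h2
  exact (sub_eq_zero.1 h2.symm)

theorem IsTraceOf.fiberInt_eq {a r : ℝ} (ha : 0 ≤ a) (hr : 1 / 2 < r) {u : 𝓢'(Euc (d + 1), ℂ)}
    {ψ : L2 d} (h : IsTraceOf a r u ψ) {G : L2 (d + 1)} (hG : hNorm r G < ∞)
    (hu : u = Xi (-a) (cut G)) : fiberInt (𝓕 G : L2 (d + 1)) =ᵐ[volume]
      fun η => (Real.Gamma (a + 1) : ℂ) * (𝓕 ψ : L2 d) η := by
  obtain ⟨F, hF, huF, hψ⟩ := h
  exact (fiberInt_fourier_ae_eq_of_cut_eq hr hG hF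
    (Xi_coe_injective ha (hu.symm.trans huF))).trans hψ

theorem IsTraceOf.unique {a r : ℝ} (ha : 0 ≤ a) (hr : 1 / 2 < r) {u : 𝓢'(Euc (d + 1), ℂ)}
    {ψ θ : L2 d} (h : IsTraceOf a r u ψ) (h' : IsTraceOf a r u θ) : ψ = θ := by
  obtain ⟨G, hG, hu, hθ⟩ := h'
  refine eq_of_fourier_ae_eq ?_
  filter_upwards [h.fiberInt_eq ha hr hG hu, hθ] with η h1 h2
  exact mul_left_cancel₀ (gamma_ne_zero ha) (h1.symm.trans h2)

theorem exists_isTraceOf {a t : ℝ} (ha : 0 ≤ a) (ht : 1 / 2 < t - a) {u : 𝓢'(Euc (d + 1), ℂ)}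
    (hu : u ∈ transmission d a t) : ∃ ψ, IsTraceOf a (t - a) u ψ := by
  obtain ⟨F, hF, hu⟩ := (mem_transmission_iff (by linarith) u).1 hu
  have hm := memLp_of_wt_mul (by linarith)
    (memLp_fiberInt ht (Lp.aestronglyMeasurable (𝓕 F : L2 (d + 1))) (memLp_of_hNorm hF))
  refine ⟨(Real.Gamma (a + 1) : ℂ)⁻¹ • ofHat hm, F, hF, hu, ?_⟩
  filter_upwards [fourier_smul_ae (Real.Gamma (a + 1) : ℂ)⁻¹ (ofHat hm), fourier_ofHat hm]
    with η h1 h2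
  rw [h1, h2, mul_inv_cancel_left₀ (gamma_ne_zero ha)]

theorem IsTraceOf.hNorm_le {a t : ℝ} (ha : 0 ≤ a) (ht : 1 / 2 < t - a) {u : 𝓢'(Euc (d + 1), ℂ)}
    {ψ : L2 d} (h : IsTraceOf a (t - a) u ψ) :
    hNorm (t - a - 1 / 2) ψ ≤ ‖(Real.Gamma (a + 1) : ℂ)⁻¹‖ₑ * fiberConst (t - a) ^ (1 / 2 : ℝ) *
      transmissionENorm a t u := by
  have hc : (‖(Real.Gamma (a + 1) : ℂ)⁻¹‖ₑ * fiberConst (t - a) ^ (1 / 2 : ℝ)) ≠ ∞ :=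
    ENNReal.mul_ne_top enorm_ne_top
      (ENNReal.rpow_lt_top_of_nonneg (by norm_num) (fiberConst_lt_top ht).ne).ne
  rw [mul_comm, ← ENNReal.div_le_iff_le_mul (Or.inr ?_) (Or.inl hc)]
  · refine le_transmissionENorm (by linarith) fun F hF hu => ?_
    refine ENNReal.div_le_of_le_mul' ?_
    rw [mul_assoc]
    refine le_trans (le_of_eq ?_) (mul_le_mul_right (eLpNorm_fiberInt_le (r := t - a)
      (Lp.aestronglyMeasurable (𝓕 F : L2 (d + 1)))) _)
    rw [← eLpNorm_const_smul]
    refine eLpNorm_congr_ae ?_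
    filter_upwards [h.fiberInt_eq ha ht hF hu] with η hη
    rw [Pi.smul_apply, hη, smul_eq_mul, mul_left_comm (wt _ _ : ℂ),
      inv_mul_cancel_left₀ (gamma_ne_zero ha)]
  · obtain ⟨F, hF, rfl, -⟩ := h
    exact ((transmissionENorm_le (by linarith) F).trans_lt hF).ne

theorem IsTraceOf.add {a r : ℝ} (hr : 1 / 2 < r) {u v : 𝓢'(Euc (d + 1), ℂ)} {ψ θ : L2 d}
    (hu : IsTraceOf a r u ψ) (hv : IsTraceOf a r v θ) : IsTraceOf a r (u + v) (ψ + θ) := by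
  obtain ⟨F, hF, rfl, hψ⟩ := hu
  obtain ⟨G, hG, rfl, hθ⟩ := hv
  refine ⟨F + G, (hNorm_add_le _ _ _).trans_lt (ENNReal.add_lt_top.2 ⟨hF, hG⟩), ?_, ?_⟩
  · rw [cut_add, coe_add, map_add]
  · filter_upwards [fiberInt_fourier_add hr hF hG, hψ, hθ, fourier_add_ae ψ θ] with η h1 h2 h3 h4
    rw [h1, h2, h3, h4, mul_add]

theorem IsTraceOf.smul {a r : ℝ} {u : 𝓢'(Euc (d + 1), ℂ)} {ψ : L2 d} (c : ℂ)
    (hu : IsTraceOf a r u ψ) : IsTraceOf a r (c • u) (c • ψ) := by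
  obtain ⟨F, hF, rfl, hψ⟩ := hu
  refine ⟨c • F, ?_, ?_, ?_⟩
  · rw [hNorm_smul]
    exact ENNReal.mul_lt_top enorm_lt_top hF
  · rw [cut_smul, coe_smul, map_smul]
  · filter_upwards [fiberInt_fourier_smul c F, hψ, fourier_smul_ae c ψ] with η h1 h2 h3
    rw [h1, h2, h3]
    ring

theorem IsTraceOf.mem_sobolev {a t : ℝ} (ha : 0 ≤ a) (ht : 1 / 2 < t - a)
    {u : 𝓢'(Euc (d + 1), ℂ)} {ψ : L2 d} (h : IsTraceOf a (t - a) u ψ) :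
    (ψ : 𝓢'(Euc d, ℂ)) ∈ sobolev d (t - a - 1 / 2) := by
  refine (coe_mem_sobolev_iff _ _).2 ((h.hNorm_le ha ht).trans_lt (ENNReal.mul_lt_top
    (ENNReal.mul_lt_top enorm_lt_top
      (ENNReal.rpow_lt_top_of_nonneg (by norm_num) (fiberConst_lt_top ht).ne)) ?_))
  obtain ⟨F, hF, rfl, -⟩ := h
  exact (transmissionENorm_le (by linarith) F).trans_lt hF

/-- A linear trace map assembled from the relation `IsTraceOf`. -/
theorem exists_linearMap_isTraceOf {a t : ℝ} (ha : 0 ≤ a) (ht : 1 / 2 < t - a) :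
    ∃ γ : transmission d a t →ₗ[ℂ] sobolev d (t - a - 1 / 2),
      ∀ u : transmission d a t, ∃ ψ : L2 d, IsTraceOf a (t - a) u ψ ∧ (γ u : 𝓢'(Euc d, ℂ)) = ψ := by
  choose ψ hψ using fun u : transmission d a t => exists_isTraceOf ha ht u.2
  refine ⟨{ toFun := fun u => ⟨ψ u, (hψ u).mem_sobolev ha ht⟩, map_add' := fun u v => ?_,
            map_smul' := fun c u => ?_ }, fun u => ⟨ψ u, hψ u, rfl⟩⟩
  · refine Subtype.ext ?_
    have : ψ (u + v) = ψ u + ψ v := (hψ (u + v)).unique ha ht ((hψ u).add ht (hψ v))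
    change (ψ (u + v) : 𝓢'(Euc d, ℂ)) = ψ u + ψ v
    rw [this, coe_add]
  · refine Subtype.ext ?_
    have : ψ (c • u) = c • ψ u := (hψ (c • u)).unique ha ht ((hψ u).smul c)
    change (ψ (c • u) : 𝓢'(Euc d, ℂ)) = c • (ψ u : 𝓢'(Euc d, ℂ))
    rw [this, coe_smul]

/-- On `x_n^a 𝒮`, the trace is `x_n^a φ ↦ φ(·, 0)`. -/
theorem IsLift.isTraceOf {a r : ℝ} {F : L2 (d + 1)} {φ : 𝓢(Euc (d + 1), ℂ)} (h : IsLift a r F φ) :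
    ∃ p : 𝓢'(Euc (d + 1), ℂ), p = Xi (-a) (cut F) ∧ IsRepBy p (nrmPowMul a φ) ∧
      IsTraceOf a r p ((sliceTang 0 φ).toLp 2) := by
  obtain ⟨hF, ⟨W, hW, hWφ⟩, htr⟩ := h
  have hp : Xi (-a) (cut F : 𝓢'(Euc (d + 1), ℂ)) = W := (Xi_coe_eq_iff _ _ _).2 hW
  refine ⟨W, hp.symm, isRepBy_coe_of_ae_eq hWφ, F, hF, hp.symm, ?_⟩
  filter_upwards [htr, fourier_toLp_ae (sliceTang 0 φ)] with η h1 h2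
  rw [h1, h2]

theorem exists_isTrace {a t : ℝ} (ha0 : 0 < a) (ha1 : a < 1) (ht : 1 / 2 < t - a) :
    ∃ γ : transmission d a t →ₗ[ℂ] sobolev d (t - a - 1 / 2), IsTrace a t γ ∧
      ∀ u : transmission d a t, ∃ ψ : L2 d,
        IsTraceOf a (t - a) u ψ ∧ (γ u : 𝓢'(Euc d, ℂ)) = ψ := by
  obtain ⟨γ, hγ⟩ := exists_linearMap_isTraceOf (d := d) ha0.le ht
  refine ⟨γ, ⟨⟨(‖(Real.Gamma (a + 1) : ℂ)⁻¹‖ₑ * fiberConst (t - a) ^ (1 / 2 : ℝ)).toNNReal,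
    fun u => ?_⟩, fun φ u hu => ?_⟩, hγ⟩
  · obtain ⟨ψ, hψ, e⟩ := hγ u
    rw [e, sobolevENorm_coe, ENNReal.coe_toNNReal]
    · exact hψ.hNorm_le ha0.le ht
    · exact ENNReal.mul_ne_top enorm_ne_top
        (ENNReal.rpow_lt_top_of_nonneg (by norm_num) (fiberConst_lt_top ht).ne).ne
  · obtain ⟨ψ, hψ, e⟩ := hγ u
    obtain ⟨F, hF⟩ := exists_isLift ha0 ha1 ht φ
    obtain ⟨p, -, hp, htr⟩ := hF.isTraceOf
    rw [← hu.unique hp] at htr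
    rw [e, hψ.unique ha0.le ht htr]
    refine isRepBy_coe_of_ae_eq ?_
    filter_upwards [SchwartzMap.coeFn_toLp (sliceTang 0 φ) 2] with y hy
    rw [hy, sliceTang_apply, bdry_eq_join]

/-! ### Density of `x_n^a 𝒮` -/

theorem IsPow.zero (a : ℝ) : IsPow a (0 : L2 (d + 1)) 0 := by
  refine ⟨0, ?_, ?_⟩
  · filter_upwards [fourier_smul_ae 0 (0 : L2 (d + 1))] with ξ h
    rw [zero_smul, zero_mul] at h
    rw [h, mul_zero]
  · filter_upwards [Lp.coeFn_zero ℂ 2 (volume : Measure (Euc (d + 1)))] with x h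
    rw [h]
    simp [nrmPowMul]

theorem cut_eq_zero {U : L2 (d + 1)} (hU : IsLower U) : cut U = 0 := by
  refine (eq_cut_of_isUpper_of_isLower_sub ?_ ?_).symm
  · filter_upwards [Lp.coeFn_zero ℂ 2 (volume : Measure (Euc (d + 1)))] with x h _
    rw [h, Pi.zero_apply]
  · have := hU.smul (-1)
    simpa using this

theorem xiSymbol_neg_succ (n : ℕ) (ξ : Euc (d + 1)) :
    xiSymbol (-((n : ℝ) + 1)) ξ = (xiBase ξ)⁻¹ ^ (n + 1) := by
  have := xiSymbol_neg_nat (n + 1) ξ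
  push_cast at this
  exact this

/-- `f(ξ') (⟨ξ'⟩ - iξ_n)^{-m} (⟨ξ'⟩ + iξ_n)^{-k}`. -/
def rationalSymbol (f : 𝓢(Euc d, ℂ)) (m k : ℕ) (ξ : Euc (d + 1)) : ℂ :=
  f (tang ξ) * ((starRingEnd ℂ) (xiBase ξ)⁻¹ ^ m * (xiBase ξ)⁻¹ ^ k)

theorem memLp_rationalSymbol (f : 𝓢(Euc d, ℂ)) {m k n : ℕ} (h : m + k = n + 1) :
    MemLp (rationalSymbol f m k) 2 volume := by
  have h1 := memLp_mul_xiSymbol (Nat.cast_nonneg n) (f.memLp 2)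
  have hc : Continuous fun ξ : Euc (d + 1) => (xiBase ξ)⁻¹ := by
    have e : (fun ξ : Euc (d + 1) => (xiBase ξ)⁻¹) = xiSymbol (-(1 : ℕ)) := by
      funext ξ
      rw [xiSymbol_neg_nat, pow_one]
    rw [e]
    exact continuous_xiSymbol _
  refine h1.mono ?_ (ae_of_all _ fun ξ => le_of_eq ?_)
  · exact ((f.continuous.comp continuous_tang).mul
      (((Complex.continuous_conj.comp hc).pow m).mul (hc.pow k))).aestronglyMeasurable
  · rw [rationalSymbol, xiSymbol_neg_succ, ← h]
    simp only [norm_mul, norm_pow, RCLike.norm_conj]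
    rw [← pow_add]

theorem rationalSymbol_succ_succ (f : 𝓢(Euc d, ℂ)) (m k : ℕ) (ξ : Euc (d + 1)) :
    rationalSymbol f (m + 1) (k + 1) ξ =
      rationalSymbol ((1 / 2 : ℂ) • sigMul (-1) f) m (k + 1) ξ +
        rationalSymbol ((1 / 2 : ℂ) • sigMul (-1) f) (m + 1) k ξ := by
  have h := inv_xiBase_mul_conj ξ
  simp only [rationalSymbol, smul_apply, sigMul_apply, smul_eq_mul, Real.rpow_neg_one]
  push_cast at h ⊢
  rw [mul_inv] at h
  calc f (tang ξ) * ((starRingEnd ℂ) (xiBase ξ)⁻¹ ^ (m + 1) * (xiBase ξ)⁻¹ ^ (k + 1))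
      = f (tang ξ) * ((starRingEnd ℂ) (xiBase ξ)⁻¹ ^ m * (xiBase ξ)⁻¹ ^ k) *
          ((xiBase ξ)⁻¹ * (starRingEnd ℂ) (xiBase ξ)⁻¹) := by ring
    _ = _ := by
      rw [h]
      ring

theorem isLower_of_rationalSymbol {f : 𝓢(Euc d, ℂ)} {n : ℕ} {F : L2 (d + 1)}
    (hF : ((𝓕 F : L2 (d + 1)) : Euc (d + 1) → ℂ) =ᵐ[volume] rationalSymbol f (n + 1) 0) :
    IsLower F := by
  refine isLower_of_fourier (Nat.cast_nonneg n) (f := f) ?_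
  filter_upwards [hF] with ξ h
  rw [h, xiSymbol_neg_succ, rationalSymbol, map_pow, pow_zero, mul_one]

theorem exists_isPow_of_rationalSymbol {a : ℝ} (ha0 : 0 < a) {f : 𝓢(Euc d, ℂ)} {n : ℕ}
    {F : L2 (d + 1)}
    (hF : ((𝓕 F : L2 (d + 1)) : Euc (d + 1) → ℂ) =ᵐ[volume] rationalSymbol f 0 (n + 1)) :
    ∃ φ, IsPow a (cut F) φ := by
  have hn : (0 : ℝ) ≤ n := Nat.cast_nonneg n
  have hf : ((𝓕 ((𝓕⁻ f : 𝓢(Euc d, ℂ)).toLp 2 : L2 d) : L2 d) : Euc d → ℂ) =ᵐ[volume] f := by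
    have := fourier_toLp_ae (𝓕⁻ f : 𝓢(Euc d, ℂ))
    rwa [FourierTransform.fourier_fourierInv_eq] at this
  obtain ⟨ψ, hψ⟩ : ∃ ψ : L2 d, ψ = (𝓕⁻ f : 𝓢(Euc d, ℂ)).toLp 2 := ⟨_, rfl⟩
  rw [← hψ] at hf
  have hP := isPow_powPoisson ha0 n _ hψ hn
  have hΓ := gamma_ne_zero hn
  have hq := gammaQuot_ne_zero ha0 hn
  have e : F = ((Real.Gamma (n + 1) : ℂ)⁻¹ * (gammaQuot a n)⁻¹) • gammaQuot a n •
      powPoisson hn ψ := by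
    rw [smul_smul, mul_assoc, inv_mul_cancel₀ hq, mul_one]
    refine eq_of_fourier_ae_eq ?_
    filter_upwards [hF, fourier_smul_ae (Real.Gamma (n + 1) : ℂ)⁻¹ (powPoisson hn ψ),
      fourier_powPoisson hn ψ, comp_tang_ae_eq hf] with ξ h1 h2 h3 h4
    rw [h1, h2, h3, h4, xiSymbol_neg_succ, rationalSymbol, pow_zero, one_mul, mul_assoc,
      inv_mul_cancel_left₀ hΓ]
  have hup : IsUpper F := by
    rw [e]
    exact ((isUpper_powPoisson hn ψ).smul _).smul _
  rw [cut_eq_self hup, e]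
  exact ⟨_, hP.smul _⟩

/-- If `F̂` is a rational symbol, then `Ξ_+^{-a} e⁺ r⁺ F` is `x_n^a` times a Schwartz function, by
partial fractions: powers of `(⟨ξ'⟩ - iξ_n)⁻¹` are cut off, and powers of `(⟨ξ'⟩ + iξ_n)⁻¹` yield
`x_n^k K₀f`. -/
theorem exists_isPow_cut_of_rationalSymbol {a : ℝ} (ha0 : 0 < a) (n : ℕ) :
    ∀ (m k : ℕ), m + k = n + 1 → ∀ (f : 𝓢(Euc d, ℂ)) (F : L2 (d + 1)),
      ((𝓕 F : L2 (d + 1)) : Euc (d + 1) → ℂ) =ᵐ[volume] rationalSymbol f m k →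
      ∃ φ, IsPow a (cut F) φ := by
  induction n with
  | zero =>
    intro m k hmk f F hF
    rcases Nat.eq_zero_or_pos k with rfl | hk
    · obtain rfl : m = 0 + 1 := by omega
      exact ⟨0, by rw [cut_eq_zero (isLower_of_rationalSymbol hF)]; exact IsPow.zero a⟩
    · obtain ⟨rfl, rfl⟩ : m = 0 ∧ k = 0 + 1 := by omega
      exact exists_isPow_of_rationalSymbol ha0 hF
  | succ n ih =>
    intro m k hmk f F hF
    rcases k with _ | k
    · obtain rfl : m = n + 1 + 1 := by omega
      exact ⟨0, by rw [cut_eq_zero (isLower_of_rationalSymbol hF)]; exact IsPow.zero a⟩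
    rcases m with _ | m
    · exact exists_isPow_of_rationalSymbol ha0 hF
    · have h1 := memLp_rationalSymbol ((1 / 2 : ℂ) • sigMul (-1) f) (m := m) (k := k + 1) (n := n)
        (by omega)
      have h2 := memLp_rationalSymbol ((1 / 2 : ℂ) • sigMul (-1) f) (m := m + 1) (k := k) (n := n)
        (by omega)
      obtain ⟨φ, hφ⟩ := ih m (k + 1) (by omega) _ _ (fourier_ofHat h1)
      obtain ⟨θ, hθ⟩ := ih (m + 1) k (by omega) _ _ (fourier_ofHat h2)
      have e : F = ofHat h1 + ofHat h2 := by
        refine eq_of_fourier_ae_eq ?_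
        filter_upwards [hF, fourier_add_ae (ofHat h1) (ofHat h2), fourier_ofHat h1,
          fourier_ofHat h2] with ξ g1 g2 g3 g4
        rw [g1, g2, g3, g4, rationalSymbol_succ_succ]
      rw [e, cut_add]
      exact ⟨_, hφ.add hθ⟩

/-- The functions `⟨ξ⟩^r F̂(ξ)` where `F ∈ H^r` and `Ξ_+^{-a} e⁺ r⁺ F ∈ x_n^a 𝒮`. -/
def weightedPow (d : ℕ) (a r : ℝ) : Submodule ℂ (L2 (d + 1)) where
  carrier := {V | ∃ F : L2 (d + 1), (∃ φ, IsPow a (cut F) φ) ∧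
    (V : Euc (d + 1) → ℂ) =ᵐ[volume] fun ξ => (wt r ξ : ℂ) * (𝓕 F : L2 (d + 1)) ξ}
  add_mem' := by
    rintro U V ⟨F, ⟨φ, hφ⟩, hU⟩ ⟨G, ⟨θ, hθ⟩, hV⟩
    refine ⟨F + G, ⟨φ + θ, by rw [cut_add]; exact hφ.add hθ⟩, ?_⟩
    filter_upwards [Lp.coeFn_add U V, fourier_add_ae F G, hU, hV] with ξ h1 h2 h3 h4
    rw [h1, Pi.add_apply, h2, h3, h4, mul_add]
  zero_mem' := by
    refine ⟨0, ⟨0, by rw [cut_eq_self (by simpa using (isUpper_cut (0 : L2 (d + 1))).smul 0)];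
                      exact IsPow.zero a⟩, ?_⟩
    filter_upwards [Lp.coeFn_zero ℂ 2 (volume : Measure (Euc (d + 1))),
      fourier_smul_ae 0 (0 : L2 (d + 1))] with ξ h1 h2
    rw [zero_smul, zero_mul] at h2
    rw [h1, h2, mul_zero, Pi.zero_apply]
  smul_mem' := by
    rintro c U ⟨F, ⟨φ, hφ⟩, hU⟩
    refine ⟨c • F, ⟨c • φ, by rw [cut_smul]; exact hφ.smul c⟩, ?_⟩
    filter_upwards [Lp.coeFn_smul c U, fourier_smul_ae c F, hU] with ξ h1 h2 h3
    rw [h1, Pi.smul_apply, h2, h3, smul_eq_mul]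
    ring

theorem norm_inv_xiBase_pow_le (N : ℕ) (ξ : Euc (d + 1)) : ‖(xiBase ξ)⁻¹‖ ^ N ≤ wt (-(N : ℝ)) ξ := by
  rw [← norm_pow, ← xiSymbol_neg_nat]
  exact norm_xiSymbol_neg_le (Nat.cast_nonneg N) ξ

theorem memLp_wt_mul_rationalSymbol {r : ℝ} {N : ℕ} (hN : r ≤ N) (f : 𝓢(Euc d, ℂ)) (m k : ℕ)
    {n : ℕ} (h : m + k = n + 1) :
    MemLp (fun ξ => (wt r ξ : ℂ) * rationalSymbol f (N + m) k ξ) 2 volume := by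
  refine (memLp_rationalSymbol f h).mono ((wt_temperate r).1.continuous.aestronglyMeasurable.mul
    (memLp_rationalSymbol f (n := N + n) (by omega)).1) (ae_of_all _ fun ξ => ?_)
  have e : (wt r ξ : ℂ) * rationalSymbol f (N + m) k ξ =
      ((wt r ξ : ℂ) * (starRingEnd ℂ) (xiBase ξ)⁻¹ ^ N) * rationalSymbol f m k ξ := by
    simp only [rationalSymbol]
    ring
  rw [e, norm_mul]
  refine mul_le_of_le_one_left (norm_nonneg _) ?_
  rw [norm_mul, norm_pow, RCLike.norm_conj, Complex.norm_real, Real.norm_of_nonneg (wt_pos _ _).le]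
  calc wt r ξ * ‖(xiBase ξ)⁻¹‖ ^ N ≤ wt N ξ * wt (-(N : ℝ)) ξ :=
        mul_le_mul (wt_mono hN ξ) (norm_inv_xiBase_pow_le N ξ) (by positivity) (wt_pos _ _).le
    _ = 1 := by rw [← wt_add, add_neg_cancel, wt_zero]

theorem integral_rationalSymbol_mul_eq_zero {a r : ℝ} (ha0 : 0 < a) {N : ℕ} (hr : 0 ≤ r)
    (hN : r ≤ N) {V : L2 (d + 1)} (hV : V ∈ (weightedPow d a r)ᗮ) (f : 𝓢(Euc d, ℂ)) {m k n : ℕ}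
    (h : m + k = n + 1) :
    ∫ ξ, (starRingEnd ℂ) ((wt r ξ : ℂ) * rationalSymbol f (N + m) k ξ) * V ξ = 0 := by
  have hm := memLp_wt_mul_rationalSymbol hN f m k h
  have hm' := memLp_of_wt_mul hr hm
  have hmem : hm.toLp _ ∈ weightedPow d a r := by
    refine ⟨ofHat hm', exists_isPow_cut_of_rationalSymbol ha0 (N + n) (N + m) k (by omega) f _
      (fourier_ofHat hm'), ?_⟩
    filter_upwards [hm.coeFn_toLp, fourier_ofHat hm'] with ξ h1 h2
    rw [h1, h2]
  have h0 := (Submodule.mem_orthogonal _ _).1 hV _ hmem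
  rw [L2.inner_def] at h0
  rw [← h0]
  refine integral_congr_ae ?_
  filter_upwards [hm.coeFn_toLp] with ξ h1
  rw [h1, RCLike.inner_apply, mul_comm]

/-- Density of `weightedPow`, by completeness of the functions `f(ξ') (⟨ξ'⟩ ± iξ_n)^{-k-1}`. The extra
factor `(⟨ξ'⟩ - iξ_n)^{-N}`, `N ≥ r`, makes the rational symbols belong to `H^r`. -/
theorem orthogonal_weightedPow {a r : ℝ} (ha0 : 0 < a) (hr : 0 ≤ r) :
    (weightedPow d a r)ᗮ = ⊥ := by
  obtain ⟨N, hN⟩ := exists_nat_ge r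
  rw [eq_bot_iff]
  intro V hV
  have hc : Continuous fun ξ : Euc (d + 1) => (wt r ξ : ℂ) * (xiBase ξ)⁻¹ ^ N := by
    simp only [← xiSymbol_neg_nat]
    exact (wt_temperate r).1.continuous.mul (continuous_xiSymbol _)
  have hG : MemLp (fun ξ => ((wt r ξ : ℂ) * (xiBase ξ)⁻¹ ^ N) * V ξ) 2 volume := by
    refine memLp_bdd_mul hc (K := 1) (fun ξ => ?_) (Lp.memLp V)
    rw [norm_mul, norm_pow, Complex.norm_real, Real.norm_of_nonneg (wt_pos _ _).le]
    calc wt r ξ * ‖(xiBase ξ)⁻¹‖ ^ N ≤ wt N ξ * wt (-(N : ℝ)) ξ :=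
          mul_le_mul (wt_mono hN ξ) (norm_inv_xiBase_pow_le N ξ) (by positivity) (wt_pos _ _).le
      _ = 1 := by rw [← wt_add, add_neg_cancel, wt_zero]
  have hconj : ∀ f : 𝓢(Euc d, ℂ), ∃ g : 𝓢(Euc d, ℂ), ∀ η, (starRingEnd ℂ) (g η) = f η :=
    fun f => ⟨f.postcompCLM (Complex.conjCLE : ℂ →L[ℝ] ℂ), fun η => by
      rw [SchwartzMap.postcompCLM_apply]
      simp⟩
  have key := ae_eq_zero_of_forall_xiSymbol hG (fun k f => ?_) (fun k f => ?_)
  · refine (Submodule.mem_bot ℂ).2 (Lp.ext ?_)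
    filter_upwards [key, Lp.coeFn_zero ℂ 2 (volume : Measure (Euc (d + 1)))] with ξ h1 h2
    rw [h2]
    have h3 : (wt r ξ : ℂ) * (xiBase ξ)⁻¹ ^ N ≠ 0 :=
      mul_ne_zero (by exact_mod_cast (wt_pos r ξ).ne') (pow_ne_zero _ (inv_ne_zero (xiBase_ne_zero ξ)))
    exact (mul_eq_zero.1 h1).resolve_left h3
  · obtain ⟨g, hg⟩ := hconj f
    rw [← integral_rationalSymbol_mul_eq_zero ha0 hr hN hV g (m := k + 1) (k := 0) (n := k) rfl]
    refine integral_congr_ae (ae_of_all _ fun ξ => ?_)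
    simp only [rationalSymbol, xiSymbol_neg_succ, map_mul, map_pow, Complex.conj_conj, hg,
      Complex.conj_ofReal]
    ring
  · obtain ⟨g, hg⟩ := hconj f
    rw [← integral_rationalSymbol_mul_eq_zero ha0 hr hN hV g (m := 0) (k := k + 1) (n := k) (by omega)]
    refine integral_congr_ae (ae_of_all _ fun ξ => ?_)
    simp only [rationalSymbol, xiSymbol_neg_succ, map_mul, map_pow, Complex.conj_conj, hg,
      Complex.conj_ofReal]
    ring

/-- Every `F ∈ H^r` is approximated in `H^r` by functions `G` with `Ξ_+^{-a} e⁺ r⁺ G ∈ x_n^a 𝒮`. -/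
theorem exists_hNorm_sub_lt {a r : ℝ} (ha0 : 0 < a) (hr : 0 ≤ r) {F : L2 (d + 1)}
    (hF : hNorm r F < ∞) {ε : ℝ≥0∞} (hε : 0 < ε) :
    ∃ G : L2 (d + 1), hNorm r G < ∞ ∧ (∃ φ, IsPow a (cut G) φ) ∧ hNorm r (F - G) < ε := by
  have hm := memLp_of_hNorm hF
  have hcl : hm.toLp _ ∈ closure (weightedPow d a r : Set (L2 (d + 1))) := by
    have h := Submodule.topologicalClosure_eq_top_iff.2 (orthogonal_weightedPow (d := d) ha0 hr)
    have : hm.toLp _ ∈ (weightedPow d a r).topologicalClosure := by rw [h]; trivial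
    exact this
  obtain ⟨V, ⟨G, hG, hVG⟩, hlt⟩ := EMetric.mem_closure_iff.1 hcl ε hε
  refine ⟨G, ?_, hG, ?_⟩
  · exact lt_of_le_of_lt (le_of_eq (eLpNorm_congr_ae hVG.symm)) (Lp.memLp V).2
  · refine lt_of_le_of_lt (le_of_eq ?_) hlt
    rw [Lp.edist_def]
    refine eLpNorm_congr_ae ?_
    filter_upwards [fourier_sub_ae F G, hm.coeFn_toLp, hVG] with ξ h1 h2 h3
    rw [Pi.sub_apply, h1, h2, h3, mul_sub]

/-! ### Decomposition of the transmission space, and uniqueness of the trace -/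

theorem fourier_powPoisson_eq_extend {a : ℝ} (ha : 0 ≤ a) (ψ : L2 d) :
    ((𝓕 (powPoisson ha ψ) : L2 (d + 1)) : Euc (d + 1) → ℂ) =ᵐ[volume] fun ξ =>
      xiSymbol (-a) ξ * (𝓕 (cut ((Real.Gamma (a + 1) : ℂ) • extend ψ)) : L2 (d + 1)) ξ := by
  rw [cut_smul, cut_extend]
  filter_upwards [fourier_powPoisson ha ψ, fourier_powPoisson le_rfl ψ,
    fourier_smul_ae (Real.Gamma (a + 1) : ℂ) (powPoisson le_rfl ψ)] with ξ h1 h2 h3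
  rw [h1, h3, h2, zero_add, Real.Gamma_one, neg_add, xiSymbol_add]
  push_cast
  ring

/-- `x_n^a K₀ψ` lies in the transmission space and has trace `ψ`. -/
theorem isTraceOf_powPoisson {a r : ℝ} (ha : 0 ≤ a) (hr : 1 / 2 ≤ r) {ψ : L2 d}
    (hψ : hNorm (r - 1 / 2) ψ < ∞) :
    IsTraceOf a r (powPoisson ha ψ : 𝓢'(Euc (d + 1), ℂ)) ψ := by
  refine ⟨(Real.Gamma (a + 1) : ℂ) • extend ψ, ?_,
    ((Xi_coe_eq_iff _ _ _).2 (fourier_powPoisson_eq_extend ha ψ)).symm, ?_⟩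
  · rw [hNorm_smul]
    exact ENNReal.mul_lt_top enorm_lt_top (hNorm_extend_lt_top hr hψ)
  · filter_upwards [fiberInt_fourier_smul (Real.Gamma (a + 1) : ℂ) (extend ψ),
      fiberInt_fourier_extend ψ] with η h1 h2
    rw [h1, h2]

/-- Elements of `H^{2a}` supported in the closed half-space have weighted trace zero. -/
theorem isTraceOf_supported {a : ℝ} (ha : 1 / 2 < a) (ha1 : a < 1) {v : 𝓢'(Euc (d + 1), ℂ)}
    (hv : v ∈ supported d (2 * a)) : IsTraceOf a a v 0 := by
  obtain ⟨V, rfl, hV⟩ := exists_coe_of_mem_sobolev (by linarith) hv.1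
  have hup : IsUpper V := (dsupport_coe_subset_iff V).1 hv.2
  rw [two_mul] at hV
  obtain ⟨F, hF, hFV, htr⟩ := hup.exists_lift (by linarith) ha1 ha hV
  refine ⟨F, hF, ((Xi_coe_eq_iff _ _ _).2 hFV).symm, ?_⟩
  filter_upwards [htr, fourier_smul_ae 0 (0 : L2 d)] with η h1 h2
  rw [zero_smul, zero_mul] at h2
  rw [h1, h2, mul_zero, Pi.zero_apply]

theorem isTraceOf_add_of_isRepBy {a : ℝ} (ha : 1 / 2 < a) (ha1 : a < 1)
    {v w : 𝓢'(Euc (d + 1), ℂ)} (hv : v ∈ supported d (2 * a)) {ψ : L2 d}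
    (hψ : (ψ : 𝓢'(Euc d, ℂ)) ∈ sobolev d (a - 1 / 2))
    (hw : IsRepBy w (nrmPowMul a (poisson ψ))) : IsTraceOf a a (v + w) ψ := by
  have ha0 : 0 ≤ a := by linarith
  have h := (isTraceOf_supported ha ha1 hv).add ha
    (isTraceOf_powPoisson ha0 ha.le ((coe_mem_sobolev_iff _ _).1 hψ))
  rwa [zero_add, ← hw.unique (isRepBy_coe_of_ae_eq (powPoisson_ae ha0 ψ))] at h

/-- An element of the transmission space of order `2a` minus `x_n^a K₀` of its trace lies in `H^{2a}`:
after subtraction of the extension of its trace, `F` can be cut off at the boundary. -/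
theorem IsTraceOf.exists_decomposition {a : ℝ} (ha : 1 / 2 < a) (ha1 : a < 1)
    {u : 𝓢'(Euc (d + 1), ℂ)} {ψ : L2 d} (h : IsTraceOf a a u ψ) (hψ : hNorm (a - 1 / 2) ψ < ∞) :
    ∃ v ∈ supported d (2 * a), u = v + powPoisson (by linarith : 0 ≤ a) ψ := by
  have ha0 : 0 ≤ a := by linarith
  obtain ⟨F, hF, rfl, htr⟩ := h
  obtain ⟨G, hG, hu, htr'⟩ := isTraceOf_powPoisson ha0 ha.le hψ
  have hZ : hNorm a (F - G) < ∞ :=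
    (hNorm_sub_le _ _ _).trans_lt (ENNReal.add_lt_top.2 ⟨hF, hG⟩)
  have h0 : fiberInt (𝓕 (F - G) : L2 (d + 1)) =ᵐ[volume] 0 := by
    filter_upwards [fiberInt_fourier_sub ha hF hG, htr, htr'] with η h1 h2 h3
    rw [h1, h2, h3, sub_self, Pi.zero_apply]
  have hcut := hNorm_cut_lt_top ha ha1 hZ h0
  have hV := fourier_invXi ha0 (cut (F - G))
  refine ⟨invXi ha0 (cut (F - G)), ⟨(coe_mem_sobolev_iff _ _).2 ?_, (dsupport_coe_subset_iff _).2
    (isUpper_of_fourier_eq_xiSymbol_neg ha0 (isUpper_cut _) hV)⟩, ?_⟩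
  · refine lt_of_le_of_lt (eLpNorm_mono_ae ?_) hcut
    filter_upwards [hV] with ξ h
    simp only [h, norm_mul, Complex.norm_real, Real.norm_of_nonneg (wt_pos _ _).le]
    rw [two_mul, wt_add, ← mul_assoc]
    refine mul_le_mul_of_nonneg_right ?_ (norm_nonneg _)
    calc wt a ξ * wt a ξ * ‖xiSymbol (-a) ξ‖ ≤ wt a ξ * wt a ξ * wt (-a) ξ :=
          mul_le_mul_of_nonneg_left (norm_xiSymbol_neg_le ha0 ξ)
            (mul_pos (wt_pos _ _) (wt_pos _ _)).le
      _ = wt a ξ := by rw [mul_assoc, ← wt_add, add_neg_cancel, wt_zero, mul_one]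
  · rw [hu, ← (Xi_coe_eq_iff _ _ _).2 hV, ← map_add, ← coe_add, cut_sub, sub_add_cancel]

theorem eq_zero_of_sobolevENorm_eq_zero {k : ℕ} {s : ℝ} (hs : 0 ≤ s) {u : 𝓢'(Euc k, ℂ)}
    (h : sobolevENorm s u = 0) : u = 0 := by
  obtain ⟨U, rfl, -⟩ := exists_coe_of_sobolevENorm hs (h.trans_lt ENNReal.zero_lt_top)
  rw [sobolevENorm_coe] at h
  have h1 : ‖U‖ₑ = 0 := by
    rw [← hNorm_zero_order]
    exact le_antisymm ((hNorm_mono hs U).trans h.le) zero_le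
  rw [enorm_eq_zero.1 h1]
  exact map_zero (Lp.toTemperedDistributionCLM ℂ (volume : Measure (Euc k)) 2)

theorem sobolevENorm_sub_le {k : ℕ} {s : ℝ} (hs : 0 ≤ s) {u v : 𝓢'(Euc k, ℂ)}
    (hu : u ∈ sobolev k s) (hv : v ∈ sobolev k s) :
    sobolevENorm s (u - v) ≤ sobolevENorm s u + sobolevENorm s v := by
  obtain ⟨U, rfl, -⟩ := exists_coe_of_mem_sobolev hs hu
  obtain ⟨V, rfl, -⟩ := exists_coe_of_mem_sobolev hs hv
  rw [← coe_sub, sobolevENorm_coe, sobolevENorm_coe, sobolevENorm_coe]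
  exact hNorm_sub_le _ _ _

theorem exists_transmissionENorm_sub_lt {a t : ℝ} (ha0 : 0 < a) (ht : 0 ≤ t - a)
    {u : 𝓢'(Euc (d + 1), ℂ)} (hu : u ∈ transmission d a t) {ε : ℝ≥0∞} (hε : 0 < ε) :
    ∃ φ : 𝓢(Euc (d + 1), ℂ), ∃ p ∈ transmission d a t, IsRepBy p (nrmPowMul a φ) ∧
      transmissionENorm a t (u - p) < ε := by
  obtain ⟨F, hF, rfl⟩ := (mem_transmission_iff ht u).1 hu
  obtain ⟨G, hG, ⟨φ, W, hW, hWφ⟩, hlt⟩ := exists_hNorm_sub_lt ha0 ht hF hε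
  refine ⟨φ, Xi (-a) (cut G), (mem_transmission_iff ht _).2 ⟨G, hG, rfl⟩, ?_, ?_⟩
  · rw [(Xi_coe_eq_iff _ _ _).2 hW]
    exact isRepBy_coe_of_ae_eq hWφ
  · rw [← map_sub, ← coe_sub, ← cut_sub]
    exact (transmissionENorm_le ht _).trans_lt hlt

theorem IsTrace.unique {a t : ℝ} (ha0 : 0 < a) (ht : 1 / 2 < t - a)
    {γ γ' : transmission d a t →ₗ[ℂ] sobolev d (t - a - 1 / 2)} (h : IsTrace a t γ)
    (h' : IsTrace a t γ') : γ = γ' := by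
  obtain ⟨⟨C, hC⟩, hγ⟩ := h
  obtain ⟨⟨C', hC'⟩, hγ'⟩ := h'
  have hs : 0 ≤ t - a - 1 / 2 := by linarith
  refine LinearMap.ext fun u => Subtype.ext (sub_eq_zero.1 ?_)
  refine eq_zero_of_sobolevENorm_eq_zero hs ?_
  have hle : ∀ ε : ℝ≥0∞, 0 < ε → sobolevENorm (t - a - 1 / 2)
      ((γ u : 𝓢'(Euc d, ℂ)) - (γ' u : 𝓢'(Euc d, ℂ))) ≤ (C + C' : ℝ≥0) * ε := by
    intro ε hε
    obtain ⟨φ, p, hp, hφ, hlt⟩ := exists_transmissionENorm_sub_lt ha0 (by linarith) u.2 hε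
    have e : (γ ⟨p, hp⟩ : 𝓢'(Euc d, ℂ)) = γ' ⟨p, hp⟩ :=
      (hγ φ ⟨p, hp⟩ hφ).unique (hγ' φ ⟨p, hp⟩ hφ)
    have e2 : (γ u : 𝓢'(Euc d, ℂ)) - (γ' u : 𝓢'(Euc d, ℂ)) =
        (γ (u - ⟨p, hp⟩) : 𝓢'(Euc d, ℂ)) - (γ' (u - ⟨p, hp⟩) : 𝓢'(Euc d, ℂ)) := by
      rw [map_sub, map_sub, Submodule.coe_sub, Submodule.coe_sub, e, sub_sub_sub_cancel_right]
    rw [e2]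
    refine (sobolevENorm_sub_le hs (γ _).2 (γ' _).2).trans ?_
    rw [ENNReal.coe_add, add_mul]
    exact add_le_add ((hC _).trans (mul_le_mul_right hlt.le _))
      ((hC' _).trans (mul_le_mul_right hlt.le _))
  refine le_antisymm (ENNReal.le_of_forall_pos_le_add fun δ hδ _ => ?_) zero_le
  rw [zero_add]
  have hK : (0 : ℝ≥0) < C + C' + 1 := by positivity
  refine (hle (δ / (C + C' + 1) : ℝ≥0) (by exact_mod_cast div_pos hδ hK)).trans ?_
  rw [← ENNReal.coe_mul]
  refine ENNReal.coe_le_coe.2 ?_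
  rw [mul_div_assoc', div_le_iff₀ hK, mul_comm]
  exact mul_le_mul_right (le_add_of_nonneg_right zero_le_one) δ

end HalfSpace

end

theorem theorem1p2 (d : ℕ) (a : ℝ) (ha0 : 0 < a) (ha1 : a < 1) :
    -- Part 1, for `1/2 < a < 1`
    (1 / 2 < a →
      -- for every `ψ ∈ H^{a-1/2}`, the function `x_n^a K₀ψ` is a tempered distribution
      (∀ ψ : Lp ℂ 2 (volume : Measure (HalfSpace.Euc d)),
        (ψ : 𝓢'(HalfSpace.Euc d, ℂ)) ∈ HalfSpace.sobolev d (a - 1 / 2) →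
          ∃ w : 𝓢'(HalfSpace.Euc (d + 1), ℂ),
            HalfSpace.IsRepBy w (HalfSpace.nrmPowMul a (HalfSpace.poisson ψ))) ∧
      ∀ u : 𝓢'(HalfSpace.Euc (d + 1), ℂ),
        u ∈ HalfSpace.transmission d a (2 * a) ↔
          ∃ v ∈ HalfSpace.supported d (2 * a),
          ∃ ψ : Lp ℂ 2 (volume : Measure (HalfSpace.Euc d)),
            (ψ : 𝓢'(HalfSpace.Euc d, ℂ)) ∈ HalfSpace.sobolev d (a - 1 / 2) ∧
          ∃ w : 𝓢'(HalfSpace.Euc (d + 1), ℂ),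
            HalfSpace.IsRepBy w (HalfSpace.nrmPowMul a (HalfSpace.poisson ψ)) ∧ u = v + w) ∧
    -- Part 2
    (∀ t : ℝ, a + 1 / 2 < t →
      -- `x_n^a 𝒮` is contained in `H^{a(t)}` ...
      (∀ φ : 𝓢(HalfSpace.Euc (d + 1), ℂ), ∃ p ∈ HalfSpace.transmission d a t,
        HalfSpace.IsRepBy p (HalfSpace.nrmPowMul a φ)) ∧
      -- ... and dense
      (∀ u ∈ HalfSpace.transmission d a t, ∀ ε : ℝ≥0∞, 0 < ε →
        ∃ (φ : 𝓢(HalfSpace.Euc (d + 1), ℂ)), ∃ p ∈ HalfSpace.transmission d a t,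
          HalfSpace.IsRepBy p (HalfSpace.nrmPowMul a φ) ∧
          HalfSpace.transmissionENorm a t (u - p) < ε) ∧
      -- the trace extends continuously, in a unique way
      ∃! γ : HalfSpace.transmission d a t →ₗ[ℂ] HalfSpace.sobolev d (t - a - 1 / 2),
        HalfSpace.IsTrace a t γ) ∧
    -- `ψ` is the trace of `u`
    (1 / 2 < a →
      ∀ γ : HalfSpace.transmission d a (2 * a) →ₗ[ℂ] HalfSpace.sobolev d (2 * a - a - 1 / 2),
        HalfSpace.IsTrace a (2 * a) γ →
        ∀ u : HalfSpace.transmission d a (2 * a), ∀ v ∈ HalfSpace.supported d (2 * a),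
        ∀ ψ : Lp ℂ 2 (volume : Measure (HalfSpace.Euc d)),
          (ψ : 𝓢'(HalfSpace.Euc d, ℂ)) ∈ HalfSpace.sobolev d (a - 1 / 2) →
        ∀ w : 𝓢'(HalfSpace.Euc (d + 1), ℂ),
          HalfSpace.IsRepBy w (HalfSpace.nrmPowMul a (HalfSpace.poisson ψ)) →
          (u : 𝓢'(HalfSpace.Euc (d + 1), ℂ)) = v + w →
            (γ u : 𝓢'(HalfSpace.Euc d, ℂ)) = (ψ : 𝓢'(HalfSpace.Euc d, ℂ))) := by
  have e2 : 2 * a - a = a := by ring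
  refine ⟨fun ha => ⟨fun ψ _ => ?_, fun u => ⟨fun hu => ?_, ?_⟩⟩, fun t ht => ⟨fun φ => ?_, ?_, ?_⟩,
    fun ha γ hγ u v hv ψ hψ w hw huvw => ?_⟩
  · exact ⟨_, HalfSpace.isRepBy_coe_of_ae_eq (HalfSpace.powPoisson_ae ha0.le ψ)⟩
  · obtain ⟨ψ, hψ⟩ := HalfSpace.exists_isTraceOf ha0.le (by linarith) hu
    have hm := hψ.mem_sobolev ha0.le (by linarith)
    rw [e2] at hψ hm
    obtain ⟨v, hv, huv⟩ :=
      hψ.exists_decomposition ha ha1 ((HalfSpace.coe_mem_sobolev_iff _ _).1 hm)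
    exact ⟨v, hv, ψ, hm, _, HalfSpace.isRepBy_coe_of_ae_eq (HalfSpace.powPoisson_ae ha0.le ψ), huv⟩
  · rintro ⟨v, hv, ψ, hψ, w, hw, rfl⟩
    obtain ⟨F, hF, hu, -⟩ := HalfSpace.isTraceOf_add_of_isRepBy ha ha1 hv hψ hw
    exact (HalfSpace.mem_transmission_iff (by linarith) _).2 ⟨F, by rwa [e2], hu⟩
  · obtain ⟨F, hF⟩ := HalfSpace.exists_isLift ha0 ha1 (by linarith : 1 / 2 < t - a) φ
    obtain ⟨p, hpF, hp, -⟩ := hF.isTraceOf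
    exact ⟨p, (HalfSpace.mem_transmission_iff (by linarith) _).2 ⟨F, hF.1, hpF⟩, hp⟩
  · exact fun u hu ε hε => HalfSpace.exists_transmissionENorm_sub_lt ha0 (by linarith) hu hε
  · obtain ⟨γ, hγ, -⟩ := HalfSpace.exists_isTrace (d := d) ha0 ha1 (by linarith : 1 / 2 < t - a)
    exact ⟨γ, hγ, fun γ' hγ' => hγ'.unique ha0 (by linarith) hγ⟩
  · have ht : 1 / 2 < 2 * a - a := by linarith
    obtain ⟨γ', hγ', h⟩ := HalfSpace.exists_isTrace (d := d) ha0 ha1 ht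
    obtain rfl := hγ.unique ha0 ht hγ'
    obtain ⟨θ, hθ, e⟩ := h u
    have hψu := HalfSpace.isTraceOf_add_of_isRepBy ha ha1 hv hψ hw
    rw [← huvw] at hψu
    rw [e2] at hθ
    rw [e, hθ.unique ha0.le ha hψu]
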